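/- Let $k$ be an algebraically closed field and let $B=\bigoplus_{n\ge 0}B_n$ be a finite dimensional positively graded $k$-algebra. Let $\Lambda$ be a finite poset indexing the isomorphism classes of irreducible $B_0$-modules $L(\lambda)$; they are also the irreducible $B$-modules, through the projection $B\to B_0$. Let $\mathrm{ext}^\bullet_B$ denote the Ext-bifunctor of the abelian category of finite dimensional $\mathbb Z$-graded $B$-modules (morphisms preserve degrees), and put $M\langle r\rangle_i=M_{i-r}$. For a finite dimensional algebra $A$ with irreducible modules $L(\lambda)$, $\lambda\in\Lambda$, the standard module $\Delta(\lambda)$ (respectively, costandard module $\nabla(\lambda)$) is the projective cover (respectively, injective envelope) of $L(\lambda)$ in the category of finite dimensional $A$-modules all of whose composition factors are $L(\mu)$ with $\mu\le\lambda$. The algebra $A$ is quasi-hereditary with weight poset $\Lambda$ if, for every $\lambda$, the kernel of $\Delta(\lambda)\to L(\lambda)$ has only composition factors $L(\mu)$ with $\mu<\lambda$, and the projective cover of $L(\lambda)$ has a finite filtration with top section $\Delta(\lambda)$ and all other sections of the form $\Delta(\mu)$ with $\mu>\lambda$. If $B$ is quasi-hereditary with weight poset $\Lambda$, its standard and costandard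 modules have natural gradings $\Delta(\lambda)=\bigoplus_{i\ge0}\Delta(\lambda)_i$ and $\nabla(\lambda)=\bigoplus_{i\le0}\nabla(\lambda)_i$ with the head, respectively the socle, $L(\lambda)$ in degree $0$. Let $\Delta^0(\lambda)=\Delta(\lambda)_0$ and $\nabla_0(\lambda)=\nabla(\lambda)_0$, regarded as graded $B$-modules concentrated in degree $0$. Call $B$ standard Q-Koszul if it is quasi-hereditary with weight poset $\Lambda$ and, for all $\lambda,\mu\in\Lambda$, $n\in\mathbb N$, $r\in\mathbb Z$, $$\mathrm{ext}^n_B(\Delta(\lambda),\nabla_0(\mu)\langle r\rangle)\ne0\implies n=r,\qquad \mathrm{ext}^n_B(\Delta^0(\mu),\nabla(\lambda)\langle r\rangle)\ne0\implies n=r.$$ **Corollary.** Assume that $B$ is standard Q-Koszul with weight poset $\Lambda$. Then for all $\lambda,\mu\in\Lambda$, $n\in\mathbb N$ and $r\in\mathbb Z$, $$\mathrm{ext}^n_B(\Delta^0(\lambda),\nabla_0(\mu)\langle r\rangle)\ne0\implies n=r.$$ Therefore $B$ is a Q-Koszul algebra, that is: $B_0$ is quasi-hereditary with weight poset $\Lambda$,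 and the displayed implication holds when $\Delta^0(\lambda)$ and $\nabla_0(\mu)$ denote the standard and costandard modules of $B_0$, regarded as graded $B$-modules concentrated in degree $0$. -/

import Mathlib

open CategoryTheory CategoryTheory.Limits

universe u v

noncomputable section

/-! ### Finite dimensional modules, standard and costandard modules, quasi-heredity -/

/-- A finite dimensional (left) module over a `k`-algebra `A`. -/
structure FDMod (k A : Type u) [Field k] [Ring A] [Algebra k A] : Type (u + 1) where
  carrier : Type u
  [addCommGroup : AddCommGroup carrier]
  [moduleBase : Module k carrier]
  [module : Module A carrier]
  [isScalarTower : IsScalarTower k A carrier]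
  [finite : Module.Finite k carrier]

namespace FDMod

attribute [instance] addCommGroup moduleBase module isScalarTower finite

instance (k A : Type u) [Field k] [Ring A] [Algebra k A] : CoeSort (FDMod k A) (Type u) :=
  ⟨FDMod.carrier⟩

end FDMod

/-- `S` is a composition factor of `M`: it is simple and a quotient of a submodule of `M`. -/
def IsCompositionFactor (A S M : Type u) [Ring A] [AddCommGroup S] [Module A S]
    [AddCommGroup M] [Module A M] : Prop :=
  IsSimpleModule A S ∧ ∃ (N : Submodule A M) (f : N →ₗ[A] S), Function.Surjective f

section QuasiHereditary

variable {k A : Type u} [Field k] [Ring A] [Algebra k A] {Λ : Type v}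

/-- `L` lists each simple `A`-module exactly once up to isomorphism. -/
structure IsSimpleIndexing (L : Λ → FDMod k A) : Prop where
  simple : ∀ l, IsSimpleModule A (L l)
  injective : ∀ l m, Nonempty (L l ≃ₗ[A] L m) → l = m
  complete : ∀ S : FDMod k A, IsSimpleModule A S → ∃ l, Nonempty (S ≃ₗ[A] L l)

/-- `M` has only composition factors `L m` with `m ≤ l`. -/
def FactorsLE [PartialOrder Λ] (L : Λ → FDMod k A) (l : Λ) (M : FDMod k A) : Prop :=
  ∀ m, IsCompositionFactor A (L m) M → m ≤ l

/-- `D` is a standard module `Δ(l)`: a projective cover of `L l` in the category of finite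
dimensional modules all of whose composition factors are `L m` with `m ≤ l` (equivalently, the
largest quotient with such factors of the projective cover of `L l`). -/
structure IsStandard [PartialOrder Λ] (L : Λ → FDMod k A) (l : Λ) (D : FDMod k A) : Prop where
  factors : FactorsLE L l D
  cover : ∃ p : D →ₗ[A] L l, Function.Surjective p ∧
    ∀ N : Submodule A D, N ⊔ LinearMap.ker p = ⊤ → N = ⊤
  projective : ∀ X Y : FDMod k A, FactorsLE L l X → FactorsLE L l Y →
    ∀ (g : X →ₗ[A] Y) (f : D →ₗ[A] Y), Function.Surjective g → ∃ h : D →ₗ[A] X, g ∘ₗ h = f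

/-- `N` is a costandard module `∇(l)`: an injective envelope of `L l` in the category of finite
dimensional modules all of whose composition factors are `L m` with `m ≤ l` (equivalently, the
largest submodule with such factors of the injective envelope of `L l`). -/
structure IsCostandard [PartialOrder Λ] (L : Λ → FDMod k A) (l : Λ) (N : FDMod k A) : Prop where
  factors : FactorsLE L l N
  envelope : ∃ i : L l →ₗ[A] N, Function.Injective i ∧
    ∀ S : Submodule A N, S ⊓ LinearMap.range i = ⊥ → S = ⊥
  injective : ∀ X Y : FDMod k A, FactorsLE L l X → FactorsLE L l Y →
    ∀ (g : X →ₗ[A] Y) (f : X →ₗ[A] N), Function.Injective g → ∃ h : Y →ₗ[A] N, h ∘ₗ g = f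

/-- The algebra `A` is quasi-hereditary with weight poset `Λ`, its simple modules being
`L l`, `l ∈ Λ`: each standard module `Δ(l)` has head `L l`, all other composition factors are `L m`
with `m < l`, and each `L l` has a projective cover `P` with a finite filtration
`P = F 0 ⊇ F 1 ⊇ ⋯ ⊇ F (n + 1) = 0` with `F 0 / F 1 ≅ Δ(l)` and every other section isomorphic to
some `Δ(m)` with `m > l`. -/
def IsQuasiHereditary [PartialOrder Λ] (L : Λ → FDMod k A) : Prop :=
  IsSimpleIndexing L ∧
  ∃ D : Λ → FDMod k A,
    (∀ l, IsStandard L l (D l)) ∧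
    (∀ l, ∃ p : D l →ₗ[A] L l, Function.Surjective p ∧
      ∀ m, IsCompositionFactor A (L m) (LinearMap.ker p) → m < l) ∧
    (∀ l, ∃ P : FDMod k A, Module.Projective A P ∧
      (∃ p : P →ₗ[A] L l, Function.Surjective p ∧
        ∀ N : Submodule A P, N ⊔ LinearMap.ker p = ⊤ → N = ⊤) ∧
      ∃ (n : ℕ) (F : ℕ → Submodule A P), Antitone F ∧ F 0 = ⊤ ∧ F (n + 1) = ⊥ ∧
        Nonempty ((F 0 ⧸ (F 1).submoduleOf (F 0)) ≃ₗ[A] D l) ∧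
        ∀ i, 1 ≤ i → i ≤ n → ∃ m, l < m ∧
          Nonempty ((F i ⧸ (F (i + 1)).submoduleOf (F i)) ≃ₗ[A] D m))

end QuasiHereditary

/-! ### The abelian category of finite dimensional graded modules -/

section GradedModules

variable {k B : Type u} [Field k] [Ring B] [Algebra k B]

/-- A finite dimensional `ℤ`-graded module `M = ⨁ M_i` over the `ℕ`-graded algebra `B = ⨁ 𝒜 n`. -/
structure GrMod (𝒜 : ℕ → Submodule k B) : Type (u + 1) where
  carrier : Type u
  [addCommGroup : AddCommGroup carrier]
  [moduleBase : Module k carrier]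
  [module : Module B carrier]
  [isScalarTower : IsScalarTower k B carrier]
  [finite : Module.Finite k carrier]
  deg : ℤ → Submodule k carrier
  isInternal : DirectSum.IsInternal deg
  smul_mem : ∀ {n : ℕ} {i : ℤ} {b : B} {x : carrier}, b ∈ 𝒜 n → x ∈ deg i → b • x ∈ deg (n + i)

namespace GrMod

attribute [instance] addCommGroup moduleBase module isScalarTower finite

variable {𝒜 : ℕ → Submodule k B}

instance : CoeSort (GrMod 𝒜) (Type u) := ⟨GrMod.carrier⟩

/-- Morphisms of graded modules: `B`-linear maps that preserve degrees. -/
@[ext]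
structure Hom (M N : GrMod 𝒜) where
  lin : M →ₗ[B] N
  map_mem : ∀ {i : ℤ} {x : M}, x ∈ M.deg i → lin x ∈ N.deg i

instance : Category (GrMod 𝒜) where
  Hom := Hom
  id M := ⟨LinearMap.id, fun h => h⟩
  comp f g := ⟨g.lin ∘ₗ f.lin, fun h => g.map_mem (f.map_mem h)⟩

@[ext]
theorem hom_ext {M N : GrMod 𝒜} {f g : M ⟶ N} (h : ∀ x, f.lin x = g.lin x) : f = g :=
  Hom.ext (LinearMap.ext h)

@[simp] theorem id_lin (M : GrMod 𝒜) (x : M) : Hom.lin (𝟙 M) x = x := rfl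

@[simp] theorem comp_lin {M N P : GrMod 𝒜} (f : M ⟶ N) (g : N ⟶ P) (x : M) :
    Hom.lin (f ≫ g) x = g.lin (f.lin x) := rfl

instance (M N : GrMod 𝒜) : Zero (M ⟶ N) := ⟨⟨0, fun _ => (N.deg _).zero_mem⟩⟩

instance (M N : GrMod 𝒜) : Add (M ⟶ N) :=
  ⟨fun f g => ⟨f.lin + g.lin, fun h => (N.deg _).add_mem (f.map_mem h) (g.map_mem h)⟩⟩

instance (M N : GrMod 𝒜) : Neg (M ⟶ N) :=
  ⟨fun f => ⟨-f.lin, fun h => (N.deg _).neg_mem (f.map_mem h)⟩⟩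

@[simp] theorem zero_lin {M N : GrMod 𝒜} (x : M) : Hom.lin (0 : M ⟶ N) x = 0 := rfl

@[simp] theorem add_lin {M N : GrMod 𝒜} (f g : M ⟶ N) (x : M) :
    Hom.lin (f + g) x = f.lin x + g.lin x := rfl

@[simp] theorem neg_lin {M N : GrMod 𝒜} (f : M ⟶ N) (x : M) :
    Hom.lin (-f) x = -f.lin x := rfl

instance (M N : GrMod 𝒜) : AddCommGroup (M ⟶ N) where
  add_assoc f g h := by ext; simp [add_assoc]
  zero_add f := by ext; simp
  add_zero f := by ext; simp
  add_comm f g := by ext; simp [add_comm]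
  neg_add_cancel f := by ext; simp
  nsmul := nsmulRec
  zsmul := zsmulRec

instance : Preadditive (GrMod 𝒜) where
  add_comp := by intros; ext; simp
  comp_add := by intros; ext; simp

instance (M : GrMod 𝒜) : DirectSum.Decomposition M.deg := M.isInternal.chooseDecomposition

/-- The homogeneous component of degree `i` of an element of a graded module. -/
def comp (M : GrMod 𝒜) (i : ℤ) : M →+ M where
  toFun x := (DirectSum.decompose M.deg x i : M)
  map_zero' := by simp
  map_add' x y := by simp

theorem comp_mem (M : GrMod 𝒜) (i : ℤ) (x : M) : M.comp i x ∈ M.deg i :=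
  (DirectSum.decompose M.deg x i).2

theorem comp_of_mem (M : GrMod 𝒜) {i : ℤ} {x : M} (h : x ∈ M.deg i) : M.comp i x = x :=
  DirectSum.decompose_of_mem_same _ h

theorem comp_of_mem_ne (M : GrMod 𝒜) {i j : ℤ} {x : M} (h : x ∈ M.deg i) (hij : i ≠ j) :
    M.comp j x = 0 :=
  DirectSum.decompose_of_mem_ne _ h hij

theorem exists_sum_comp (M : GrMod 𝒜) (x : M) : ∃ s : Finset ℤ, ∑ i ∈ s, M.comp i x = x := by
  classical
  exact ⟨_, DirectSum.sum_support_decompose M.deg x⟩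

theorem comp_lin_comm {M N : GrMod 𝒜} (f : M ⟶ N) (i : ℤ) (x : M) :
    N.comp i (f.lin x) = f.lin (M.comp i x) := by
  obtain ⟨s, hs⟩ := M.exists_sum_comp x
  have key : ∀ j, N.comp i (f.lin (M.comp j x)) = f.lin (M.comp i (M.comp j x)) := by
    intro j
    by_cases h : j = i
    · subst h
      rw [comp_of_mem _ (f.map_mem (M.comp_mem _ x)), comp_of_mem _ (M.comp_mem _ x)]
    · rw [comp_of_mem_ne _ (f.map_mem (M.comp_mem _ x)) h, comp_of_mem_ne _ (M.comp_mem _ x) h,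
        map_zero]
  rw [← hs]
  simp only [map_sum, key]

/-- A criterion for a family of subspaces to be a grading. -/
theorem isInternal_of_components {V : Type u} [AddCommGroup V] [Module k V]
    (d : ℤ → Submodule k V) (c : ℤ → V →+ V) (h1 : ∀ i x, c i x ∈ d i)
    (h2 : ∀ i x, x ∈ d i → c i x = x) (h3 : ∀ i j x, x ∈ d i → i ≠ j → c j x = 0)
    (h4 : ∀ x, ∃ s : Finset ℤ, ∑ i ∈ s, c i x = x) : DirectSum.IsInternal d := by
  classical
  have key : ∀ (x : DirectSum ℤ fun i => d i) (j : ℤ),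
      c j (DirectSum.coeAddMonoidHom d x) = x j := by
    intro x j
    induction x using DirectSum.induction_on with
    | zero => simp
    | of i y =>
      rw [DirectSum.coeAddMonoidHom_of]
      by_cases h : i = j
      · subst h
        rw [h2 _ _ y.2, DirectSum.of_eq_same]
      · rw [h3 _ _ _ y.2 h, DirectSum.of_eq_of_ne _ _ _ (Ne.symm h)]
        rfl
    | add x y hx hy => rw [map_add, map_add, hx, hy]; rfl
  refine ⟨fun x y hxy => ?_, fun x => ?_⟩
  · ext j
    rw [← key x j, ← key y j, hxy]
  · obtain ⟨s, hs⟩ := h4 x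
    refine ⟨∑ i ∈ s, DirectSum.of (fun i => d i) i ⟨c i x, h1 i x⟩, ?_⟩
    rw [map_sum]
    simp only [DirectSum.coeAddMonoidHom_of]
    exact hs

/-- The kernel of a morphism of graded modules. -/
def ker {M N : GrMod 𝒜} (f : M ⟶ N) : GrMod 𝒜 where
  carrier := LinearMap.ker f.lin
  finite := Module.Finite.of_injective ((LinearMap.ker f.lin).subtype.restrictScalars k)
    Subtype.val_injective
  deg i := (M.deg i).comap ((LinearMap.ker f.lin).subtype.restrictScalars k)
  isInternal := by
    have hc : ∀ (i : ℤ) (x : LinearMap.ker f.lin), M.comp i x ∈ LinearMap.ker f.lin := by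
      intro i x
      rw [LinearMap.mem_ker, ← comp_lin_comm, x.2, map_zero]
    refine isInternal_of_components _
      (fun i => AddMonoidHom.mk' (fun x => ⟨M.comp i x, hc i x⟩) ?_) ?_ ?_ ?_ ?_
    · intro x y
      ext
      simp
    · intro i x
      exact M.comp_mem i x
    · intro i x hx
      ext
      exact M.comp_of_mem hx
    · intro i j x hx hij
      ext
      exact M.comp_of_mem_ne hx hij
    · intro x
      obtain ⟨s, hs⟩ := M.exists_sum_comp (x : M)
      refine ⟨s, ?_⟩
      ext
      simpa using hs
  smul_mem := fun hb hx => M.smul_mem hb hx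

/-- The inclusion of the kernel. -/
def kerι {M N : GrMod 𝒜} (f : M ⟶ N) : ker f ⟶ M :=
  ⟨(LinearMap.ker f.lin).subtype, fun h => h⟩

theorem kerι_comp {M N : GrMod 𝒜} (f : M ⟶ N) : kerι f ≫ f = 0 := by
  ext x
  exact x.2

/-- The image of a grading under a surjection with homogeneous kernel is a grading. -/
theorem isInternal_map {W : Type u} [AddCommGroup W] [Module k W] (N : GrMod 𝒜) (π : N →ₗ[k] W)
    (hπ : Function.Surjective π) (hk : ∀ i x, π x = 0 → π (N.comp i x) = 0) :
    DirectSum.IsInternal fun i => (N.deg i).map π := by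
  have hc : ∀ i x y, π x = π y → π (N.comp i x) = π (N.comp i y) := by
    intro i x y h
    rw [← sub_eq_zero, ← map_sub, ← map_sub]
    exact hk i _ (by rw [map_sub, h, sub_self])
  have hs := Function.surjInv_eq hπ
  let c : ℤ → W →+ W := fun i => AddMonoidHom.mk' (fun w => π (N.comp i (Function.surjInv hπ w))) (by
    intro v w
    rw [← map_add, ← map_add]
    apply hc
    rw [map_add, hs, hs, hs])
  have hcm : ∀ i x, c i (π x) = π (N.comp i x) := fun i x => hc i _ _ (hs _)
  refine isInternal_of_components _ c ?_ ?_ ?_ ?_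
  · intro i x
    exact ⟨_, N.comp_mem i _, rfl⟩
  · rintro i _ ⟨x, hx, rfl⟩
    rw [hcm, N.comp_of_mem hx]
  · rintro i j _ ⟨x, hx, rfl⟩ hij
    rw [hcm, N.comp_of_mem_ne hx hij, map_zero]
  · intro x
    obtain ⟨x, rfl⟩ := hπ x
    obtain ⟨s, hs⟩ := N.exists_sum_comp x
    refine ⟨s, ?_⟩
    simp only [hcm, ← map_sum, hs]

theorem coker_isInternal {M N : GrMod 𝒜} (f : M ⟶ N) :
    DirectSum.IsInternal fun i =>
      (N.deg i).map ((LinearMap.range f.lin).mkQ.restrictScalars k) := by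
  refine isInternal_map N _ (Submodule.mkQ_surjective (LinearMap.range f.lin)) ?_
  intro i x hx
  obtain ⟨y, rfl⟩ := (Submodule.Quotient.mk_eq_zero (LinearMap.range f.lin)).1 hx
  exact (Submodule.Quotient.mk_eq_zero (LinearMap.range f.lin)).2
    ⟨M.comp i y, (comp_lin_comm f i y).symm⟩

/-- The cokernel of a morphism of graded modules. -/
def coker {M N : GrMod 𝒜} (f : M ⟶ N) : GrMod 𝒜 where
  carrier := N ⧸ LinearMap.range f.lin
  addCommGroup := inferInstance
  moduleBase := inferInstance
  module := inferInstance
  isScalarTower := inferInstance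
  finite := Module.Finite.of_surjective ((LinearMap.range f.lin).mkQ.restrictScalars k)
    (Submodule.mkQ_surjective (LinearMap.range f.lin))
  deg i := (N.deg i).map ((LinearMap.range f.lin).mkQ.restrictScalars k)
  isInternal := coker_isInternal f
  smul_mem := by
    rintro n i b _ hb ⟨x, hx, rfl⟩
    exact ⟨b • x, N.smul_mem hb hx, rfl⟩

/-- The projection to the cokernel. -/
def cokerπ {M N : GrMod 𝒜} (f : M ⟶ N) : N ⟶ coker f :=
  ⟨(LinearMap.range f.lin).mkQ, fun h => ⟨_, h, rfl⟩⟩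

theorem cokerπ_surjective {M N : GrMod 𝒜} (f : M ⟶ N) : Function.Surjective (cokerπ f).lin :=
  Submodule.mkQ_surjective _

theorem cokerπ_eq_zero {M N : GrMod 𝒜} (f : M ⟶ N) (x : N) :
    (cokerπ f).lin x = 0 ↔ ∃ y, f.lin y = x :=
  Submodule.Quotient.mk_eq_zero _

theorem comp_cokerπ {M N : GrMod 𝒜} (f : M ⟶ N) : f ≫ cokerπ f = 0 := by
  ext x
  exact (cokerπ_eq_zero f _).2 ⟨x, rfl⟩

/-- An injective morphism whose image is the kernel of `g` is a kernel of `g`. -/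
def isLimitOfInjective {M N P : GrMod 𝒜} (f : M ⟶ N) (g : N ⟶ P) (w : f ≫ g = 0)
    (hf : Function.Injective f.lin) (hr : ∀ x, g.lin x = 0 → ∃ y, f.lin y = x) :
    IsLimit (KernelFork.ofι f w) :=
  KernelFork.IsLimit.ofι f w
    (fun {T} t ht =>
      have hmem : ∀ x, t.lin x ∈ LinearMap.range f.lin := fun x =>
        hr _ (congrArg (fun q : T ⟶ P => q.lin x) ht)
      ⟨(LinearEquiv.ofInjective f.lin hf).symm.toLinearMap ∘ₗ t.lin.codRestrict _ hmem, by
        intro i x hx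
        set y := (LinearEquiv.ofInjective f.lin hf).symm (t.lin.codRestrict _ hmem x) with hy
        have hfy : f.lin y = t.lin x := by
          have := (LinearEquiv.ofInjective f.lin hf).apply_symm_apply
            (t.lin.codRestrict _ hmem x)
          exact congrArg Subtype.val this
        have : M.comp i y = y := by
          apply hf
          rw [← comp_lin_comm, hfy, comp_of_mem _ (t.map_mem hx)]
        change y ∈ M.deg i
        rw [← this]
        exact M.comp_mem i y⟩)
    (fun {T} t ht => by
      ext x
      have hmem : ∀ x, t.lin x ∈ LinearMap.range f.lin := fun x =>
        hr _ (congrArg (fun q : T ⟶ P => q.lin x) ht)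
      exact congrArg Subtype.val ((LinearEquiv.ofInjective f.lin hf).apply_symm_apply
            (t.lin.codRestrict _ hmem x)))
    (fun {T} t ht m hm => by
      ext x
      apply hf
      have hmem : ∀ x, t.lin x ∈ LinearMap.range f.lin := fun x =>
        hr _ (congrArg (fun q : T ⟶ P => q.lin x) ht)
      refine (congrArg (fun q : T ⟶ N => q.lin x) hm).trans ?_
      exact (congrArg Subtype.val ((LinearEquiv.ofInjective f.lin hf).apply_symm_apply
            (t.lin.codRestrict _ hmem x))).symm)

/-- A surjective morphism whose kernel is the image of `g` is a cokernel of `g`. -/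
def isColimitOfSurjective {M N P : GrMod 𝒜} (g : P ⟶ M) (f : M ⟶ N) (w : g ≫ f = 0)
    (hf : Function.Surjective f.lin) (hr : ∀ x, f.lin x = 0 → ∃ y, g.lin y = x) :
    IsColimit (CokernelCofork.ofπ f w) :=
  have hk : ∀ {T : GrMod 𝒜} (t : M ⟶ T), g ≫ t = 0 →
      LinearMap.ker f.lin ≤ LinearMap.ker t.lin := by
    intro T t ht x hx
    obtain ⟨y, rfl⟩ := hr x hx
    exact congrArg (fun q : P ⟶ T => q.lin y) ht
  have hl : ∀ {T : GrMod 𝒜} (t : M ⟶ T) (ht : g ≫ t = 0) (x : M),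
      ((LinearMap.ker f.lin).liftQ t.lin (hk t ht))
        ((f.lin.quotKerEquivOfSurjective hf).symm (f.lin x)) = t.lin x := by
    intro T t ht x
    have : (f.lin.quotKerEquivOfSurjective hf).symm (f.lin x) =
        (LinearMap.ker f.lin).mkQ x := by
      rw [LinearEquiv.symm_apply_eq]
      rfl
    rw [this]
    rfl
  CokernelCofork.IsColimit.ofπ f w
    (fun {T} t ht =>
      ⟨(LinearMap.ker f.lin).liftQ t.lin (hk t ht) ∘ₗ
          (f.lin.quotKerEquivOfSurjective hf).symm.toLinearMap, by
        intro i x hx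
        obtain ⟨y, rfl⟩ := hf x
        rw [← N.comp_of_mem hx, comp_lin_comm]
        exact (hl t ht _).symm ▸ t.map_mem (M.comp_mem i y)⟩)
    (fun {T} t ht => by
      ext x
      exact hl t ht x)
    (fun {T} t ht m hm => by
      ext x
      obtain ⟨y, rfl⟩ := hf x
      exact (congrArg (fun q : M ⟶ T => q.lin y) hm).trans (hl t ht y).symm)

instance : HasKernels (GrMod 𝒜) where
  has_limit f := ⟨⟨_, isLimitOfInjective (kerι f) f (kerι_comp f) Subtype.val_injective
    (fun x hx => ⟨⟨x, hx⟩, rfl⟩)⟩⟩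

instance : HasCokernels (GrMod 𝒜) where
  has_colimit f := ⟨⟨_, isColimitOfSurjective f (cokerπ f) (comp_cokerπ f) (cokerπ_surjective f)
    (fun x hx => (cokerπ_eq_zero f x).1 hx)⟩⟩

theorem injective_of_mono {M N : GrMod 𝒜} (f : M ⟶ N) [Mono f] : Function.Injective f.lin := by
  rw [← LinearMap.ker_eq_bot, eq_bot_iff]
  intro x hx
  have h : kerι f = 0 := by
    rw [← cancel_mono f, kerι_comp, zero_comp]
  exact congrArg (fun q : ker f ⟶ M => q.lin ⟨x, hx⟩) h

theorem surjective_of_epi {M N : GrMod 𝒜} (f : M ⟶ N) [Epi f] : Function.Surjective f.lin := by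
  intro x
  have h : cokerπ f = 0 := by
    rw [← cancel_epi f, comp_cokerπ, comp_zero]
  exact (cokerπ_eq_zero f x).1 (congrArg (fun q : N ⟶ coker f => q.lin x) h)

instance : IsNormalMonoCategory (GrMod 𝒜) where
  normalMonoOfMono f _ := ⟨⟨coker f, cokerπ f, comp_cokerπ f,
    isLimitOfInjective f (cokerπ f) (comp_cokerπ f) (injective_of_mono f)
      (fun x hx => (cokerπ_eq_zero f x).1 hx)⟩⟩

instance : IsNormalEpiCategory (GrMod 𝒜) where
  normalEpiOfEpi f _ := ⟨⟨ker f, kerι f, kerι_comp f,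
    isColimitOfSurjective (kerι f) f (kerι_comp f) (surjective_of_epi f)
      (fun x hx => ⟨⟨x, hx⟩, rfl⟩)⟩⟩

/-- The zero graded module. -/
def zeroObj : GrMod 𝒜 where
  carrier := PUnit
  deg _ := ⊤
  isInternal := isInternal_of_components _ (fun _ => 0) (fun _ _ => trivial)
    (fun _ _ _ => rfl) (fun _ _ _ _ _ => rfl) (fun _ => ⟨∅, rfl⟩)
  smul_mem := fun _ _ => trivial

instance : HasZeroObject (GrMod 𝒜) :=
  ⟨zeroObj, (IsZero.iff_id_eq_zero _).2 (by ext x; rfl)⟩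

/-- The direct sum of two graded modules. -/
def prod (M N : GrMod 𝒜) : GrMod 𝒜 where
  carrier := M × N
  deg i := (M.deg i).prod (N.deg i)
  isInternal := by
    refine isInternal_of_components _ (fun i => (M.comp i).prodMap (N.comp i)) ?_ ?_ ?_ ?_
    · exact fun i x => ⟨M.comp_mem i x.1, N.comp_mem i x.2⟩
    · exact fun i x hx => Prod.ext (M.comp_of_mem hx.1) (N.comp_of_mem hx.2)
    · exact fun i j x hx hij => Prod.ext (M.comp_of_mem_ne hx.1 hij) (N.comp_of_mem_ne hx.2 hij)
    · intro x
      obtain ⟨s, hs⟩ := M.exists_sum_comp x.1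
      obtain ⟨t, ht⟩ := N.exists_sum_comp x.2
      have aux : ∀ (P : GrMod 𝒜) (y : P) (s t : Finset ℤ), ∑ i ∈ s, P.comp i y = y → s ⊆ t →
          ∑ i ∈ t, P.comp i y = y := by
        intro P y s t h hst
        rw [← Finset.sum_subset hst, h]
        intro i _ hi
        rw [← h, map_sum]
        exact Finset.sum_eq_zero fun j hj =>
          P.comp_of_mem_ne (P.comp_mem j y) (fun e => hi (e ▸ hj))
      refine ⟨s ∪ t, Prod.ext ?_ ?_⟩
      · rw [Prod.fst_sum]
        exact aux M x.1 s _ hs Finset.subset_union_left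
      · rw [Prod.snd_sum]
        exact aux N x.2 t _ ht Finset.subset_union_right
  smul_mem := fun hb hx => ⟨M.smul_mem hb hx.1, N.smul_mem hb hx.2⟩

instance : HasBinaryBiproducts (GrMod 𝒜) where
  has_binary_biproduct M N := HasBinaryBiproduct.mk
    { bicone :=
        { pt := prod M N
          fst := ⟨LinearMap.fst B M N, fun h => h.1⟩
          snd := ⟨LinearMap.snd B M N, fun h => h.2⟩
          inl := ⟨LinearMap.inl B M N, fun h => ⟨h, (N.deg _).zero_mem⟩⟩
          inr := ⟨LinearMap.inr B M N, fun h => ⟨(M.deg _).zero_mem, h⟩⟩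
          inl_fst := rfl
          inl_snd := rfl
          inr_fst := rfl
          inr_snd := rfl }
      isBilimit := isBinaryBilimitOfTotal _ (by
        ext x
        exact Prod.ext (add_zero _) (zero_add _)) }

instance : HasFiniteProducts (GrMod 𝒜) := hasFiniteProducts_of_has_binary_and_terminal

instance : Abelian (GrMod 𝒜) where

instance : HasExt.{u + 1} (GrMod 𝒜) := HasExt.standard _

/-- The grading shift `M⟨r⟩`, with `M⟨r⟩_i = M_{i - r}`. -/
def shift (M : GrMod 𝒜) (r : ℤ) : GrMod 𝒜 where
  carrier := M
  deg i := M.deg (i - r)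
  isInternal := isInternal_of_components _ (fun i => M.comp (i - r))
    (fun _ _ => M.comp_mem _ _) (fun _ _ h => M.comp_of_mem h)
    (fun _ _ _ h hij => M.comp_of_mem_ne h (fun e => hij (by linarith)))
    (fun x => by
      obtain ⟨s, hs⟩ := M.exists_sum_comp x
      refine ⟨s.map (addRightEmbedding r), ?_⟩
      simpa using hs)
  smul_mem := by
    intro n i b x hb hx
    rw [add_sub_assoc]
    exact M.smul_mem hb hx

/-- The underlying ungraded module. -/
def ungraded (M : GrMod 𝒜) : FDMod k B where
  carrier := M

variable [GradedAlgebra 𝒜]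

/-- The action of `𝒜 0` on the component of degree `0`. -/
instance (M : GrMod 𝒜) : Module (𝒜 0) (M.deg 0) where
  smul := fun b x => ⟨(b : B) • (x : M), by simpa using M.smul_mem b.2 x.2⟩
  one_smul := fun x => Subtype.ext (one_smul B (x : M))
  mul_smul := fun a b x => Subtype.ext (mul_smul (a : B) (b : B) (x : M))
  smul_zero := fun a => Subtype.ext (smul_zero (a : B))
  smul_add := fun a x y => Subtype.ext (smul_add (a : B) (x : M) (y : M))
  add_smul := fun a b x => Subtype.ext (add_smul (a : B) (b : B) (x : M))
  zero_smul := fun x => Subtype.ext (zero_smul B (x : M))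

instance (M : GrMod 𝒜) : IsScalarTower k (𝒜 0) (M.deg 0) where
  smul_assoc c b x := Subtype.ext (smul_assoc c (b : B) (x : M))

/-- The component `M_0` of degree `0`, a module over the subalgebra `𝒜 0`. -/
def zeroPart (M : GrMod 𝒜) : FDMod k (𝒜 0) where
  carrier := M.deg 0

end GrMod

variable {𝒜 : ℕ → Submodule k B} [GradedAlgebra 𝒜]

/-- An `𝒜 0`-module regarded as a `B`-module through the projection `B → 𝒜 0`. -/
def FDMod.inflate (X : FDMod k (𝒜 0)) : FDMod k B where
  carrier := X
  module := Module.compHom X (GradedRing.projZeroRingHom' 𝒜)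
  isScalarTower := by
    let : Module B X := Module.compHom X (GradedRing.projZeroRingHom' 𝒜)
    refine ⟨fun c b x => ?_⟩
    change GradedRing.projZeroRingHom' 𝒜 (c • b) • x = c • GradedRing.projZeroRingHom' 𝒜 b • x
    have : GradedRing.projZeroRingHom' 𝒜 (c • b) = c • GradedRing.projZeroRingHom' 𝒜 b := by
      ext
      simp only [GradedRing.coe_projZeroRingHom'_apply, GradedRing.projZeroRingHom_apply,
        DirectSum.decompose_smul]
      rfl
    rw [this, smul_assoc]

/-- An `𝒜 0`-module regarded as a graded `B`-module concentrated in degree `0`, on which `B` acts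
through the projection `B → 𝒜 0`. -/
def FDMod.toGrMod (X : FDMod k (𝒜 0)) : GrMod 𝒜 where
  carrier := X
  module := X.inflate.module
  isScalarTower := X.inflate.isScalarTower
  deg i := if i = 0 then ⊤ else ⊥
  isInternal := by
    refine GrMod.isInternal_of_components _
      (fun i => if i = 0 then AddMonoidHom.id X else 0) ?_ ?_ ?_ ?_
    · intro i x
      by_cases h : i = 0 <;> simp [h]
    · intro i x hx
      by_cases h : i = 0
      · simp [h]
      · simp only [h, if_false, Submodule.mem_bot] at hx
        simp [h, hx]
    · intro i j x hx hij
      by_cases h : j = 0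
      · have hi : i ≠ 0 := fun e => hij (e.trans h.symm)
        simp only [hi, if_false, Submodule.mem_bot] at hx
        simp [h, hx]
      · simp [h]
    · exact fun x => ⟨{0}, by simp⟩
  smul_mem := by
    intro n i b x hb hx
    by_cases hi : i = 0
    · subst hi
      by_cases hn : n = 0
      · subst hn
        simp
      · have h0 : GradedRing.projZeroRingHom' 𝒜 b = 0 := by
          ext
          simp [DirectSum.decompose_of_mem_ne 𝒜 hb hn]
        have : GradedRing.projZeroRingHom' 𝒜 b • x = 0 := by rw [h0, zero_smul]
        have hz : (@HSMul.hSMul B X X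
          (@instHSMul B X X.inflate.module.toSMul) b x) = 0 := this
        rw [hz]
        exact Submodule.zero_mem _
    · simp only [hi, if_false, Submodule.mem_bot] at hx
      have hz : (@HSMul.hSMul B X X
          (@instHSMul B X X.inflate.module.toSMul) b x) = 0 := by
        rw [hx]
        exact smul_zero (GradedRing.projZeroRingHom' 𝒜 b)
      rw [hz]
      exact Submodule.zero_mem _

/-! ### Standard Q-Koszul algebras and Q-Koszul algebras -/

variable {Λ : Type v} [PartialOrder Λ]

/-- `D` is the standard `B`-module `Δ(l)` with its natural grading `⨁_{i ≥ 0} Δ(l)_i`, whose head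
`L l` is in degree `0`. -/
structure IsGradedStandard (L : Λ → FDMod k (𝒜 0)) (l : Λ) (D : GrMod 𝒜) : Prop where
  standard : IsStandard (fun m => (L m).inflate) l D.ungraded
  deg_neg : ∀ i < 0, D.deg i = ⊥
  deg_zero : D.deg 0 ≠ ⊥

/-- `N` is the costandard `B`-module `∇(l)` with its natural grading `⨁_{i ≤ 0} ∇(l)_i`, whose
socle `L l` is in degree `0`. -/
structure IsGradedCostandard (L : Λ → FDMod k (𝒜 0)) (l : Λ) (N : GrMod 𝒜) : Prop where
  costandard : IsCostandard (fun m => (L m).inflate) l N.ungraded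
  deg_pos : ∀ i > 0, N.deg i = ⊥
  deg_zero : N.deg 0 ≠ ⊥

variable (𝒜)

/-- The graded algebra `B = ⨁ 𝒜 n`, with simple modules `L l` concentrated in degree `0`, is a
standard Q-Koszul algebra with weight poset `Λ`: it is quasi-hereditary, and
`ext^n_B(Δ(l), ∇(m)_0⟨r⟩) ≠ 0` or `ext^n_B(Δ(m)_0, ∇(l)⟨r⟩) ≠ 0` imply `n = r`. -/
structure IsStandardQKoszul (L : Λ → FDMod k (𝒜 0)) : Prop where
  quasiHereditary : IsQuasiHereditary (fun l => ((L l).inflate : FDMod k B))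
  ext_standard : ∀ (l m : Λ) (D N : GrMod 𝒜), IsGradedStandard L l D → IsGradedCostandard L m N →
    ∀ (n : ℕ) (r : ℤ), Nontrivial (Abelian.Ext D (N.zeroPart.toGrMod.shift r) n) → (n : ℤ) = r
  ext_costandard : ∀ (l m : Λ) (D N : GrMod 𝒜), IsGradedStandard L m D →
    IsGradedCostandard L l N →
    ∀ (n : ℕ) (r : ℤ), Nontrivial (Abelian.Ext D.zeroPart.toGrMod (N.shift r) n) → (n : ℤ) = r

/-- The graded algebra `B = ⨁ 𝒜 n` is a Q-Koszul algebra with weight poset `Λ`: the algebra `𝒜 0`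
is quasi-hereditary with simple modules `L l`, and for its standard modules `X = Δ⁰(l)` and
costandard modules `Y = ∇₀(m)`, `ext^n_B(X, Y⟨r⟩) ≠ 0` implies `n = r`. -/
structure IsQKoszul (L : Λ → FDMod k (𝒜 0)) : Prop where
  quasiHereditary : IsQuasiHereditary L
  ext_standard : ∀ (l m : Λ) (X Y : FDMod k (𝒜 0)), IsStandard L l X → IsCostandard L m Y →
    ∀ (n : ℕ) (r : ℤ), Nontrivial (Abelian.Ext X.toGrMod (Y.toGrMod.shift r) n) → (n : ℤ) = r

end GradedModules

end

set_option linter.unusedSectionVars false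

/-! The argument takes place in the derived category of finite dimensional graded `B`-modules. Write
`Δ(ν)⟨s⟩[a]` for a standard module with grading shift `s` and cohomological shift `a`. Since `B` is
quasi-hereditary, these objects form an exceptional family: nonzero maps go from smaller to larger
labels, or are scalar endomorphisms of one object. The objects `∇(ν)⟨s⟩[a]` form the dual family: a
map `Δ(μ)⟨s⟩[a] ⟶ ∇(ν)⟨t⟩[b]` vanishes unless all indices agree.

If an object `X` is generated by such a family and receives few maps from it, then `X` is an
iterated cone of sums of objects `Δ(ν)⟨s⟩[a]`, and only those `(s, a)` occur for which some map `X ⟶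
∇(ν)⟨s⟩[a]` is nonzero. Hence a `Y` that receives no map from these particular standard objects
receives none from `X`. This is `IsExceptionalPair.hom_eq_zero`.

For `X = Δ⁰(λ)`, the condition on `ext(Δ⁰(λ), ∇(ν)⟨r⟩)` says that only pairs with `s = a` occur. For
`Y = ∇₀(μ)⟨r⟩[n]`, the condition on `ext(Δ(ν), ∇₀(μ)⟨r⟩)` says that a nonzero map `Δ(ν)⟨s⟩[s] ⟶ Y`
forces `n - s = r - s`. So every map `X ⟶ Y` vanishes when `n ≠ r`; this is
`GrMod.ext_eq_of_linear`.

The work lies in checking the hypotheses in the graded category. Quasi-heredity only gives ungraded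
filtrations of projective modules. A dimension count turns them into filtrations of the kernel of `B
e_l ⟶ Δ(l)` by shifted standard modules (`GrMod.filtered_trace`). Dimension shifting along this
kernel yields the vanishing and finiteness of Ext from standard modules
(`GrMod.ext_standard_standard`, `GrMod.ext_standard_costandard`, `GrMod.extFinite_standard`), and
`GrMod.standard_generates` shows that standard modules generate everything.

The degree 0 part of the same graded filtration shows that `B_0` is quasi-hereditary, with standard
modules `Δ(l)_0` (`GrMod.isQuasiHereditary_zeroPart`). Uniqueness of standard and costandard modules
then carries the Ext statement to those of `B_0`. -/

noncomputable section

/-! ### Exceptional families and their duals in a triangulated category -/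

section ExceptionalFamily

open Pretriangulated

variable {𝒟 : Type*} [Category* 𝒟] [Preadditive 𝒟] [HasZeroObject 𝒟] [HasShift 𝒟 ℤ]
  [∀ n : ℤ, (shiftFunctor 𝒟 n).Additive] [Pretriangulated 𝒟] [HasFiniteBiproducts 𝒟]
  (k : Type*) [Field k] [Linear k 𝒟]
  {Λ τ : Type*}

/-- The morphisms from the objects `d ν t` to `X` form, for each `ν`, a finite dimensional space
in total. -/
structure HomFinite (d : Λ → τ → 𝒟) (X : 𝒟) : Prop where
  finite : ∀ ν t, Module.Finite k (d ν t ⟶ X)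
  support : ∀ ν, {t | ∃ f : d ν t ⟶ X, f ≠ 0}.Finite

/-- `X` belongs to the left orthogonal of the right orthogonal of the family `d`. -/
def IsGeneratedBy (d : Λ → τ → 𝒟) (X : 𝒟) : Prop :=
  ∀ Z : 𝒟, (∀ ν t (f : d ν t ⟶ Z), f = 0) → ∀ f : X ⟶ Z, f = 0

/-- A family of exceptional objects `d` indexed by a poset, together with a dual family `c`. -/
structure IsExceptionalPair [PartialOrder Λ] (sh : τ ≃ τ) (d c : Λ → τ → 𝒟) : Prop where
  shift_d : ∀ ν t, Nonempty ((d ν t)⟦(1 : ℤ)⟧ ≅ d ν (sh t))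
  shift_c : ∀ ν t, Nonempty ((c ν t)⟦(1 : ℤ)⟧ ≅ c ν (sh t))
  hom_dd : ∀ μ ν t u (f : d μ t ⟶ d ν u), f ≠ 0 → μ < ν ∨ (μ = ν ∧ t = u)
  end_d : ∀ ν t (f : d ν t ⟶ d ν t), ∃ a : k, f = a • 𝟙 _
  hom_dc : ∀ μ ν t u (f : d μ t ⟶ c ν u), f ≠ 0 → μ = ν ∧ t = u
  exists_dc : ∀ ν t, ∃ f : d ν t ⟶ c ν t, f ≠ 0
  finite : ∀ ν t, HomFinite k d (d ν t)

variable {k}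

theorem eq_zero_of_iso_left {X X' Z : 𝒟} (e : X ≅ X') (h : ∀ f : X' ⟶ Z, f = 0) (f : X ⟶ Z) :
    f = 0 := by
  rw [← cancel_epi e.inv, h (e.inv ≫ f), comp_zero]

theorem eq_zero_of_iso_right {X Z Z' : 𝒟} (e : Z ≅ Z') (h : ∀ f : X ⟶ Z', f = 0) (f : X ⟶ Z) :
    f = 0 := by
  rw [← cancel_mono e.hom, h (f ≫ e.hom), zero_comp]

theorem shift_biproduct_hom_ext {J : Type} [Finite J] (V : J → 𝒟) {Z : 𝒟}
    (f : (⨁ V)⟦(1 : ℤ)⟧ ⟶ Z) (h : ∀ j, (biproduct.ι V j)⟦(1 : ℤ)⟧' ≫ f = 0) : f = 0 := by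
  classical
  have := Fintype.ofFinite J
  have e : (𝟙 ((⨁ V)⟦(1 : ℤ)⟧)) =
      ∑ j, (biproduct.π V j)⟦(1 : ℤ)⟧' ≫ (biproduct.ι V j)⟦(1 : ℤ)⟧' := by
    simp only [← Functor.map_comp, ← Functor.map_sum, biproduct.total]
    exact (CategoryTheory.Functor.map_id _ _).symm
  rw [← Category.id_comp f, e, Preadditive.sum_comp]
  exact Finset.sum_eq_zero fun j _ => by rw [Category.assoc, h, comp_zero]

theorem shift_biproduct_hom_ext' {J : Type} [Finite J] (V : J → 𝒟) {Z : 𝒟}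
    (f : Z ⟶ (⨁ V)⟦(1 : ℤ)⟧) (h : ∀ j, f ≫ (biproduct.π V j)⟦(1 : ℤ)⟧' = 0) : f = 0 := by
  classical
  have := Fintype.ofFinite J
  have e : (𝟙 ((⨁ V)⟦(1 : ℤ)⟧)) =
      ∑ j, (biproduct.π V j)⟦(1 : ℤ)⟧' ≫ (biproduct.ι V j)⟦(1 : ℤ)⟧' := by
    simp only [← Functor.map_comp, ← Functor.map_sum, biproduct.total]
    exact (CategoryTheory.Functor.map_id _ _).symm
  rw [← Category.comp_id f, e, Preadditive.comp_sum]
  exact Finset.sum_eq_zero fun j _ => by rw [← Category.assoc, h, zero_comp]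

/-- If there are finitely many morphisms up to linear combination, there is a universal morphism
from a finite direct sum of objects `d ν t`. -/
theorem exists_universal_biproduct {d : τ → 𝒟} {X : 𝒟}
    (hd : ∀ t u (f : d t ⟶ d u), f ≠ 0 → t = u)
    (hk : ∀ t (f : d t ⟶ d t), ∃ a : k, f = a • 𝟙 _)
    (hfin : ∀ t, Module.Finite k (d t ⟶ X)) (hsupp : {t | ∃ f : d t ⟶ X, f ≠ 0}.Finite) :
    ∃ (J : Type) (_ : Finite J) (j : J → τ) (φ : (⨁ fun i => d (j i)) ⟶ X),
      ∀ t, Function.Bijective fun h : d t ⟶ ⨁ fun i => d (j i) => h ≫ φ := by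
  classical
  have := fun t => (hfin t)
  -- Enumerating the support by `Fin m` keeps the index set `J` in `Type`. The universal object is
  -- the sum of one copy of `d t` for each vector of a basis of the maps `d t ⟶ X`.
  let m := hsupp.toFinset.card
  let q : Fin m ≃ hsupp.toFinset := hsupp.toFinset.equivFin.symm
  let b := fun t => Module.finBasis k (d t ⟶ X)
  let J := Σ i : Fin m, Fin (Module.finrank k (d (q i) ⟶ X))
  let j : J → τ := fun i => q i.1
  let φ : (⨁ fun i => d (j i)) ⟶ X := biproduct.desc fun i => b (q i.1) i.2
  refine ⟨J, inferInstance, j, φ, fun t => ⟨?_, ?_⟩⟩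
  · intro h h' hh
    rw [← sub_eq_zero]
    replace hh : (h - h') ≫ φ = 0 := by
      rw [Preadditive.sub_comp, sub_eq_zero]; exact hh
    generalize h - h' = g at hh
    have key : g ≫ φ = ∑ i : J, (g ≫ biproduct.π _ i) ≫ b (q i.1) i.2 := by
      conv_lhs => rw [← Category.comp_id g, ← biproduct.total, Preadditive.comp_sum,
        Preadditive.sum_comp]
      simp [φ]
    rw [key] at hh
    apply biproduct.hom_ext
    rintro ⟨i, l⟩
    rw [zero_comp]
    by_contra hne
    obtain rfl : t = q i := hd _ _ _ hne
    rw [Fintype.sum_sigma, Finset.sum_eq_single i] at hh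
    · choose a ha using fun l => hk (q i) (g ≫ biproduct.π (fun i => d (j i)) ⟨i, l⟩)
      have h2 : ∑ l, a l • b (q i) l = 0 := by
        rw [← hh]
        refine Finset.sum_congr rfl fun l _ => ?_
        change _ = (g ≫ biproduct.π (fun i => d (j i)) ⟨i, l⟩) ≫ b (q i) l
        rw [ha l, Linear.smul_comp, Category.id_comp]
      have h3 := Fintype.linearIndependent_iff.1 (b (q i)).linearIndependent a h2 l
      apply hne
      change g ≫ biproduct.π (fun i => d (j i)) ⟨i, l⟩ = 0
      rw [ha l, h3, zero_smul]
    · intro i' _ hi'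
      refine Finset.sum_eq_zero fun l' _ => ?_
      have : g ≫ biproduct.π (fun i => d (j i)) ⟨i', l'⟩ = 0 := by
        by_contra hne'
        exact hi' (q.injective (Subtype.ext (hd _ _ _ hne').symm))
      rw [this, zero_comp]
    · simp
  · intro f
    by_cases hf : f = 0
    · exact ⟨0, by simp [hf]⟩
    obtain ⟨i, rfl⟩ : ∃ i, (q i : τ) = t :=
      ⟨q.symm ⟨t, by simpa using ⟨f, hf⟩⟩, by simp⟩
    refine ⟨∑ l, (b (q i)).repr f l • biproduct.ι (fun i => d (j i)) ⟨i, l⟩, ?_⟩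
    conv_rhs => rw [← (b (q i)).sum_repr f]
    refine (Preadditive.sum_comp _ _ _).trans (Finset.sum_congr rfl fun l _ => ?_)
    rw [Linear.smul_comp]
    exact congrArg _ (biproduct.ι_desc _ _)

variable [PartialOrder Λ] {sh : τ ≃ τ} {d c : Λ → τ → 𝒟}

/-- The maps from `d μ t` to the cone lie, by the long exact sequence, between the maps to `X` and
the maps to a suspended finite sum of objects of the family, for which finiteness is part of the
hypothesis on the pair. -/
theorem HomFinite.cone (hE : IsExceptionalPair k sh d c) {ν : Λ} {J : Type} [Finite J] (j : J → τ)
    {X X' : 𝒟} (hX : HomFinite k d X) (f : (⨁ fun i => d ν (j i)) ⟶ X) (g : X ⟶ X')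
    (h : X' ⟶ (⨁ fun i => d ν (j i))⟦(1 : ℤ)⟧) (hT : Triangle.mk f g h ∈ distTriang 𝒟) :
    HomFinite k d X' := by
  let e := fun i => (hE.shift_d ν (j i)).some
  let π : ∀ i, (⨁ fun i => d ν (j i))⟦(1 : ℤ)⟧ ⟶ d ν (sh (j i)) := fun i =>
    (biproduct.π (fun i => d ν (j i)) i)⟦(1 : ℤ)⟧' ≫ (e i).hom
  have hπ : ∀ {Z : 𝒟} (a : Z ⟶ _), (∀ i, a ≫ π i = 0) → a = 0 := by
    intro Z a ha
    refine shift_biproduct_hom_ext' _ a fun i => ?_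
    rw [← cancel_mono (e i).hom, Category.assoc, zero_comp]
    exact ha i
  constructor
  · intro μ t
    have := hX.finite μ t
    have := fun i => (hE.finite ν (sh (j i))).finite μ t
    let α : (d μ t ⟶ X) →ₗ[k] (d μ t ⟶ X') := Linear.rightComp k _ g
    let β : (d μ t ⟶ X') →ₗ[k] (∀ i, d μ t ⟶ d ν (sh (j i))) :=
      LinearMap.pi fun i => Linear.rightComp k _ (h ≫ π i)
    have hker : LinearMap.ker β ≤ LinearMap.range α := by
      intro x hx
      have hx' : x ≫ h = 0 := hπ _ fun i => by
        have := congrFun hx i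
        simpa [β] using this
      obtain ⟨y, hy⟩ := Triangle.coyoneda_exact₃ _ hT x hx'
      exact ⟨y, hy.symm⟩
    have h1 : Module.Finite k (LinearMap.ker β) :=
      Module.Finite.of_injective (Submodule.inclusion hker) (Submodule.inclusion_injective hker)
    have h2 : Module.Finite k (LinearMap.range β) := inferInstance
    have h3 : Module.Finite k ((d μ t ⟶ X') ⧸ LinearMap.ker β) :=
      Module.Finite.equiv β.quotKerEquivRange.symm
    exact Module.Finite.of_submodule_quotient (LinearMap.ker β)
  · intro μ
    refine ((hX.support μ).union (Set.finite_iUnion fun i =>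
      (hE.finite ν (sh (j i))).support μ)).subset ?_
    rintro t ⟨x, hx⟩
    by_contra hcon
    simp only [Set.mem_union, Set.mem_ofPred_eq, Set.mem_iUnion, not_or, not_exists,
      not_not] at hcon
    obtain ⟨y, hy⟩ := Triangle.coyoneda_exact₃ _ hT x (hπ _ fun i => hcon.2 i _)
    apply hx
    rw [hy, hcon.1 y]
    exact zero_comp

/-- If `X` is generated by an exceptional family `d` and the morphisms to the dual family `c` are
concentrated in `G`, then `X` is built from the `d ν t`, `t ∈ G`. -/
theorem IsExceptionalPair.hom_eq_zero [Finite Λ] (hE : IsExceptionalPair k sh d c) {X Y : 𝒟}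
    (hX : HomFinite k d X) (hgen : IsGeneratedBy d X) (G : Set τ)
    (hG : ∀ ν t (f : X ⟶ c ν t), f ≠ 0 → t ∈ G) (hY : ∀ ν, ∀ t ∈ G, ∀ f : d ν t ⟶ Y, f = 0)
    (f : X ⟶ Y) : f = 0 := by
  classical
  -- The induction is over lower sets `S` outside of which no `d ν t` maps to `X`. The first
  -- conclusion, that such an `X` has no maps to `c ν t` with `ν ∉ S`, is what allows maps to be
  -- extended along `φ` below.
  suffices H : ∀ (n : ℕ) (S : Finset Λ), S.card = n → IsLowerSet (S : Set Λ) → ∀ X : 𝒟,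
      HomFinite k d X → IsGeneratedBy d X → (∀ ν ∉ S, ∀ t (f : d ν t ⟶ X), f = 0) →
      (∀ ν ∉ S, ∀ t (f : X ⟶ c ν t), f = 0) ∧
      ((∀ ν t (f : X ⟶ c ν t), f ≠ 0 → t ∈ G) → ∀ f : X ⟶ Y, f = 0) by
    have := Fintype.ofFinite Λ
    exact (H _ Finset.univ rfl (by simp [IsLowerSet]) X hX hgen (by simp)).2 hG f
  clear f hG hgen hX X
  intro n
  induction n with
  | zero =>
    intro S hS _ X _ hgen hz
    obtain rfl := Finset.card_eq_zero.1 hS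
    -- An object that is generated by the family and right orthogonal to it is orthogonal to itself.
    have h0 : 𝟙 X = 0 := hgen X (fun ν t f => hz ν (by simp) t f) _
    have h1 : ∀ {Z} (f : X ⟶ Z), f = 0 := fun f => by rw [← Category.id_comp f, h0, zero_comp]
    exact ⟨fun _ _ _ f => h1 f, fun _ f => h1 f⟩
  | succ n ih =>
    intro S hS hlow X hX hgen hz
    obtain ⟨ν, hν⟩ := S.exists_maximal (Finset.card_pos.1 (by omega))
    have hlow' : IsLowerSet ((S.erase ν : Finset Λ) : Set Λ) := by
      intro a b hba ha
      simp only [Finset.coe_erase, Set.mem_sdiff, Finset.mem_coe, Set.mem_singleton_iff] at ha ⊢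
      refine ⟨hlow hba ha.1, ?_⟩
      rintro rfl
      exact ha.2 (le_antisymm (hν.2 ha.1 hba) hba)
    -- For a fixed label the objects `d ν t` are pairwise orthogonal with scalar endomorphisms, so
    -- the universal map `φ` exists. Its cone `X'` has lost the label `ν`.
    obtain ⟨J, _, j, φ, hφ⟩ := exists_universal_biproduct (k := k) (d := d ν) (X := X)
      (fun t u f hf => by
        rcases hE.hom_dd _ _ _ _ f hf with h | h
        · exact absurd h (lt_irrefl _)
        · exact h.2)
      (hE.end_d ν) (hX.finite ν) (hX.support ν)
    obtain ⟨X', g, h, hT⟩ := distinguished_cocone_triangle φ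
    have hX' : HomFinite k d X' := hX.cone hE j φ g h hT
    have hVS : ∀ {Z : 𝒟}, (∀ t (f : d ν t ⟶ Z), f = 0) →
        ∀ f : (⨁ fun i => d ν (j i))⟦(1 : ℤ)⟧ ⟶ Z, f = 0 := by
      intro Z hZ f
      refine shift_biproduct_hom_ext _ f fun i => ?_
      obtain ⟨e⟩ := hE.shift_d ν (j i)
      exact eq_zero_of_iso_left e (hZ _) _
    have hgen' : IsGeneratedBy d X' := by
      intro Z hZ f
      obtain ⟨y, hy⟩ := Triangle.yoneda_exact₃ _ hT f (hgen Z hZ _)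
      rw [hy, hVS (hZ ν) y]
      exact comp_zero
    have hdV : ∀ μ ∉ S.erase ν, ∀ t (f : d μ t ⟶ X'), f = 0 := by
      intro μ hμ t f
      by_cases hμν : μ = ν
      · subst hμν
        -- Up to suspension, `f ≫ h` is a map `w` to the direct sum that `φ` kills, hence zero by
        -- the injectivity part of universality. So `f` comes from `X`, and the surjectivity part
        -- makes it factor through `φ`, which the next map of the triangle annihilates.
        have h1 : f ≫ h = 0 := by
          obtain ⟨e⟩ := hE.shift_d μ (sh.symm t)
          rw [sh.apply_symm_apply] at e
          rw [← cancel_epi e.hom, comp_zero]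
          obtain ⟨w, hw⟩ := (shiftFunctor 𝒟 (1 : ℤ)).map_surjective (e.hom ≫ f ≫ h)
          have h2 : w ≫ φ = 0 := by
            apply (shiftFunctor 𝒟 (1 : ℤ)).map_injective
            rw [Functor.map_comp, hw, Functor.map_zero, Category.assoc, Category.assoc]
            have := comp_distTriang_mor_zero₃₁ _ hT
            change h ≫ φ⟦(1 : ℤ)⟧' = 0 at this
            rw [this, comp_zero, comp_zero]
          have h3 : w = 0 := (hφ _).1 (by simpa using h2)
          rw [← hw, h3, Functor.map_zero]
        obtain ⟨y, hy⟩ := Triangle.coyoneda_exact₃ _ hT f h1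
        obtain ⟨w, rfl⟩ := (hφ t).2 y
        rw [hy]
        change (w ≫ φ) ≫ g = 0
        rw [Category.assoc]
        have := comp_distTriang_mor_zero₁₂ _ hT
        change φ ≫ g = 0 at this
        rw [this, comp_zero]
      · have hμS : μ ∉ S := fun h => hμ (Finset.mem_erase.2 ⟨hμν, h⟩)
        -- A nonzero component would give `μ < ν`, and `S` is a lower set containing `ν` but not
        -- `μ`.
        have h1 : f ≫ h = 0 := by
          refine shift_biproduct_hom_ext' _ _ fun i => ?_
          obtain ⟨e⟩ := hE.shift_d ν (j i)
          refine eq_zero_of_iso_right e (fun x => ?_) _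
          by_contra hx
          rcases hE.hom_dd _ _ _ _ x hx with h' | h'
          · exact hμS (hlow h'.le hν.1)
          · exact hμν h'.1
        obtain ⟨y, hy⟩ := Triangle.coyoneda_exact₃ _ hT f h1
        rw [hy, hz μ hμS t y]
        exact zero_comp
    obtain ⟨ha, hb⟩ := ih (S.erase ν) (by rw [Finset.card_erase_of_mem hν.1, hS]; rfl) hlow' X'
      hX' hgen' hdV
    refine ⟨fun μ hμ t f => ?_, fun hG f => ?_⟩
    · have h1 : φ ≫ f = 0 := by
        apply biproduct.hom_ext'
        intro i
        rw [comp_zero]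
        by_contra hx
        exact hμ ((hE.hom_dc _ _ _ _ _ hx).1 ▸ hν.1)
      obtain ⟨y, hy⟩ := Triangle.yoneda_exact₂ _ hT f h1
      rw [hy, ha μ (fun h => hμ (Finset.mem_of_mem_erase h)) t y]
      exact comp_zero
    -- A nonzero map `p` from the sum to `c ν (j i)` extends along `φ`, up to sign, since the
    -- obstruction `h ≫ p⟦1⟧'` is a map from `X'` to a dual object with label `ν`, which has been
    -- removed. The extension is a nonzero map from `X`, and so `j i` lies in `G`.
    · have hjG : ∀ i, j i ∈ G := by
        intro i
        obtain ⟨x, hx⟩ := hE.exists_dc ν (j i)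
        let p : (⨁ fun i => d ν (j i)) ⟶ c ν (j i) := biproduct.π _ i ≫ x
        have hp : p ≠ 0 := by
          intro h0
          apply hx
          have : biproduct.ι (fun i => d ν (j i)) i ≫ p = 0 := by rw [h0, comp_zero]
          simpa [p] using this
        have hhp : h ≫ p⟦(1 : ℤ)⟧' = 0 := by
          obtain ⟨e⟩ := hE.shift_c ν (j i)
          exact eq_zero_of_iso_right e (ha ν (Finset.notMem_erase _ _) _) _
        obtain ⟨y, hy⟩ := Triangle.yoneda_exact₃ _ (rot_of_distTriang _ hT) (p⟦(1 : ℤ)⟧') hhp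
        obtain ⟨z, rfl⟩ : ∃ z : X ⟶ c ν (j i), z⟦(1 : ℤ)⟧' = y :=
          (shiftFunctor 𝒟 (1 : ℤ)).map_surjective y
        have hz : p = -(φ ≫ z) := by
          apply (shiftFunctor 𝒟 (1 : ℤ)).map_injective
          refine hy.trans ?_
          rw [Functor.map_neg, Functor.map_comp, ← Preadditive.neg_comp]
          rfl
        refine hG ν (j i) z ?_
        rintro rfl
        exact hp (by rw [hz, comp_zero, neg_zero])
      have h1 : φ ≫ f = 0 := by
        apply biproduct.hom_ext'
        intro i
        rw [comp_zero]
        exact hY ν _ (hjG i) _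
      obtain ⟨y, hy⟩ := Triangle.yoneda_exact₂ _ hT f h1
      -- The cone inherits the condition on `G`: for a label `μ ≠ ν`, composition with `g` is
      -- injective on maps to `c μ t`, since the suspended sum of objects `d ν _` has no maps to `c
      -- μ t`. The remaining labels do not occur at all.
      have hy0 : y = 0 := by
        refine hb (fun μ t x hx => ?_) y
        by_cases hμ : μ ∈ S.erase ν
        · refine hG μ t (g ≫ x) fun h0 => hx ?_
          obtain ⟨w, hw⟩ := Triangle.yoneda_exact₃ _ hT x h0
          rw [hw, hVS (fun u a => ?_) w]
          · exact comp_zero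
          · by_contra ha'
            exact Finset.ne_of_mem_erase hμ (hE.hom_dc _ _ _ _ _ ha').1.symm
        · exact absurd (ha μ hμ t x) hx
      rw [hy, hy0]
      exact comp_zero

end ExceptionalFamily

/-! ### Idempotents attached to the simple modules -/

section IdempotentSystems

variable {k A : Type u} [Field k] [Ring A] [Algebra k A] {Λ : Type v}

/-- Idempotents `e l` cutting out a line of the simple module `L l` and killing the others. -/
structure IsIdempotentSystem (L : Λ → FDMod k A) (e : Λ → A) : Prop where
  indexing : IsSimpleIndexing L
  idem : ∀ l, e l * e l = e l
  off : ∀ l m, l ≠ m → ∀ x : L m, e l • x = 0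
  line : ∀ l, ∃ v : L l, e l • v = v ∧ v ≠ 0 ∧ ∀ x : L l, ∃ c : k, e l • x = c • v

theorem IsSimpleIndexing.exists_equiv {L : Λ → FDMod k A} (hL : IsSimpleIndexing L)
    (S : Type u) [AddCommGroup S] [Module k S] [Module A S] [IsScalarTower k A S]
    [Module.Finite k S] [IsSimpleModule A S] : ∃ l, Nonempty (S ≃ₗ[A] L l) :=
  hL.complete ⟨S⟩ ‹_›

/-- The image of a map compatible with the projections to `L` supplements a superfluous kernel, so
both `f` and `g` are surjective. Comparing dimensions gives bijectivity. -/
theorem bijective_of_covers {P P' L : Type u} [AddCommGroup P] [Module k P] [Module A P]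
    [IsScalarTower k A P] [Module.Finite k P] [AddCommGroup P'] [Module k P'] [Module A P']
    [IsScalarTower k A P'] [Module.Finite k P'] [AddCommGroup L] [Module A L]
    (p : P →ₗ[A] L) (p' : P' →ₗ[A] L) (hp : Function.Surjective p) (hp' : Function.Surjective p')
    (hpc : ∀ N : Submodule A P, N ⊔ LinearMap.ker p = ⊤ → N = ⊤)
    (hpc' : ∀ N : Submodule A P', N ⊔ LinearMap.ker p' = ⊤ → N = ⊤)
    (f : P →ₗ[A] P') (g : P' →ₗ[A] P) (hf : p' ∘ₗ f = p) (hg : p ∘ₗ g = p') :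
    Function.Bijective f := by
  have key : ∀ {P P' : Type u} [AddCommGroup P] [Module A P] [AddCommGroup P'] [Module A P']
      (p : P →ₗ[A] L) (p' : P' →ₗ[A] L), Function.Surjective p →
      (∀ N : Submodule A P', N ⊔ LinearMap.ker p' = ⊤ → N = ⊤) → ∀ f : P →ₗ[A] P',
      p' ∘ₗ f = p → Function.Surjective f := by
    intro P P' _ _ _ _ p p' hp hpc f hf
    rw [← LinearMap.range_eq_top]
    apply hpc
    rw [eq_top_iff]
    intro z _
    obtain ⟨y, hy⟩ := hp (p' z)
    rw [← add_sub_cancel (f y) z]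
    refine Submodule.add_mem_sup ⟨y, rfl⟩ ?_
    rw [LinearMap.mem_ker, map_sub, ← hy, ← hf, LinearMap.comp_apply, sub_self]
  have hfs := key p p' hp hpc' f hf
  have hgs := key p' p hp' hpc g hg
  have h1 := LinearMap.finrank_le_finrank_of_surjective (f := f.restrictScalars k) hfs
  have h2 := LinearMap.finrank_le_finrank_of_surjective (f := g.restrictScalars k) hgs
  exact ⟨(LinearMap.injective_iff_surjective_of_finrank_eq_finrank (f := f.restrictScalars k)
    (le_antisymm h2 h1)).2 hfs, hfs⟩

/-- A projective cover of `L l` provides an idempotent that cuts out a line of `L l` and kills the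
other simple modules. -/
theorem exists_idempotent [IsAlgClosed k] {L : Λ → FDMod k A} (hL : IsSimpleIndexing L) (l : Λ)
    (P : FDMod k A) [Module.Projective A P] (p : P →ₗ[A] L l) (hp : Function.Surjective p)
    (hpc : ∀ N : Submodule A P, N ⊔ LinearMap.ker p = ⊤ → N = ⊤) :
    ∃ e : A, e * e = e ∧ (∀ m, l ≠ m → ∀ x : L m, e • x = 0) ∧
      ∃ v : L l, e • v = v ∧ v ≠ 0 ∧ ∀ x : L l, ∃ c : k, e • x = c • v := by
  have := hL.simple
  have := fun m => IsSimpleModule.nontrivial A (L m)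
  obtain ⟨v0, hv0⟩ := exists_ne (0 : L l)
  obtain ⟨x, rfl⟩ := hp v0
  -- The submodule `A x` together with `ker p` is everything, hence `A x = P`. A splitting `σ` of
  -- `π` satisfies `σ y • x = y`, and `σ x` is the desired idempotent.
  let π : A →ₗ[A] P := LinearMap.toSpanSingleton A P x
  have hπ : Function.Surjective π := by
    rw [← LinearMap.range_eq_top]
    apply hpc
    rw [eq_top_iff]
    intro z _
    obtain ⟨a, ha⟩ := IsSimpleModule.toSpanSingleton_surjective A hv0 (p z)
    rw [LinearMap.toSpanSingleton_apply] at ha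
    rw [← add_sub_cancel (a • x) z]
    refine Submodule.add_mem_sup ⟨a, rfl⟩ ?_
    rw [LinearMap.mem_ker, map_sub, map_smul, ha, sub_self]
  obtain ⟨σ, hσ⟩ := Module.projective_lifting_property π LinearMap.id hπ
  have hσ' : ∀ y, σ y • x = y := fun y => LinearMap.congr_fun hσ y
  -- If `σ x • u ≠ 0`, then `y ↦ σ y • u` maps `P` onto `L m`. The only maximal submodule of `P` is
  -- `ker p`, so this map factors through `p` and `L m` is isomorphic to `L l`.
  have hsurj : ∀ m (u : L m), σ x • u ≠ 0 → l = m ∧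
      ∀ y, p y = 0 → σ y • u = 0 := by
    intro m u hu
    let q : P →ₗ[A] L m := LinearMap.toSpanSingleton A _ u ∘ₗ σ
    have hq : Function.Surjective q := LinearMap.surjective_of_ne_zero (by
      intro h0
      exact hu (LinearMap.congr_fun h0 x))
    have hqp : LinearMap.ker p ≤ LinearMap.ker q := by
      by_contra hle
      have hco : IsCoatom (LinearMap.ker p) := by
        rw [← isSimpleModule_iff_isCoatom]
        exact IsSimpleModule.congr (p.quotKerEquivOfSurjective hp)
      have hco' : IsCoatom (LinearMap.ker q) := by
        rw [← isSimpleModule_iff_isCoatom]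
        exact IsSimpleModule.congr (q.quotKerEquivOfSurjective hq)
      have ht : LinearMap.ker q ⊔ LinearMap.ker p = ⊤ := by
        apply hco'.2
        exact left_lt_sup.2 hle
      have h1 := hpc _ ht
      exact hco'.1 h1
    have heq : LinearMap.ker p = LinearMap.ker q := by
      have hco : IsCoatom (LinearMap.ker p) := by
        rw [← isSimpleModule_iff_isCoatom]
        exact IsSimpleModule.congr (p.quotKerEquivOfSurjective hp)
      by_contra hne
      have := hco.2 _ (lt_of_le_of_ne hqp hne)
      have h0 : q x = 0 := by
        have : x ∈ LinearMap.ker q := this ▸ Submodule.mem_top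
        exact this
      exact hu h0
    refine ⟨hL.injective _ _ ⟨(p.quotKerEquivOfSurjective hp).symm.trans
      ((Submodule.quotEquivOfEq _ _ heq).trans (q.quotKerEquivOfSurjective hq))⟩, fun y hy => ?_⟩
    exact hqp hy
  have hidem : σ x * σ x = σ x := by
    rw [← smul_eq_mul, ← map_smul, hσ']
  refine ⟨σ x, hidem, fun m hm u => by_contra fun hu => hm (hsurj m u hu).1, p x, ?_, hv0,
    fun u => ?_⟩
  · rw [← map_smul, hσ']
  · by_cases hu : σ x • u = 0
    · exact ⟨0, by rw [hu, zero_smul]⟩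
    have hk := (hsurj l u hu).2
    let q : P →ₗ[A] L l := LinearMap.toSpanSingleton A _ u ∘ₗ σ
    let θ : L l →ₗ[A] L l := (LinearMap.ker p).liftQ q (fun y hy => hk y hy) ∘ₗ
      (p.quotKerEquivOfSurjective hp).symm.toLinearMap
    have hθ : ∀ y, θ (p y) = q y := by
      intro y
      have : (p.quotKerEquivOfSurjective hp).symm (p y) = (LinearMap.ker p).mkQ y := by
        rw [LinearEquiv.symm_apply_eq]
        rfl
      change (LinearMap.ker p).liftQ q (fun y hy => hk y hy) ((p.quotKerEquivOfSurjective hp).symm (p y)) = q y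
      rw [this]
      rfl
    -- Each `u` with `σ x • u ≠ 0` defines an endomorphism of `L l` with `p x ↦ σ x • u`. By Schur's
    -- lemma over an algebraically closed field it is a scalar.
    obtain ⟨c, hc⟩ := (IsSimpleModule.algebraMap_end_bijective_of_isAlgClosed (A := A) (V := L l)
      k).2 θ
    refine ⟨c, ?_⟩
    have h1 := hθ x
    rw [← hc] at h1
    exact h1.symm

namespace IsIdempotentSystem

variable {L : Λ → FDMod k A} {e : Λ → A} (h : IsIdempotentSystem L e)
include h

variable {M : Type u} [AddCommGroup M] [Module k M] [Module A M] [IsScalarTower k A M]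
  [Module.Finite k M]

theorem exists_le_equiv (N : Submodule A M) (hN : N ≠ ⊥) :
    ∃ (l : Λ) (S : Submodule A M) (g : L l →ₗ[A] M), S ≤ N ∧ Function.Injective g ∧
      LinearMap.range g = S := by
  have : IsArtinian A M := isArtinian_of_tower k inferInstance
  obtain ⟨S, hS, hSN⟩ := (eq_bot_or_exists_atom_le N).resolve_left hN
  have : IsSimpleModule A S := isSimpleModule_iff_isAtom.2 hS
  have : Module.Finite k S := Module.Finite.of_injective (S.subtype.restrictScalars k)
    Subtype.val_injective
  obtain ⟨l, ⟨φ⟩⟩ := h.indexing.exists_equiv S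
  refine ⟨l, S, S.subtype ∘ₗ φ.symm.toLinearMap, hSN,
    Subtype.val_injective.comp φ.symm.injective, ?_⟩
  rw [LinearMap.range_comp_of_range_eq_top _ (LinearEquiv.range φ.symm), Submodule.range_subtype]

theorem exists_le_ker (N : Submodule A M) (hN : N ≠ ⊤) :
    ∃ (l : Λ) (g : M →ₗ[A] L l), Function.Surjective g ∧ N ≤ LinearMap.ker g := by
  have : IsNoetherian A M := isNoetherian_of_tower k inferInstance
  obtain ⟨S, hS, hSN⟩ := (eq_top_or_exists_le_coatom N).resolve_left hN
  have : IsSimpleModule A (M ⧸ S) := isSimpleModule_iff_isCoatom.2 hS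
  have : Module.Finite k (M ⧸ S) := Module.Finite.of_surjective (S.mkQ.restrictScalars k)
    (Submodule.mkQ_surjective S)
  obtain ⟨l, ⟨φ⟩⟩ := h.indexing.exists_equiv (M ⧸ S)
  refine ⟨l, φ.toLinearMap ∘ₗ S.mkQ, φ.surjective.comp (Submodule.mkQ_surjective S), ?_⟩
  intro x hx
  have : S.mkQ x = 0 := (Submodule.Quotient.mk_eq_zero S).2 (hSN hx)
  rw [LinearMap.mem_ker, LinearMap.comp_apply, this, map_zero]

theorem eq_zero_of_forall (hz : ∀ l (x : M), e l • x = 0) (x : M) : x = 0 := by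
  by_contra hx
  obtain ⟨l, S, g, -, hg, -⟩ := h.exists_le_equiv (⊤ : Submodule A M) fun ht =>
    hx (by simpa [ht] using (Submodule.mem_top : x ∈ (⊤ : Submodule A M)))
  obtain ⟨v, hv, hv0, -⟩ := h.line l
  apply hv0
  apply hg
  rw [map_zero, ← hv, map_smul, hz]

theorem eq_of_smul_ne_zero {l m : Λ} {x : L m} (hx : e l • x ≠ 0) : l = m := by
  by_contra hlm
  exact hx (h.off l m hlm x)

/-- Multiplication by `e l` is exact and detects exactly the simple module `L l`. Conversely, any
simple quotient of the submodule generated by `e l • x` is not killed by `e l`, so it is `L l`. This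
reduces every condition on composition factors to equations `e m • x = 0`. -/
theorem isCompositionFactor_iff (l : Λ) :
    IsCompositionFactor A (L l) M ↔ ∃ x : M, e l • x ≠ 0 := by
  constructor
  · rintro ⟨-, N, f, hf⟩
    obtain ⟨v, hv, hv0, -⟩ := h.line l
    obtain ⟨n, rfl⟩ := hf v
    refine ⟨n, fun h0 => hv0 ?_⟩
    rw [← hv, ← map_smul]
    have : e l • n = 0 := Subtype.ext h0
    rw [this, map_zero]
  · rintro ⟨x, hx⟩
    refine ⟨h.indexing.simple l, ?_⟩
    let N := Submodule.span A {e l • x}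
    let y : N := ⟨e l • x, Submodule.mem_span_singleton_self _⟩
    have hy : e l • y = y := Subtype.ext (by
      change e l • e l • x = e l • x
      rw [smul_smul, h.idem])
    have hbt : (⊥ : Submodule A N) ≠ ⊤ := by
      intro hh
      have : y ∈ (⊥ : Submodule A N) := hh ▸ Submodule.mem_top
      exact hx (congrArg Subtype.val ((Submodule.mem_bot A).1 this))
    have : Module.Finite k N := Module.Finite.of_injective (N.subtype.restrictScalars k)
      Subtype.val_injective
    obtain ⟨m, g, hg, -⟩ := h.exists_le_ker (⊥ : Submodule A N) hbt
    have hgy : g y ≠ 0 := by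
      intro h0
      have hg0 : ∀ z, g z = 0 := by
        rintro ⟨z, hz⟩
        obtain ⟨a, rfl⟩ := Submodule.mem_span_singleton.1 hz
        change g (a • y) = 0
        rw [map_smul, h0, smul_zero]
      obtain ⟨v, -, hv0, -⟩ := h.line m
      obtain ⟨z, rfl⟩ := hg v
      exact hv0 (hg0 z)
    obtain rfl : l = m := h.eq_of_smul_ne_zero (x := g y) (by rwa [← map_smul, hy])
    exact ⟨N, g, hg⟩

theorem factorsLE_iff [PartialOrder Λ] {l : Λ} {X : FDMod k A} :
    FactorsLE L l X ↔ ∀ m, ¬ m ≤ l → ∀ x : X, e m • x = 0 := by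
  refine forall_congr' fun m => ?_
  rw [h.isCompositionFactor_iff]
  constructor
  · intro hh hm x
    by_contra hx
    exact hm (hh ⟨x, hx⟩)
  · rintro hh ⟨x, hx⟩
    by_contra hm
    exact hx (hh hm x)

theorem factorsLE_self [PartialOrder Λ] (l : Λ) : FactorsLE L l (L l) :=
  h.factorsLE_iff.2 fun _ hm _ => h.off _ _ (fun e => hm e.le) _

/-- A simple quotient of `M` is nonzero on the generator `x = e l • x`, so it is `L l`. Since `e l`
cuts out a line there, any two such quotient maps agree on `x` up to a scalar and have the same
kernel. Thus `M` has a unique maximal submodule. -/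
theorem cover_of_generator {l : Λ} {x : M} (hx : e l • x = x) (hgen : ∀ y : M, ∃ a : A, a • x = y)
    (p : M →ₗ[A] L l) (hp : Function.Surjective p) (N : Submodule A M)
    (hN : N ⊔ LinearMap.ker p = ⊤) : N = ⊤ := by
  by_contra hne
  obtain ⟨m, g, hg, hNg⟩ := h.exists_le_ker N hne
  have key : ∀ {m} (q : M →ₗ[A] L m), Function.Surjective q → q x ≠ 0 := by
    intro m q hq h0
    obtain ⟨v, -, hv0, -⟩ := h.line m
    obtain ⟨z, rfl⟩ := hq v
    obtain ⟨a, rfl⟩ := hgen z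
    exact hv0 (by rw [map_smul, h0, smul_zero])
  have hgx := key g hg
  obtain rfl : l = m := h.eq_of_smul_ne_zero (x := g x) (by rwa [← map_smul, hx])
  obtain ⟨v, hv, hv0, hline⟩ := h.line l
  obtain ⟨c, hc⟩ := hline (p x)
  obtain ⟨c', hc'⟩ := hline (g x)
  rw [← map_smul, hx] at hc hc'
  have hc0 : c ≠ 0 := by
    rintro rfl
    exact key p hp (by rw [hc, zero_smul])
  have hgp : g x = (c' * c⁻¹) • p x := by
    rw [hc, hc', smul_smul, mul_assoc, inv_mul_cancel₀ hc0, mul_one]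
  have hker : LinearMap.ker p ≤ LinearMap.ker g := by
    intro y hy
    obtain ⟨a, rfl⟩ := hgen y
    rw [LinearMap.mem_ker, map_smul] at hy ⊢
    rw [hgp, smul_comm, hy, smul_zero]
  have htop : LinearMap.ker g = ⊤ := top_le_iff.1 (hN ▸ sup_le hNg hker)
  apply hgx
  have : x ∈ LinearMap.ker g := htop ▸ Submodule.mem_top
  exact this

/-- A standard module represents the functor `X ↦ e l • X` on modules with factors at most `l`. This
functor is exact, which gives relative projectivity. -/
theorem isStandard_of [PartialOrder Λ] {l : Λ} {D : FDMod k A} {x : D} (hx : e l • x = x)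
    (hgen : ∀ y : D, ∃ a : A, a • x = y) (hD : FactorsLE L l D)
    (hlift : ∀ X : FDMod k A, FactorsLE L l X → ∀ y : X, e l • y = y →
      ∃ f : D →ₗ[A] X, f x = y) : IsStandard L l D where
  factors := hD
  cover := by
    obtain ⟨v, hv, hv0, -⟩ := h.line l
    obtain ⟨p, hp⟩ := hlift _ (h.factorsLE_self l) v hv
    have := h.indexing.simple l
    have hps : Function.Surjective p := LinearMap.surjective_of_ne_zero (by
      rintro rfl
      exact hv0 hp.symm)
    exact ⟨p, hps, h.cover_of_generator hx hgen p hps⟩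
  projective := by
    intro X Y hX hY g f hg
    obtain ⟨y, hy⟩ := hg (f x)
    obtain ⟨φ, hφ⟩ := hlift X hX (e l • y) (by rw [smul_smul, h.idem])
    refine ⟨φ, LinearMap.ext fun z => ?_⟩
    obtain ⟨a, rfl⟩ := hgen z
    rw [LinearMap.comp_apply, map_smul, map_smul, hφ, map_smul, hy, ← map_smul f (e l), hx,
      map_smul]

/-- The dual criterion: a map to `N` is determined by its composite with `ε`, and every functional
on `X` that factors through `e l` arises in this way. Extending functionals then replaces lifting
elements. -/
theorem isCostandard_of [PartialOrder Λ] {l : Λ} {N : FDMod k A} (ε : N →ₗ[k] k)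
    (hε : ∀ x, ε (e l • x) = ε x) (hnd : ∀ x, (∀ a : A, ε (a • x) = 0) → x = 0)
    (hN : FactorsLE L l N)
    (hlift : ∀ X : FDMod k A, FactorsLE L l X → ∀ ψ : X →ₗ[k] k, (∀ x, ψ (e l • x) = ψ x) →
      ∃ f : X →ₗ[A] N, ∀ x, ε (f x) = ψ x) : IsCostandard L l N where
  factors := hN
  envelope := by
    obtain ⟨v, hv, hv0, hline⟩ := h.line l
    have := h.indexing.simple l
    obtain ⟨ψ, hψ⟩ : ∃ ψ : L l →ₗ[k] k, ψ v ≠ 0 := by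
      by_contra! hh
      exact hv0 ((Module.forall_dual_apply_eq_zero_iff k v).1 hh)
    let sm : L l →ₗ[k] L l := Algebra.lsmul k k (L l) (e l)
    obtain ⟨i, hi⟩ := hlift _ (h.factorsLE_self l) (ψ ∘ₗ sm) (fun x => by
      change ψ (e l • e l • x) = ψ (e l • x)
      rw [smul_smul, h.idem])
    have hiv : ε (i v) ≠ 0 := by
      rw [hi]
      change ψ (e l • v) ≠ 0
      rwa [hv]
    refine ⟨i, LinearMap.injective_of_ne_zero (by rintro rfl; simp at hiv), fun S hS => ?_⟩
    by_contra hne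
    obtain ⟨m, T, g, hTS, hg, rfl⟩ := h.exists_le_equiv S hne
    have hT0 : ∃ w, g w ≠ 0 := by
      obtain ⟨w, -, hw0, -⟩ := h.line m
      exact ⟨w, fun h0 => hw0 (hg (by rw [h0, map_zero]))⟩
    obtain ⟨w, hw⟩ := hT0
    -- On a simple submodule other than `L l` the functional `ε` vanishes, because it factors
    -- through `e l`; nondegeneracy excludes this. Two embeddings of `L l` are proportional since
    -- `ε` is determined there by its value on the image of the line spanned by `v`.
    obtain rfl : l = m := by
      by_contra hlm
      refine hw (hnd _ fun a => ?_)
      rw [← hε, ← map_smul, ← map_smul, h.off _ _ hlm, map_zero, map_zero]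
    have hgi : ∀ x, g x = (ε (g v) / ε (i v)) • i x := by
      intro x
      rw [← sub_eq_zero]
      refine hnd _ fun a => ?_
      obtain ⟨c, hc⟩ := hline (a • x)
      have h1 : ε (g (a • x)) = c * ε (g v) := by
        rw [← hε, ← map_smul, hc, LinearMap.map_smul_of_tower, map_smul, smul_eq_mul]
      have h2 : ε (i (a • x)) = c * ε (i v) := by
        rw [← hε, ← map_smul, hc, LinearMap.map_smul_of_tower, map_smul, smul_eq_mul]
      rw [smul_sub, smul_comm, ← map_smul, ← map_smul, map_sub, map_smul ε, h1, h2, smul_eq_mul]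
      field_simp
      ring
    apply hw
    have : g w ∈ S ⊓ LinearMap.range i := by
      refine ⟨hTS ⟨w, rfl⟩, ?_⟩
      rw [hgi w]
      exact Submodule.smul_of_tower_mem _ _ ⟨w, rfl⟩
    rwa [hS, Submodule.mem_bot] at this
  injective := by
    intro X Y hX hY g f hg
    -- A `k`-linear retraction extends the functional `ε ∘ f` from `X` to `Y`. Precomposition with
    -- `e l` makes the extension invariant without changing it on `X`.
    obtain ⟨r, hr⟩ := LinearMap.exists_leftInverse_of_injective (g.restrictScalars k)
      (LinearMap.ker_eq_bot.2 hg)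
    have hr' : ∀ x, r (g x) = x := fun x => LinearMap.congr_fun hr x
    let s : Y →ₗ[k] Y := Algebra.lsmul k k Y (e l)
    obtain ⟨φ, hφ⟩ := hlift Y hY (ε ∘ₗ f.restrictScalars k ∘ₗ r ∘ₗ s) (fun y => by
      change ε (f (r (e l • e l • y))) = ε (f (r (e l • y)))
      rw [smul_smul, h.idem])
    refine ⟨φ, LinearMap.ext fun x => ?_⟩
    rw [← sub_eq_zero]
    refine hnd _ fun a => ?_
    rw [smul_sub, map_sub, LinearMap.comp_apply, ← map_smul, ← map_smul, hφ, ← map_smul,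
      sub_eq_zero]
    change ε (f (r (e l • g (a • x)))) = _
    rw [← map_smul, hr', map_smul, hε]

theorem standard_unique [PartialOrder Λ] {l : Λ} {D D' : FDMod k A} (hD : IsStandard L l D)
    (hD' : IsStandard L l D') : Nonempty (D ≃ₗ[A] D') := by
  obtain ⟨p, hp, hpc⟩ := hD.cover
  obtain ⟨p', hp', hpc'⟩ := hD'.cover
  obtain ⟨f, hf⟩ := hD.projective D' (L l) hD'.factors (h.factorsLE_self l) p' p hp'
  obtain ⟨g, hg⟩ := hD'.projective D (L l) hD.factors (h.factorsLE_self l) p p' hp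
  exact ⟨LinearEquiv.ofBijective f
    (bijective_of_covers (k := k) p p' hp hp' hpc hpc' f g hf hg)⟩

theorem costandard_unique [PartialOrder Λ] {l : Λ} {N N' : FDMod k A} (hN : IsCostandard L l N)
    (hN' : IsCostandard L l N') : Nonempty (N ≃ₗ[A] N') := by
  have key : ∀ {N N' : FDMod k A}, IsCostandard L l N → IsCostandard L l N' →
      ∃ f : N →ₗ[A] N', Function.Injective f := by
    intro N N' hN hN'
    obtain ⟨i, hi, hic⟩ := hN.envelope
    obtain ⟨i', hi', -⟩ := hN'.envelope
    obtain ⟨f, hf⟩ := hN'.injective (L l) N (h.factorsLE_self l) hN.factors i i' hi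
    refine ⟨f, LinearMap.ker_eq_bot.1 (hic _ ?_)⟩
    rw [eq_bot_iff]
    rintro _ ⟨hy, y, rfl⟩
    have : i' y = 0 := by rw [← hf]; exact hy
    rw [(map_eq_zero_iff i' hi').1 this, map_zero]
    exact Submodule.zero_mem _
  obtain ⟨f, hf⟩ := key hN hN'
  obtain ⟨g, hg⟩ := key hN' hN
  have h1 := LinearMap.finrank_le_finrank_of_injective (f := f.restrictScalars k) hf
  have h2 := LinearMap.finrank_le_finrank_of_injective (f := g.restrictScalars k) hg
  exact ⟨LinearEquiv.ofBijective f ⟨hf, (LinearMap.injective_iff_surjective_of_finrank_eq_finrank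
    (f := f.restrictScalars k) (le_antisymm h1 h2)).1 hf⟩⟩

theorem exists_generator {l : Λ} {p : M →ₗ[A] L l} (hp : Function.Surjective p)
    (hpc : ∀ N : Submodule A M, N ⊔ LinearMap.ker p = ⊤ → N = ⊤) :
    ∃ x : M, e l • x = x ∧ p x ≠ 0 ∧ ∀ y : M, ∃ a : A, a • x = y := by
  obtain ⟨v, hv, hv0, -⟩ := h.line l
  have := h.indexing.simple l
  obtain ⟨d, hd⟩ := hp v
  have hpx : p (e l • d) = v := by rw [map_smul, hd, hv]
  refine ⟨e l • d, by rw [smul_smul, h.idem], by rwa [hpx], fun y => ?_⟩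
  have ht : Submodule.span A {e l • d} = ⊤ := by
    apply hpc
    rw [eq_top_iff]
    intro z _
    obtain ⟨a, ha⟩ := IsSimpleModule.toSpanSingleton_surjective A hv0 (p z)
    rw [LinearMap.toSpanSingleton_apply] at ha
    rw [← add_sub_cancel (a • e l • d) z]
    refine Submodule.add_mem_sup (Submodule.smul_mem _ _ (Submodule.mem_span_singleton_self _)) ?_
    rw [LinearMap.mem_ker, map_sub, map_smul, hpx, ha, sub_self]
  exact Submodule.mem_span_singleton.1 (ht ▸ (Submodule.mem_top : y ∈ (⊤ : Submodule A M)))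

/-- If the kernel of `p` has no factor `L l`, then `e l • M` embeds in the line `e l • L l`. -/
theorem smul_mem_line [PartialOrder Λ] {l : Λ} {x : M} (hx : e l • x = x) {p : M →ₗ[A] L l}
    (hpx : p x ≠ 0) (hker : ∀ y, p y = 0 → e l • y = 0) (y : M) : ∃ c : k, e l • y = c • x := by
  obtain ⟨v, hv, hv0, hline⟩ := h.line l
  obtain ⟨c, hc⟩ := hline (p y)
  obtain ⟨c', hc'⟩ := hline (p x)
  rw [← map_smul] at hc hc'
  rw [hx] at hc'
  have hc0 : c' ≠ 0 := by
    rintro rfl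
    exact hpx (by rw [hc', zero_smul])
  refine ⟨c / c', ?_⟩
  have : e l • (e l • y - (c / c') • x) = 0 := by
    apply hker
    rw [map_sub, hc, LinearMap.map_smul_of_tower, hc', smul_smul, div_mul_cancel₀ _ hc0, sub_self]
  rwa [smul_sub, smul_smul, h.idem, smul_comm, hx, sub_eq_zero] at this

end IsIdempotentSystem

end IdempotentSystems

/-! ### Standard filtrations and the standard module as a quotient of `A` -/

section Filtrations

variable {k A : Type u} [Field k] [Ring A] [Algebra k A] {Λ : Type v}

/-- The submodule `N` of `M` has a finite filtration whose sections are the `D m`, `m ∈ w`. -/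
inductive HasFiltration (D : Λ → FDMod k A) {M : Type u} [AddCommGroup M] [Module A M] :
    Submodule A M → Multiset Λ → Prop
  | bot : HasFiltration D ⊥ 0
  | step {N N' : Submodule A M} {m : Λ} {w : Multiset Λ} (q : N →ₗ[A] D m)
      (hq : Function.Surjective q) (hle : N' ≤ N) (hk : ∀ x : N, q x = 0 ↔ (x : M) ∈ N')
      (hN' : HasFiltration D N' w) : HasFiltration D N (m ::ₘ w)

/-- The submodule of `M` generated by the `e m • M`, `m ∈ U`. -/
def idempotentTrace (e : Λ → A) (U : Set Λ) (M : Type u) [AddCommGroup M] [Module A M] :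
    Submodule A M :=
  Submodule.span A {y | ∃ m ∈ U, ∃ x : M, y = e m • x}

/-- The left ideal `A (1 - e l) + ∑ A e m A`, the sum being over all `m` with `¬ m ≤ l`. -/
def standardIdeal [PartialOrder Λ] (e : Λ → A) (l : Λ) : Submodule A A :=
  Submodule.span A ({1 - e l} ∪ {y | ∃ m, ¬ m ≤ l ∧ ∃ b : A, y = e m * b})

/-- The properties of the standard modules of a quasi-hereditary algebra in terms of idempotents. -/
structure IsStandardFamily [PartialOrder Λ] (e : Λ → A) (D : Λ → FDMod k A) : Prop where
  generator : ∀ l, ∃ x : D l, e l • x = x ∧ (∀ y : D l, ∃ a : A, a • x = y) ∧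
    ∀ y : D l, ∃ c : k, e l • y = c • x
  factors : ∀ l m, ¬ m ≤ l → ∀ y : D l, e m • y = 0

variable {M M' : Type u} [AddCommGroup M] [Module A M] [AddCommGroup M'] [Module A M']

theorem smul_mem_idempotentTrace {e : Λ → A} {U : Set Λ} {m : Λ} (hm : m ∈ U) (x : M) :
    e m • x ∈ idempotentTrace e U M :=
  Submodule.subset_span ⟨m, hm, x, rfl⟩

theorem map_mem_idempotentTrace {e : Λ → A} {U : Set Λ} (f : M →ₗ[A] M') {x : M}
    (hx : x ∈ idempotentTrace e U M) : f x ∈ idempotentTrace e U M' := by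
  have : idempotentTrace e U M ≤ (idempotentTrace e U M').comap f := by
    refine Submodule.span_le.2 ?_
    rintro _ ⟨m, hm, x, rfl⟩
    change f (e m • x) ∈ idempotentTrace e U M'
    rw [map_smul]
    exact smul_mem_idempotentTrace hm _
  exact this hx

theorem idempotentTrace_mono {e : Λ → A} {U V : Set Λ} (h : U ⊆ V) :
    idempotentTrace e U M ≤ idempotentTrace e V M :=
  Submodule.span_mono fun _ ⟨m, hm, hx⟩ => ⟨m, h hm, hx⟩

namespace HasFiltration

variable {D : Λ → FDMod k A}

theorem map (φ : M ≃ₗ[A] M') {N : Submodule A M} {w : Multiset Λ} (h : HasFiltration D N w) :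
    HasFiltration D (N.map φ.toLinearMap) w := by
  induction h with
  | bot => rw [Submodule.map_bot]; exact .bot
  | @step N N' m w q hq hle hk _ ih =>
    refine .step (q ∘ₗ (φ.submoduleMap N).symm.toLinearMap)
      (hq.comp (φ.submoduleMap N).symm.surjective) (Submodule.map_mono hle) (fun x => ?_) ih
    obtain ⟨y, rfl⟩ := (φ.submoduleMap N).surjective x
    rw [LinearMap.comp_apply, LinearEquiv.coe_coe, LinearEquiv.symm_apply_apply, hk]
    constructor
    · exact fun hy => ⟨y, hy, rfl⟩
    · rintro ⟨z, hz, hzy⟩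
      have : z = y := φ.injective hzy
      exact this ▸ hz

theorem finrank_eq [Module k M] [IsScalarTower k A M] [Module.Finite k M]
    {N : Submodule A M} {w : Multiset Λ} (h : HasFiltration D N w) :
    Module.finrank k N = (w.map fun m => Module.finrank k (D m)).sum := by
  induction h with
  | bot => exact finrank_bot k M
  | @step N N' m w q hq hle hk _ ih =>
    have hN : Module.Finite k N := Module.Finite.of_injective (N.subtype.restrictScalars k)
      Subtype.val_injective
    have h1 := LinearMap.finrank_range_add_finrank_ker (q.restrictScalars k)
    have h2 : LinearMap.range (q.restrictScalars k) = ⊤ := LinearMap.range_eq_top.2 hq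
    rw [h2, finrank_top] at h1
    let φ : LinearMap.ker (q.restrictScalars k) ≃ₗ[k] N' :=
      { toFun := fun x => ⟨(x : N), (hk x).1 x.2⟩
        invFun := fun x => ⟨⟨x, hle x.2⟩, (hk _).2 x.2⟩
        map_add' := fun _ _ => rfl
        map_smul' := fun _ _ => rfl
        left_inv := fun _ => rfl
        right_inv := fun _ => rfl }
    rw [Multiset.map_cons, Multiset.sum_cons, ← ih, ← h1, φ.finrank_eq]

variable [PartialOrder Λ] {e : Λ → A} (hD : IsStandardFamily e D)
include hD

/-- Each section `D m` is generated by a vector fixed by `e m`. Lifts of these vectors, multiplied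
by the idempotents, generate `N`. -/
theorem le_idempotentTrace {U : Set Λ} {N : Submodule A M} {w : Multiset Λ}
    (h : HasFiltration D N w) (hw : ∀ m ∈ w, m ∈ U) : N ≤ idempotentTrace e U M := by
  induction h with
  | bot => exact bot_le
  | @step N N' m w q hq hle hk _ ih =>
    intro y hy
    obtain ⟨x, hx, hgen, -⟩ := hD.generator m
    obtain ⟨x', rfl⟩ := hq x
    obtain ⟨a, ha⟩ := hgen (q ⟨y, hy⟩)
    have h1 : y - a • e m • (x' : M) ∈ N' := by
      refine (hk (⟨y, hy⟩ - a • e m • x')).1 ?_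
      rw [map_sub, map_smul, map_smul, hx, ha, sub_self]
    rw [← sub_add_cancel y (a • e m • (x' : M))]
    exact Submodule.add_mem _ (ih (fun m hm => hw m (Multiset.mem_cons_of_mem hm)) h1)
      (Submodule.smul_mem _ _ (smul_mem_idempotentTrace (hw m (Multiset.mem_cons_self _ _)) _))

/-- A section with label in `U` only contributes to the trace. A section with label `i` contributes
one vector, as `e i` cuts out a line in `D i`. A section whose label is not above `i` contributes
nothing, as `e i` kills it. -/
theorem exists_finset [Module k M] [IsScalarTower k A M] (hidem : ∀ l, e l * e l = e l)
    {U : Set Λ} {i : Λ} {N : Submodule A M} {w : Multiset Λ} [DecidableEq Λ]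
    (h : HasFiltration D N w) (hw : ∀ m ∈ w, m ∈ U ∨ m = i ∨ ¬ i ≤ m) :
    ∃ s : Finset M, s.card ≤ w.count i ∧ ∀ x ∈ N,
      e i • x ∈ Submodule.span k (s : Set M) ⊔ (idempotentTrace e U M).restrictScalars k := by
  classical
  induction h with
  | bot =>
    refine ⟨∅, by simp, fun x hx => ?_⟩
    rw [(Submodule.mem_bot A).1 hx, smul_zero]
    exact Submodule.zero_mem _
  | @step N N' m w q hq hle hk _ ih =>
    obtain ⟨s, hs, hsN⟩ := ih (fun m hm => hw m (Multiset.mem_cons_of_mem hm))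
    obtain ⟨x, hx, hgen, hline⟩ := hD.generator m
    rcases hw m (Multiset.mem_cons_self _ _) with hm | rfl | hm
    · refine ⟨s, hs.trans (Multiset.count_le_of_le _ (Multiset.le_cons_self _ _)),
        fun y hy => ?_⟩
      obtain ⟨x', rfl⟩ := hq x
      obtain ⟨a, ha⟩ := hgen (q ⟨y, hy⟩)
      have h1 : y - a • e m • (x' : M) ∈ N' := by
        refine (hk (⟨y, hy⟩ - a • e m • x')).1 ?_
        rw [map_sub, map_smul, map_smul, hx, ha, sub_self]
      rw [← sub_add_cancel y (a • e m • (x' : M)), smul_add]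
      refine Submodule.add_mem _ (hsN _ h1) (Submodule.mem_sup_right ?_)
      exact Submodule.smul_mem _ _ (Submodule.smul_mem _ _ (smul_mem_idempotentTrace hm _))
    · obtain ⟨x', rfl⟩ := hq x
      refine ⟨insert (e m • (x' : M)) s, (Finset.card_insert_le _ _).trans (by simpa using hs),
        fun y hy => ?_⟩
      obtain ⟨c, hc⟩ := hline (q ⟨y, hy⟩)
      have h1 : e m • y - c • (e m • (x' : M)) ∈ N' := by
        refine (hk (e m • ⟨y, hy⟩ - c • (e m • x'))).1 ?_
        rw [map_sub, map_smul, LinearMap.map_smul_of_tower, map_smul, hx, hc, sub_self]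
      have h2 := hsN _ h1
      rw [smul_sub, smul_smul, hidem, smul_comm, smul_smul, hidem] at h2
      rw [← sub_add_cancel (e m • y) (c • (e m • (x' : M)))]
      refine Submodule.add_mem _ ?_ (Submodule.mem_sup_left
        (Submodule.smul_mem _ _ (Submodule.subset_span (by simp))))
      have h3 : Submodule.span k (s : Set M) ≤
          Submodule.span k ((insert (e m • (x' : M)) s : Finset M) : Set M) :=
        Submodule.span_mono ?_
      · exact (sup_le_sup_right h3 ((idempotentTrace e U M).restrictScalars k)) h2
      rw [Finset.coe_insert]
      exact Set.subset_insert _ _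
    · refine ⟨s, hs.trans (Multiset.count_le_of_le _ (Multiset.le_cons_self _ _)),
        fun y hy => ?_⟩
      have h1 : e i • y ∈ N' := by
        refine (hk (e i • ⟨y, hy⟩)).1 ?_
        rw [map_smul, hD.factors m i hm]
      have h2 := hsN _ h1
      rwa [smul_smul, hidem] at h2

end HasFiltration

theorem one_sub_mem_standardIdeal [PartialOrder Λ] (e : Λ → A) (l : Λ) :
    1 - e l ∈ standardIdeal e l :=
  Submodule.subset_span (Or.inl rfl)

theorem mul_mem_standardIdeal [PartialOrder Λ] (e : Λ → A) {l m : Λ} (hm : ¬ m ≤ l) (b : A) :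
    e m * b ∈ standardIdeal e l :=
  Submodule.subset_span (Or.inr ⟨m, hm, b, rfl⟩)

theorem smul_eq_zero_of_mem_standardIdeal [PartialOrder Λ] {e : Λ → A} {l : Λ} {x : M}
    (hx : e l • x = x) (hz : ∀ m, ¬ m ≤ l → ∀ y : M, e m • y = 0) {a : A}
    (ha : a ∈ standardIdeal e l) : a • x = 0 := by
  have : standardIdeal e l ≤ LinearMap.ker (LinearMap.toSpanSingleton A M x) := by
    refine Submodule.span_le.2 ?_
    rintro _ (rfl | ⟨m, hm, b, rfl⟩)
    · simp [sub_smul, hx]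
    · change (e m * b) • x = 0
      rw [mul_smul, hz m hm]
  exact this ha

/-- A module over a finite dimensional algebra as a bundled finite dimensional module. -/
abbrev FDMod.of (k A : Type u) [Field k] [Ring A] [Algebra k A] (M : Type u) [AddCommGroup M]
    [Module k M] [Module A M] [IsScalarTower k A M] [Module.Finite k M] : FDMod k A :=
  ⟨M⟩

instance finite_quotient [Module.Finite k A] (I : Submodule A A) : Module.Finite k (A ⧸ I) :=
  Module.Finite.of_surjective (I.mkQ.restrictScalars k) (Submodule.mkQ_surjective _)

/-- The standard module as a quotient of the regular module. -/
abbrev standardQuotient (k : Type u) [Field k] [Algebra k A] [Module.Finite k A] [PartialOrder Λ]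
    (e : Λ → A) (l : Λ) : FDMod k A :=
  FDMod.of k A (A ⧸ standardIdeal e l)

namespace IsIdempotentSystem

variable {L : Λ → FDMod k A} {e : Λ → A} (h : IsIdempotentSystem L e) [PartialOrder Λ]
include h

theorem standardQuotient_factors [Module.Finite k A] (l m : Λ) (hm : ¬ m ≤ l)
    (x : standardQuotient k e l) : e m • x = 0 := by
  obtain ⟨b, rfl⟩ := Submodule.mkQ_surjective (standardIdeal e l) x
  rw [← map_smul]
  exact (Submodule.Quotient.mk_eq_zero _).2 (mul_mem_standardIdeal e hm b)

/-- A map from `A / standardIdeal e l` is a vector fixed by `e l` and killed by every `e m * b` with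
`¬ m ≤ l`. In a module with factors at most `l` the second condition is automatic. -/
theorem isStandard_standardQuotient [Module.Finite k A] (l : Λ) :
    IsStandard L l (standardQuotient k e l) := by
  refine h.isStandard_of (D := standardQuotient k e l)
    (x := (standardIdeal e l).mkQ (e l)) ?_ ?_ ?_ ?_
  · rw [← map_smul, smul_eq_mul, h.idem]
  · intro y
    obtain ⟨b, rfl⟩ := Submodule.mkQ_surjective (standardIdeal e l) y
    refine ⟨b, ?_⟩
    rw [← map_smul, ← sub_eq_zero, ← map_sub]
    refine (Submodule.Quotient.mk_eq_zero _).2 ?_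
    have : b • e l - b = -(b • (1 - e l)) := by simp [mul_sub]
    rw [this]
    exact Submodule.neg_mem _ (Submodule.smul_mem _ _ (one_sub_mem_standardIdeal e l))
  · exact h.factorsLE_iff.2 (h.standardQuotient_factors l)
  · intro X hX y hy
    refine ⟨(standardIdeal e l).liftQ (LinearMap.toSpanSingleton A X y) (fun a ha =>
      smul_eq_zero_of_mem_standardIdeal hy (h.factorsLE_iff.1 hX) ha), ?_⟩
    change e l • y = y
    exact hy

/-- The multiplicity of `L l` in its standard module is one, because the kernel of the map to `L l`
has only strictly smaller factors. -/
theorem isStandardFamily {D : Λ → FDMod k A} (hD : ∀ l, IsStandard L l (D l))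
    (hker : ∀ l, ∃ p : D l →ₗ[A] L l, Function.Surjective p ∧
      ∀ m, IsCompositionFactor A (L m) (LinearMap.ker p) → m < l) : IsStandardFamily e D where
  generator l := by
    obtain ⟨p, hp, hpc⟩ := (hD l).cover
    obtain ⟨x, hx, -, hgen⟩ := h.exists_generator hp hpc
    refine ⟨x, hx, hgen, fun y => ?_⟩
    obtain ⟨q, hq, hqk⟩ := hker l
    have hqx : q x ≠ 0 := by
      intro h0
      obtain ⟨v, -, hv0, -⟩ := h.line l
      obtain ⟨z, rfl⟩ := hq v
      obtain ⟨a, rfl⟩ := hgen z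
      exact hv0 (by rw [map_smul, h0, smul_zero])
    refine h.smul_mem_line hx hqx (fun y hy => ?_) y
    by_contra hne
    have hfin : Module.Finite k (LinearMap.ker q) :=
      Module.Finite.of_injective ((LinearMap.ker q).subtype.restrictScalars k)
        Subtype.val_injective
    refine lt_irrefl _ (hqk l ((h.isCompositionFactor_iff l).2 ⟨⟨y, hy⟩, fun h0 => hne ?_⟩))
    exact congrArg Subtype.val h0
  factors l := h.factorsLE_iff.1 (hD l).factors

theorem cover_span [Module.Finite k A] (l : Λ) :
    ∃ p : Submodule.span A {e l} →ₗ[A] L l, Function.Surjective p ∧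
      ∀ N : Submodule A (Submodule.span A {e l}), N ⊔ LinearMap.ker p = ⊤ → N = ⊤ := by
  obtain ⟨v, hv, hv0, -⟩ := h.line l
  have := h.indexing.simple l
  let x : Submodule.span A {e l} := ⟨e l, Submodule.mem_span_singleton_self _⟩
  have hx : e l • x = x := Subtype.ext (h.idem l)
  have hfin : Module.Finite k (Submodule.span A {e l}) :=
    Module.Finite.of_injective ((Submodule.span A {e l}).subtype.restrictScalars k)
      Subtype.val_injective
  let p : Submodule.span A {e l} →ₗ[A] L l :=
    LinearMap.toSpanSingleton A _ v ∘ₗ (Submodule.span A {e l}).subtype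
  have hp : Function.Surjective p := LinearMap.surjective_of_ne_zero (by
    intro h0
    apply hv0
    rw [← hv]
    exact LinearMap.congr_fun h0 x)
  refine ⟨p, hp, h.cover_of_generator hx (fun y => ?_) p hp⟩
  obtain ⟨a, ha⟩ := Submodule.mem_span_singleton.1 y.2
  exact ⟨a, Subtype.ext ha⟩

/-- The filtration of the projective module `A e l` of a quasi-hereditary algebra. -/
theorem exists_filtration [Module.Finite k A] (hq : IsQuasiHereditary L) :
    ∃ D : Λ → FDMod k A, (∀ l, IsStandard L l (D l)) ∧ IsStandardFamily e D ∧
      ∀ l, ∃ (N : Submodule A (Submodule.span A {e l})) (w : Multiset Λ),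
        HasFiltration D N w ∧ (∀ m ∈ w, l < m) ∧
        ∃ q : Submodule.span A {e l} →ₗ[A] D l, Function.Surjective q ∧ LinearMap.ker q = N := by
  obtain ⟨-, D, hD, hker, hP⟩ := hq
  refine ⟨D, hD, h.isStandardFamily hD hker, fun l => ?_⟩
  obtain ⟨P, hproj, ⟨p, hp, hpc⟩, n, F, hF, hF0, hFn, ⟨φ⟩, hsec⟩ := hP l
  obtain ⟨p', hp', hpc'⟩ := h.cover_span l
  have hfin : Module.Finite k (Submodule.span A {e l}) :=
    Module.Finite.of_injective ((Submodule.span A {e l}).subtype.restrictScalars k)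
      Subtype.val_injective
  obtain ⟨f, hf⟩ := Module.projective_lifting_property p' p hp'
  obtain ⟨x, hx, hpx⟩ : ∃ x : P, e l • x = x ∧ p x = p' ⟨e l, Submodule.mem_span_singleton_self _⟩
      := by
    obtain ⟨x, hx⟩ := hp (p' ⟨e l, Submodule.mem_span_singleton_self _⟩)
    refine ⟨e l • x, by rw [smul_smul, h.idem], ?_⟩
    rw [map_smul, hx, ← map_smul]
    exact congrArg p' (Subtype.ext (h.idem l))
  -- The given projective cover `P` and `A e l` both cover `L l`; maps in both directions over `L l`
  -- identify them, and the filtration is transported to `A e l`.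
  let g : Submodule.span A {e l} →ₗ[A] P :=
    LinearMap.toSpanSingleton A P x ∘ₗ (Submodule.span A {e l}).subtype
  have hg : p ∘ₗ g = p' := by
    ext ⟨y, hy⟩
    obtain ⟨a, rfl⟩ := Submodule.mem_span_singleton.1 hy
    change p ((a * e l) • x) = p' (a • ⟨e l, Submodule.mem_span_singleton_self _⟩)
    rw [mul_smul, hx, map_smul, map_smul, hpx]
  let φ' := LinearEquiv.ofBijective f (bijective_of_covers (k := k) p p' hp hp' hpc hpc' f g hf hg)
  -- The filtration is built upwards from `F (n + 1) = ⊥`. Stopping at `j = n` reaches `F 1` and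
  -- leaves out the top section, which is the standard module of `l` itself.
  have key : ∀ j, j ≤ n → ∃ w : Multiset Λ, HasFiltration D (F (n + 1 - j)) w ∧ ∀ m ∈ w, l < m := by
    intro j
    induction j with
    | zero => exact fun _ => ⟨0, by rw [Nat.sub_zero, hFn]; exact .bot, by simp⟩
    | succ j ih =>
      intro hj
      obtain ⟨w, hw, hwl⟩ := ih (by omega)
      obtain ⟨m, hm, ⟨ψ⟩⟩ := hsec (n + 1 - (j + 1)) (by omega) (by omega)
      have hs : n + 1 - (j + 1) + 1 = n + 1 - j := by omega
      rw [hs] at ψ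
      refine ⟨m ::ₘ w, .step (ψ.toLinearMap ∘ₗ Submodule.mkQ _)
        (ψ.surjective.comp (Submodule.mkQ_surjective _)) (hF (by omega)) (fun x => ?_) hw, ?_⟩
      · rw [LinearMap.comp_apply, LinearEquiv.coe_coe, LinearEquiv.map_eq_zero_iff]
        exact (Submodule.Quotient.mk_eq_zero _).trans Iff.rfl
      · simpa using ⟨hm, hwl⟩
  obtain ⟨w, hw, hwl⟩ := key n le_rfl
  rw [Nat.add_sub_cancel_left] at hw
  refine ⟨_, w, hw.map φ', hwl, φ.toLinearMap ∘ₗ Submodule.mkQ _ ∘ₗ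
    (LinearMap.codRestrict (F 0) φ'.symm.toLinearMap fun y => hF0 ▸ Submodule.mem_top), ?_, ?_⟩
  · refine φ.surjective.comp ((Submodule.mkQ_surjective _).comp ?_)
    rintro ⟨y, hy⟩
    exact ⟨φ' y, Subtype.ext (φ'.symm_apply_apply y)⟩
  · ext y
    obtain ⟨z, rfl⟩ := φ'.surjective y
    rw [LinearMap.mem_ker, LinearMap.comp_apply, LinearEquiv.coe_coe, LinearEquiv.map_eq_zero_iff]
    refine (Submodule.Quotient.mk_eq_zero _).trans ?_
    change φ'.symm (φ' z) ∈ F 1 ↔ _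
    rw [φ'.symm_apply_apply]
    constructor
    · exact fun hz => ⟨z, hz, rfl⟩
    · rintro ⟨z', hz', hzz⟩
      have : z' = z := φ'.injective hzz
      exact this ▸ hz'

end IsIdempotentSystem

end Filtrations

/-! ### Traces in the projective modules `A e_l` -/

section ProjectiveModules

variable {k A : Type u} [Field k] [Ring A] [Algebra k A] {Λ : Type v} [PartialOrder Λ]
  {L : Λ → FDMod k A} {e : Λ → A}

namespace IsIdempotentSystem

variable (h : IsIdempotentSystem L e) [Module.Finite k A] (hq : IsQuasiHereditary L)
include h

theorem mkQ_standardIdeal_ne_zero (l : Λ) : (standardIdeal e l).mkQ (e l) ≠ 0 := by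
  intro h0
  obtain ⟨v, hv, hv0, -⟩ := h.line l
  apply hv0
  rw [← hv]
  exact smul_eq_zero_of_mem_standardIdeal hv (fun m hm y => h.off m l (fun e => hm e.le) y)
    ((Submodule.Quotient.mk_eq_zero _).1 h0)

include hq

/-- The ideal is defined by labels that are not at most `l`, whereas the trace only uses labels in
`U`, which may be just those above `l`. In `A e l` the passage is possible because the kernel of the
map to the standard module is filtered by standard modules with larger labels. The general case is
its image under `A e l → M`, `e l ↦ x`. -/
theorem smul_mem_trace_of_mem_standardIdeal {M : Type u} [AddCommGroup M] [Module A M]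
    {l : Λ} {x : M} (hx : e l • x = x) {U : Set Λ} (hU : Set.Ioi l ⊆ U) {a : A}
    (ha : a ∈ standardIdeal e l) : a • x ∈ idempotentTrace e U M := by
  obtain ⟨D, -, hD, hfil⟩ := h.exists_filtration hq
  obtain ⟨N, w, hw, hwl, q, -, rfl⟩ := hfil l
  have hN := hw.le_idempotentTrace hD (U := Set.Ioi l) hwl
  have key : standardIdeal e l ≤ (idempotentTrace e U M).comap
      (LinearMap.toSpanSingleton A M x) := by
    refine Submodule.span_le.2 ?_
    rintro _ (rfl | ⟨m, hm, b, rfl⟩)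
    · change (1 - e l) • x ∈ idempotentTrace e U M
      rw [sub_smul, one_smul, hx, sub_self]
      exact Submodule.zero_mem _
    · let y : Submodule.span A {e l} := b • ⟨e l, Submodule.mem_span_singleton_self _⟩
      have hy : e m • y ∈ LinearMap.ker q := by
        rw [LinearMap.mem_ker, map_smul, hD.factors l m hm]
      have h1 := map_mem_idempotentTrace
        (LinearMap.toSpanSingleton A M x ∘ₗ (Submodule.span A {e l}).subtype) (hN hy)
      have h2 : (LinearMap.toSpanSingleton A M x ∘ₗ (Submodule.span A {e l}).subtype) (e m • y) =
          (e m * b) • x := by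
        change (e m * (b * e l)) • x = _
        rw [← mul_assoc, mul_smul, hx]
      rw [h2] at h1
      exact idempotentTrace_mono hU h1
  exact key ha

theorem idempotentTrace_span (l : Λ) :
    idempotentTrace e (Set.Ioi l) (Submodule.span A {e l}) =
      (standardIdeal e l).comap (Submodule.span A {e l}).subtype := by
  apply le_antisymm
  · refine Submodule.span_le.2 ?_
    rintro _ ⟨m, hm, x, rfl⟩
    exact mul_mem_standardIdeal e (not_le_of_gt hm) _
  · rintro ⟨y, hy⟩ hyI
    obtain ⟨a, rfl⟩ := Submodule.mem_span_singleton.1 hy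
    have h1 := h.smul_mem_trace_of_mem_standardIdeal hq
      (x := (⟨e l, Submodule.mem_span_singleton_self _⟩ : Submodule.span A {e l})) (l := l)
      (Subtype.ext (h.idem l)) (subset_refl (Set.Ioi l)) hyI
    convert h1 using 1
    refine Subtype.ext ?_
    change a * e l = (a * e l) * e l
    rw [mul_assoc, h.idem]

/-- The multiplicities in the filtration of a projective module bound the size of the sections of
the trace filtration, and the sum of the dimensions is as large as possible. -/
theorem exists_multiplicities [Fintype Λ] [DecidableEq Λ] (l : Λ) :
    ∃ n : Λ → ℕ, (∀ m, n m ≠ 0 → l < m) ∧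
      (∀ (i : Λ) (U : Set Λ), l < i → Set.Ioi i ⊆ U → IsUpperSet U →
        ∃ s : Finset (Submodule.span A {e l}), s.card ≤ n i ∧ ∀ x : Submodule.span A {e l},
          e i • x ∈ Submodule.span k (s : Set (Submodule.span A {e l})) ⊔
            (idempotentTrace e U (Submodule.span A {e l})).restrictScalars k) ∧
      ∑ m, n m * Module.finrank k (A ⧸ standardIdeal e m) ≤
        Module.finrank k (idempotentTrace e (Set.Ioi l) (Submodule.span A {e l})) := by
  obtain ⟨D, hDs, hD, hfil⟩ := h.exists_filtration hq
  obtain ⟨N, w, hw, hwl, q, hq', hqN⟩ := hfil l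
  have hfin : Module.Finite k (Submodule.span A {e l}) :=
    Module.Finite.of_injective ((Submodule.span A {e l}).subtype.restrictScalars k)
      Subtype.val_injective
  refine ⟨fun m => w.count m, fun m hm => hwl m (Multiset.count_ne_zero.1 hm), ?_, ?_⟩
  · intro i U hi hU hup
    -- The whole of `A e l` has one more section, with label `l`. It does not affect the count of
    -- `i`, since `i ≠ l`.
    have hw' : HasFiltration D (⊤ : Submodule A (Submodule.span A {e l})) (l ::ₘ w) := by
      refine .step (q ∘ₗ (⊤ : Submodule A (Submodule.span A {e l})).subtype) ?_ le_top ?_ hw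
      · intro y
        obtain ⟨x, rfl⟩ := hq' y
        exact ⟨⟨x, Submodule.mem_top⟩, rfl⟩
      · intro x
        rw [← hqN]
        rfl
    obtain ⟨s, hs, hsx⟩ := hw'.exists_finset hD h.idem (U := U) (i := i) (fun m _ => by
      by_cases h1 : m = i
      · exact Or.inr (Or.inl h1)
      by_cases h2 : i ≤ m
      · exact Or.inl (hU (lt_of_le_of_ne h2 (Ne.symm h1)))
      · exact Or.inr (Or.inr h2))
    refine ⟨s, ?_, fun x => hsx x Submodule.mem_top⟩
    rwa [Multiset.count_cons_of_ne hi.ne'] at hs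
  · have h1 : ∀ m, Module.finrank k (A ⧸ standardIdeal e m) = Module.finrank k (D m) := by
      intro m
      obtain ⟨φ⟩ := h.standard_unique (h.isStandard_standardQuotient m) (hDs m)
      exact (φ.restrictScalars k).finrank_eq
    simp only [h1]
    have h2 := hw.finrank_eq
    have h3 : (w.map fun m => Module.finrank k (D m)).sum =
        ∑ m, w.count m * Module.finrank k (D m) := by
      rw [Finset.sum_multiset_map_count]
      simp only [smul_eq_mul]
      refine Finset.sum_subset (Finset.subset_univ _) fun m _ hm => ?_
      rw [Multiset.mem_toFinset] at hm
      rw [Multiset.count_eq_zero.2 hm, zero_mul]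
    rw [← h3, ← h2]
    have : Module.Finite k (idempotentTrace e (Set.Ioi l) (Submodule.span A {e l})) :=
      Module.Finite.of_injective ((Submodule.subtype _).restrictScalars k) Subtype.val_injective
    have hle := hw.le_idempotentTrace hD (U := Set.Ioi l) hwl
    exact LinearMap.finrank_le_finrank_of_injective
      (f := (Submodule.inclusion hle).restrictScalars k) (Submodule.inclusion_injective hle)

end IsIdempotentSystem

end ProjectiveModules

/-! ### Homogeneous submodules, quotients and the regular graded module -/

section GradedConstructions

variable {k B : Type u} [Field k] [Ring B] [Algebra k B] {𝒜 : ℕ → Submodule k B}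

namespace GrMod

theorem comp_comp_smul (M : GrMod 𝒜) {n : ℕ} {a : B} (ha : a ∈ 𝒜 n) (i : ℤ) (x : M) :
    M.comp i (a • x) = a • M.comp (i - n) x := by
  obtain ⟨s, hs⟩ := M.exists_sum_comp x
  have key : ∀ j, M.comp i (a • M.comp j x) = a • M.comp (i - n) (M.comp j x) := by
    intro j
    have h1 := M.smul_mem ha (M.comp_mem j x)
    by_cases h : n + j = i
    · obtain rfl : j = i - n := by omega
      rw [h] at h1
      rw [comp_of_mem _ h1, comp_of_mem _ (M.comp_mem _ x)]
    · rw [comp_of_mem_ne _ h1 h, comp_of_mem_ne _ (M.comp_mem _ x) (by omega), smul_zero]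
  rw [← hs]
  simp only [map_sum, Finset.smul_sum, key]

theorem ext_comp (M : GrMod 𝒜) {x : M} (h : ∀ i, M.comp i x = 0) : x = 0 := by
  obtain ⟨s, hs⟩ := M.exists_sum_comp x
  rw [← hs]
  exact Finset.sum_eq_zero fun i _ => h i

/-- A submodule of a graded module is homogeneous if it contains the components of its
elements. -/
def IsHomogeneous (M : GrMod 𝒜) (N : Submodule B M) : Prop :=
  ∀ x ∈ N, ∀ i, M.comp i x ∈ N

theorem isHomogeneous_bot (M : GrMod 𝒜) : M.IsHomogeneous ⊥ := by
  intro x hx i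
  rw [(Submodule.mem_bot B).1 hx, map_zero]
  exact Submodule.zero_mem _

theorem IsHomogeneous.sup {M : GrMod 𝒜} {N N' : Submodule B M} (h : M.IsHomogeneous N)
    (h' : M.IsHomogeneous N') : M.IsHomogeneous (N ⊔ N') := by
  intro x hx i
  obtain ⟨y, hy, z, hz, rfl⟩ := Submodule.mem_sup.1 hx
  rw [map_add]
  exact Submodule.add_mem_sup (h y hy i) (h' z hz i)

/-- A homogeneous submodule as a graded module. -/
abbrev sub (M : GrMod 𝒜) (N : Submodule B M) (hN : M.IsHomogeneous N) : GrMod 𝒜 where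
  carrier := N
  finite := Module.Finite.of_injective (N.subtype.restrictScalars k) Subtype.val_injective
  deg i := (M.deg i).comap (N.subtype.restrictScalars k)
  isInternal := by
    refine isInternal_of_components _
      (fun i => AddMonoidHom.mk' (fun x => ⟨M.comp i x, hN x x.2 i⟩) ?_) ?_ ?_ ?_ ?_
    · intro x y
      ext
      simp
    · intro i x
      exact M.comp_mem i x
    · intro i x hx
      ext
      exact M.comp_of_mem hx
    · intro i j x hx hij
      ext
      exact M.comp_of_mem_ne hx hij
    · intro x
      obtain ⟨s, hs⟩ := M.exists_sum_comp (x : M)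
      refine ⟨s, ?_⟩
      ext
      simpa using hs
  smul_mem := fun hb hx => M.smul_mem hb hx

theorem quot_isInternal (M : GrMod 𝒜) (N : Submodule B M) (hN : M.IsHomogeneous N) :
    DirectSum.IsInternal fun i => (M.deg i).map (N.mkQ.restrictScalars k) := by
  refine isInternal_map M _ (Submodule.mkQ_surjective N) ?_
  intro i x hx
  exact (Submodule.Quotient.mk_eq_zero N).2 (hN x ((Submodule.Quotient.mk_eq_zero N).1 hx) i)

/-- The quotient by a homogeneous submodule as a graded module. -/
abbrev quot (M : GrMod 𝒜) (N : Submodule B M) (hN : M.IsHomogeneous N) : GrMod 𝒜 where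
  carrier := M ⧸ N
  addCommGroup := inferInstance
  moduleBase := inferInstance
  module := inferInstance
  isScalarTower := inferInstance
  finite := Module.Finite.of_surjective (N.mkQ.restrictScalars k) (Submodule.mkQ_surjective N)
  deg i := (M.deg i).map (N.mkQ.restrictScalars k)
  isInternal := quot_isInternal M N hN
  smul_mem := by
    rintro n i b _ hb ⟨x, hx, rfl⟩
    exact ⟨b • x, M.smul_mem hb hx, rfl⟩

/-- The inclusion between homogeneous submodules. -/
def subHom (M : GrMod 𝒜) {N N' : Submodule B M} (hN : M.IsHomogeneous N)
    (hN' : M.IsHomogeneous N') (h : N ≤ N') : M.sub N hN ⟶ M.sub N' hN' :=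
  ⟨Submodule.inclusion h, fun hx => hx⟩

theorem shortExact_of {M N P : GrMod 𝒜} (f : M ⟶ N) (g : N ⟶ P) (w : f ≫ g = 0)
    (hf : Function.Injective f.lin) (hg : Function.Surjective g.lin)
    (hr : ∀ x, g.lin x = 0 → ∃ y, f.lin y = x) : (ShortComplex.mk f g w).ShortExact where
  exact := ShortComplex.exact_of_f_is_kernel _ (isLimitOfInjective f g w hf hr)
  mono_f := by
    refine ⟨fun a b hab => ?_⟩
    ext x
    exact hf (congrArg (fun q => Hom.lin q x) hab)
  epi_g := by
    refine ⟨fun a b hab => ?_⟩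
    ext x
    obtain ⟨y, rfl⟩ := hg x
    exact congrArg (fun q => Hom.lin q y) hab

theorem mono_of_injective {M N : GrMod 𝒜} (f : M ⟶ N) (hf : Function.Injective f.lin) : Mono f :=
  ⟨fun a b hab => by
    ext x
    exact hf (congrArg (fun q => Hom.lin q x) hab)⟩

theorem epi_of_surjective {M N : GrMod 𝒜} (f : M ⟶ N) (hf : Function.Surjective f.lin) : Epi f :=
  ⟨fun a b hab => by
    ext x
    obtain ⟨y, rfl⟩ := hf x
    exact congrArg (fun q => Hom.lin q y) hab⟩

theorem nonempty_iso_of_bijective {M N : GrMod 𝒜} (f : M ⟶ N) (hf : Function.Bijective f.lin) :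
    Nonempty (M ≅ N) := by
  have := mono_of_injective f hf.1
  have := epi_of_surjective f hf.2
  have := isIso_of_mono_of_epi f
  exact ⟨asIso f⟩

theorem isZero_of_forall {M : GrMod 𝒜} (h : ∀ x : M, x = 0) : IsZero M :=
  (IsZero.iff_id_eq_zero _).2 (by ext x; rw [h x, map_zero, map_zero])

/-- The linear structure is needed to speak of finite dimensional spaces of morphisms and
extensions. -/
instance (M N : GrMod 𝒜) : SMul k (M ⟶ N) :=
  ⟨fun c f => ⟨c • f.lin, fun hx => (N.deg _).smul_mem c (f.map_mem hx)⟩⟩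

@[simp] theorem smul_lin {M N : GrMod 𝒜} (c : k) (f : M ⟶ N) (x : M) :
    Hom.lin (c • f) x = c • f.lin x := rfl

instance (M N : GrMod 𝒜) : Module k (M ⟶ N) where
  one_smul f := by ext; simp
  mul_smul a b f := by ext; simp [mul_smul]
  smul_zero a := by ext; simp
  smul_add a f g := by ext; simp
  add_smul a b f := by ext; simp [add_smul]
  zero_smul f := by ext; simp

instance : Linear k (GrMod 𝒜) where
  smul_comp := by intros; ext; simp
  comp_smul := by intros; ext; simp

variable [GradedAlgebra 𝒜]

theorem isHomogeneous_span (M : GrMod 𝒜) (S : Set M)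
    (hS : ∀ x ∈ S, ∀ i, M.comp i x ∈ Submodule.span B S) :
    M.IsHomogeneous (Submodule.span B S) := by
  classical
  intro x hx
  induction hx using Submodule.span_induction with
  | mem x hx => exact hS x hx
  | zero => exact fun i => by rw [map_zero]; exact Submodule.zero_mem _
  | add x y _ _ hx hy => exact fun i => by rw [map_add]; exact Submodule.add_mem _ (hx i) (hy i)
  | smul a x _ hx =>
    intro i
    rw [← DirectSum.sum_support_decompose 𝒜 a, Finset.sum_smul, map_sum]
    refine Submodule.sum_mem _ fun n _ => ?_
    rw [comp_comp_smul M (SetLike.coe_mem _)]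
    exact Submodule.smul_mem _ _ (hx _)

theorem isHomogeneous_span_singleton (M : GrMod 𝒜) {x : M} {s : ℤ} (hx : x ∈ M.deg s) :
    M.IsHomogeneous (Submodule.span B {x}) := by
  refine M.isHomogeneous_span _ ?_
  rintro _ rfl i
  by_cases h : s = i
  · subst h
    rw [comp_of_mem _ hx]
    exact Submodule.mem_span_singleton_self _
  · rw [comp_of_mem_ne _ hx h]
    exact Submodule.zero_mem _

variable (𝒜) in
/-- The regular graded module. -/
abbrev regular [Module.Finite k B] : GrMod 𝒜 where
  carrier := B
  deg i := if 0 ≤ i then 𝒜 i.toNat else ⊥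
  isInternal := by
    refine isInternal_of_components _ (fun i => AddMonoidHom.mk'
      (fun b => if 0 ≤ i then (DirectSum.decompose 𝒜 b i.toNat : B) else 0) ?_) ?_ ?_ ?_ ?_
    · intro x y
      by_cases h : 0 ≤ i <;> simp [h]
    · intro i x
      by_cases h : 0 ≤ i <;> simp [h]
    · intro i x hx
      by_cases h : 0 ≤ i
      · simp only [h, if_true] at hx
        simp [h, DirectSum.decompose_of_mem_same 𝒜 hx]
      · simp only [h, if_false, Submodule.mem_bot] at hx
        simp [hx]
    · intro i j x hx hij
      by_cases h : 0 ≤ i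
      · simp only [h, if_true] at hx
        by_cases hj : 0 ≤ j
        · simp [hj, DirectSum.decompose_of_mem_ne 𝒜 hx (show i.toNat ≠ j.toNat by omega)]
        · simp [hj]
      · simp only [h, if_false, Submodule.mem_bot] at hx
        simp [hx]
    · intro x
      classical
      refine ⟨(DirectSum.decompose 𝒜 x).support.map ⟨Nat.cast, Nat.cast_injective⟩, ?_⟩
      simp only [AddMonoidHom.mk'_apply, Finset.sum_map, Function.Embedding.coeFn_mk,
        Nat.cast_nonneg, if_true, Int.toNat_natCast]
      exact DirectSum.sum_support_decompose 𝒜 x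
  smul_mem := by
    intro n i b x hb hx
    by_cases h : 0 ≤ i
    · simp only [h, if_true] at hx
      have h1 : (n + i : ℤ).toNat = n + i.toNat := by omega
      rw [if_pos (by omega), h1]
      exact SetLike.mul_mem_graded hb hx
    · simp only [h, if_false, Submodule.mem_bot] at hx
      rw [hx, smul_zero]
      exact Submodule.zero_mem _

section

variable [Module.Finite k B]

theorem mem_regular_deg_natCast {n : ℕ} {b : B} : b ∈ (regular 𝒜).deg n ↔ b ∈ 𝒜 n := by
  change b ∈ (if (0 : ℤ) ≤ (n : ℤ) then 𝒜 (n : ℤ).toNat else ⊥) ↔ _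
  rw [if_pos (Int.natCast_nonneg n), Int.toNat_natCast]

theorem mem_regular_deg_zero {b : B} : b ∈ (regular 𝒜).deg 0 ↔ b ∈ 𝒜 0 :=
  mem_regular_deg_natCast (n := 0)

theorem eq_zero_of_mem_regular_deg {i : ℤ} (hi : i < 0) {b : B} (hb : b ∈ (regular 𝒜).deg i) :
    b = 0 := by
  change b ∈ (if (0 : ℤ) ≤ i then 𝒜 i.toNat else ⊥) at hb
  rwa [if_neg (by omega), Submodule.mem_bot] at hb

theorem smul_mem_of_mem_regular {M : GrMod 𝒜} {i j : ℤ} {b : B} {x : M}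
    (hb : b ∈ (regular 𝒜).deg i) (hx : x ∈ M.deg j) : b • x ∈ M.deg (i + j) := by
  by_cases hi : 0 ≤ i
  · obtain ⟨n, rfl⟩ := Int.eq_ofNat_of_zero_le hi
    exact M.smul_mem (mem_regular_deg_natCast.1 hb) hx
  · rw [eq_zero_of_mem_regular_deg (by omega) hb, zero_smul]
    exact Submodule.zero_mem _

end

end GrMod

end GradedConstructions

/-! ### Inflation from degree 0 and graded standard modules -/

section GradedStandardModules

variable {k B : Type u} [Field k] [Ring B] [Algebra k B] {𝒜 : ℕ → Submodule k B}
  [GradedAlgebra 𝒜]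

namespace FDMod

theorem inflate_smul_def {X : FDMod k (𝒜 0)} (b : B) (x : X) :
    (@HSMul.hSMul B X X (@instHSMul B X X.inflate.module.toSMul) b x) =
      GradedRing.projZeroRingHom' 𝒜 b • x := rfl

theorem projZero_coe (a : 𝒜 0) : GradedRing.projZeroRingHom' 𝒜 (a : B) = a := by
  ext
  simp

theorem inflate_coe_smul {X : FDMod k (𝒜 0)} (a : 𝒜 0) (x : X) :
    (@HSMul.hSMul B X X (@instHSMul B X X.inflate.module.toSMul) (a : B) x) = a • x := by
  rw [inflate_smul_def, projZero_coe]

/-- Maps of `𝒜 0`-modules as maps of the inflated modules. -/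
def inflateMap {X Y : FDMod k (𝒜 0)} (f : X →ₗ[𝒜 0] Y) : X.inflate →ₗ[B] Y.inflate where
  toFun := f
  map_add' := f.map_add
  map_smul' b x := f.map_smul (GradedRing.projZeroRingHom' 𝒜 b) x

/-- Maps of inflated modules as maps of `𝒜 0`-modules. -/
def deflateMap {X Y : FDMod k (𝒜 0)} (f : X.inflate →ₗ[B] Y.inflate) : X →ₗ[𝒜 0] Y where
  toFun := f
  map_add' := f.map_add
  map_smul' a x := by
    have h := f.map_smul (a : B) x
    exact (congrArg f (inflate_coe_smul a x)).symm.trans (h.trans (inflate_coe_smul a (f x)))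

end FDMod

open FDMod

variable {Λ : Type v} {L : Λ → FDMod k (𝒜 0)}

/-- The projection from `B` to its degree 0 part is surjective, so a module and its inflation have
the same submodules and the same homomorphisms. -/
theorem IsSimpleIndexing.of_inflate
    (h : IsSimpleIndexing (fun l => ((L l).inflate : FDMod k B))) : IsSimpleIndexing L := by
  have hs : ∀ X : FDMod k (𝒜 0), IsSimpleModule B X.inflate ↔ IsSimpleModule (𝒜 0) X := by
    intro X
    rw [isSimpleModule_iff_toSpanSingleton_surjective,
      isSimpleModule_iff_toSpanSingleton_surjective]
    refine and_congr Iff.rfl (forall_congr' fun m => imp_congr Iff.rfl ⟨fun h x => ?_, fun h x => ?_⟩)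
    · obtain ⟨b, hb⟩ := h x
      exact ⟨GradedRing.projZeroRingHom' 𝒜 b, hb⟩
    · obtain ⟨b, hb⟩ := h x
      exact ⟨(b : B), (inflate_coe_smul b m).trans hb⟩
  refine ⟨fun l => (hs _).1 (h.simple l), ?_, ?_⟩
  · rintro l m ⟨φ⟩
    refine h.injective l m ⟨LinearEquiv.ofBijective (inflateMap φ.toLinearMap) φ.bijective⟩
  · intro S hS
    obtain ⟨l, ⟨φ⟩⟩ := h.complete S.inflate ((hs S).2 hS)
    exact ⟨l, ⟨LinearEquiv.ofBijective (deflateMap φ.toLinearMap) φ.bijective⟩⟩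

/-- The simple modules are inflated, so an idempotent acts on them through its degree 0 component.
This component is again idempotent because the projection is a ring homomorphism. Idempotents of
degree 0 make all later constructions homogeneous, and they serve `B` and `𝒜 0` at once. -/
theorem exists_idempotentSystem [IsAlgClosed k] [PartialOrder Λ]
    (hq : IsQuasiHereditary (fun l => ((L l).inflate : FDMod k B))) :
    ∃ e : Λ → 𝒜 0, IsIdempotentSystem (fun l => ((L l).inflate : FDMod k B)) (fun l => (e l : B)) ∧
      IsIdempotentSystem L e := by
  obtain ⟨hL, D, -, -, hP⟩ := hq
  have key : ∀ l, ∃ e : B, e * e = e ∧ (∀ m, l ≠ m → ∀ x : (L m).inflate, e • x = 0) ∧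
      ∃ v : (L l).inflate, e • v = v ∧ v ≠ 0 ∧ ∀ x : (L l).inflate, ∃ c : k, e • x = c • v := by
    intro l
    obtain ⟨P, hproj, ⟨p, hp, hpc⟩, -⟩ := hP l
    exact exists_idempotent hL l P p hp hpc
  choose f hf1 hf2 hf3 using key
  have hsm : ∀ (l m : Λ) (x : L m), (GradedRing.projZeroRingHom' 𝒜 (f l) : B) •
      (show (L m).inflate from x) = f l • (show (L m).inflate from x) := by
    intro l m x
    exact inflate_coe_smul (GradedRing.projZeroRingHom' 𝒜 (f l)) x
  refine ⟨fun l => GradedRing.projZeroRingHom' 𝒜 (f l), ⟨hL, fun l => ?_, fun l m hlm x => ?_,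
    fun l => ?_⟩, ⟨hL.of_inflate, fun l => ?_, hf2, hf3⟩⟩
  · rw [← SetLike.GradeZero.coe_mul, ← map_mul, hf1]
  · exact (hsm l m x).trans (hf2 l m hlm x)
  · obtain ⟨v, hv, hv0, hline⟩ := hf3 l
    refine ⟨v, (hsm l l v).trans hv, hv0, fun x => ?_⟩
    obtain ⟨c, hc⟩ := hline x
    exact ⟨c, (hsm l l x).trans hc⟩
  · rw [← map_mul, hf1]

namespace GrMod

theorem comp_smul_base (M : GrMod 𝒜) (i : ℤ) (c : k) (x : M) :
    M.comp i (c • x) = c • M.comp i x := by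
  have h := M.comp_comp_smul (SetLike.algebraMap_mem_graded 𝒜 c) i x
  rwa [algebraMap_smul, algebraMap_smul, Nat.cast_zero, sub_zero] at h

theorem exists_degrees (M : GrMod 𝒜) : ∃ s : Finset ℤ, ∀ i ∉ s, ∀ x, M.comp i x = 0 := by
  classical
  let b := Module.finBasis k M
  choose t ht using fun j => M.exists_sum_comp (b j)
  refine ⟨Finset.univ.biUnion t, fun i hi x => ?_⟩
  rw [← b.sum_repr x, map_sum]
  refine Finset.sum_eq_zero fun j _ => ?_
  rw [comp_smul_base, ← ht j, map_sum, Finset.sum_eq_zero, smul_zero]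
  intro i' hi'
  refine M.comp_of_mem_ne (M.comp_mem _ _) ?_
  rintro rfl
  exact hi (Finset.mem_biUnion.2 ⟨j, Finset.mem_univ _, hi'⟩)

theorem exists_sum_comp_eq (M : GrMod 𝒜) : ∃ s : Finset ℤ, ∀ x, ∑ i ∈ s, M.comp i x = x := by
  classical
  obtain ⟨s, hs⟩ := M.exists_degrees
  refine ⟨s, fun x => ?_⟩
  rw [← sub_eq_zero]
  refine M.ext_comp fun j => ?_
  rw [map_sub, map_sum]
  by_cases hj : j ∈ s
  · rw [Finset.sum_eq_single_of_mem j hj, M.comp_of_mem (M.comp_mem _ _), sub_self]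
    exact fun i _ hij => M.comp_of_mem_ne (M.comp_mem _ _) hij
  · rw [hs j hj, sub_zero]
    refine Finset.sum_eq_zero fun i hi => M.comp_of_mem_ne (M.comp_mem _ _) ?_
    rintro rfl
    exact hj hi

variable [Module.Finite k B] [PartialOrder Λ] (e : Λ → 𝒜 0)

theorem comp_regular_mul_of_mem_zero {a : B} (ha : a ∈ 𝒜 0) (i : ℤ) (b : B) :
    (regular 𝒜).comp i (a * b : B) = (a * (regular 𝒜).comp i b : B) := by
  have h := (regular 𝒜).comp_comp_smul ha i b
  rwa [Nat.cast_zero, sub_zero] at h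

theorem comp_regular_of_mem_zero {a : B} (ha : a ∈ 𝒜 0) (i : ℤ) :
    (regular 𝒜).comp i a = if i = 0 then a else 0 := by
  split_ifs with hi
  · exact (regular 𝒜).comp_of_mem (hi ▸ mem_regular_deg_zero.2 ha)
  · exact (regular 𝒜).comp_of_mem_ne (mem_regular_deg_zero.2 ha) (Ne.symm hi)

theorem isHomogeneous_standardIdeal (l : Λ) :
    (regular 𝒜).IsHomogeneous (standardIdeal (fun l => (e l : B)) l) := by
  refine isHomogeneous_span _ _ ?_
  intro x hx i
  obtain hx | ⟨m, hm, b, hb⟩ := hx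
  · have h : x ∈ standardIdeal (fun l => (e l : B)) l :=
      (show x = 1 - (e l : B) from hx) ▸ one_sub_mem_standardIdeal (fun l => (e l : B)) l
    have h1 : (regular 𝒜).comp i x = if i = 0 then x else 0 :=
      comp_regular_of_mem_zero
        (hx ▸ Submodule.sub_mem _ SetLike.GradedOne.one_mem (e l).2) i
    rw [h1]
    split_ifs
    · exact h
    · exact Submodule.zero_mem _
  · subst hb
    have h1 := comp_regular_mul_of_mem_zero (e m).2 i b
    exact h1 ▸ mul_mem_standardIdeal (fun l => (e l : B)) hm ((regular 𝒜).comp i b)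

/-- The graded standard module generated in degree `0`. -/
abbrev standard (l : Λ) : GrMod 𝒜 :=
  (regular 𝒜).quot (standardIdeal (fun l => (e l : B)) l) (isHomogeneous_standardIdeal e l)

/-- The generator of the graded standard module. -/
def standardGen (l : Λ) : standard e l :=
  (standardIdeal (fun l => (e l : B)) l).mkQ (e l : B)

variable {e}

theorem standardGen_mem (l : Λ) : standardGen e l ∈ (standard e l).deg 0 :=
  ⟨(e l : B), mem_regular_deg_zero.2 (e l).2, rfl⟩

theorem smul_standardGen (l : Λ) (b : B) :
    b • standardGen e l = (standardIdeal (fun l => (e l : B)) l).mkQ b := by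
  rw [← sub_eq_zero]
  change (standardIdeal (fun l => (e l : B)) l).mkQ (b • (e l : B)) - _ = 0
  rw [← map_sub]
  refine (Submodule.Quotient.mk_eq_zero _).2 ?_
  have : b • (e l : B) - b = -(b • (1 - (e l : B))) := by simp [mul_sub]
  rw [this]
  exact Submodule.neg_mem _ (Submodule.smul_mem _ _
    (one_sub_mem_standardIdeal (fun l => (e l : B)) l))

theorem exists_smul_standardGen (l : Λ) (x : standard e l) :
    ∃ b : B, b • standardGen e l = x := by
  obtain ⟨b, rfl⟩ := Submodule.mkQ_surjective (standardIdeal (fun l => (e l : B)) l) x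
  exact ⟨b, smul_standardGen l b⟩

theorem smul_standardGen_eq_zero (l : Λ) (b : B) :
    b • standardGen e l = 0 ↔ b ∈ standardIdeal (fun l => (e l : B)) l := by
  rw [smul_standardGen]
  exact Submodule.Quotient.mk_eq_zero _

theorem exists_mem_deg_smul_standardGen (l : Λ) {i : ℤ} {x : standard e l}
    (hx : x ∈ (standard e l).deg i) : ∃ b ∈ (regular 𝒜).deg i, b • standardGen e l = x := by
  obtain ⟨b, hb, rfl⟩ := hx
  exact ⟨b, hb, smul_standardGen l b⟩

theorem isGradedStandard_standard
    (h : IsIdempotentSystem (fun l => ((L l).inflate : FDMod k B)) (fun l => (e l : B))) (l : Λ) :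
    IsGradedStandard L l (standard e l) where
  standard := h.isStandard_standardQuotient l
  deg_neg i hi := by
    rw [eq_bot_iff]
    intro x hx
    obtain ⟨b, hb, rfl⟩ := exists_mem_deg_smul_standardGen l hx
    rw [eq_zero_of_mem_regular_deg hi hb, zero_smul]
    exact Submodule.zero_mem _
  deg_zero h0 := by
    have := standardGen_mem (e := e) l
    rw [h0, Submodule.mem_bot] at this
    exact h.mkQ_standardIdeal_ne_zero l this

end GrMod

end GradedStandardModules

/-! ### Costandard modules as spaces of functionals -/

section Costandard

variable {k A : Type u} [Field k] [Ring A] [Algebra k A] {Λ : Type v} [PartialOrder Λ]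

variable (k) in
/-- The functionals on `A` that form the costandard module attached to the idempotent `e l`. -/
def costandardSpace (e : Λ → A) (l : Λ) : Submodule k (Module.Dual k A) where
  carrier := {f | (∀ b, f (e l * b) = f b) ∧ ∀ m, ¬ m ≤ l → ∀ b c, f (b * (e m * c)) = 0}
  add_mem' := by
    rintro f g ⟨h1, h2⟩ ⟨h3, h4⟩
    exact ⟨fun b => by simp [h1, h3], fun m hm b c => by simp [h2 m hm, h4 m hm]⟩
  zero_mem' := ⟨fun _ => rfl, fun _ _ _ _ => rfl⟩
  smul_mem' := by
    rintro c f ⟨h1, h2⟩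
    exact ⟨fun b => by simp [h1], fun m hm b c => by simp [h2 m hm]⟩

variable {e : Λ → A} {l : Λ}

instance : SMul A (costandardSpace k e l) :=
  ⟨fun a f => ⟨(f : Module.Dual k A) ∘ₗ LinearMap.mulRight k a, fun b => by
    change f.1 (e l * b * a) = f.1 (b * a)
    rw [mul_assoc, f.2.1], fun m hm b c => by
    change f.1 (b * (e m * c) * a) = 0
    rw [mul_assoc, mul_assoc, f.2.2 m hm]⟩⟩

@[simp] theorem costandardSpace_smul_apply (a : A) (f : costandardSpace k e l) (x : A) :
    (a • f).1 x = f.1 (x * a) := rfl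

theorem costandardSpace_ext {f g : costandardSpace k e l} (h : ∀ x, f.1 x = g.1 x) : f = g :=
  Subtype.ext (LinearMap.ext h)

instance : Module A (costandardSpace k e l) where
  one_smul f := costandardSpace_ext fun x => by simp
  mul_smul a b f := costandardSpace_ext fun x => by simp [mul_assoc]
  smul_zero a := costandardSpace_ext fun x => rfl
  smul_add a f g := costandardSpace_ext fun x => rfl
  add_smul a b f := costandardSpace_ext fun x => by
    change f.1 (x * (a + b)) = f.1 (x * a) + f.1 (x * b)
    rw [mul_add, map_add]
  zero_smul f := costandardSpace_ext fun x => by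
    change f.1 (x * 0) = 0
    rw [mul_zero, map_zero]

instance : IsScalarTower k A (costandardSpace k e l) where
  smul_assoc c a f := costandardSpace_ext fun x => by
    change f.1 (x * (c • a)) = c • f.1 (x * a)
    rw [mul_smul_comm, map_smul]

/-- The functional on a module with factors at most `l` as a map to the costandard module. -/
def toCostandard {X : Type u} [AddCommGroup X] [Module k X] [Module A X] [IsScalarTower k A X]
    (hX : ∀ m, ¬ m ≤ l → ∀ x : X, e m • x = 0) (ψ : X →ₗ[k] k) (hψ : ∀ x, ψ (e l • x) = ψ x) :
    X →ₗ[A] costandardSpace k e l where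
  toFun x := ⟨ψ ∘ₗ (LinearMap.toSpanSingleton A X x).restrictScalars k, fun b => by
    change ψ ((e l * b) • x) = ψ (b • x)
    rw [mul_smul, hψ], fun m hm b c => by
    change ψ ((b * (e m * c)) • x) = 0
    rw [mul_smul, mul_smul, hX m hm, smul_zero, map_zero]⟩
  map_add' x y := costandardSpace_ext fun b => by
    change ψ (b • (x + y)) = ψ (b • x) + ψ (b • y)
    rw [smul_add, map_add]
  map_smul' a x := costandardSpace_ext fun b => by
    change ψ (b • a • x) = ψ ((b * a) • x)
    rw [mul_smul]

theorem toCostandard_apply {X : Type u} [AddCommGroup X] [Module k X] [Module A X]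
    [IsScalarTower k A X] (hX : ∀ m, ¬ m ≤ l → ∀ x : X, e m • x = 0) (ψ : X →ₗ[k] k)
    (hψ : ∀ x, ψ (e l • x) = ψ x) (x : X) (b : A) : (toCostandard hX ψ hψ x).1 b = ψ (b • x) := rfl

instance [Module.Finite k A] : Module.Finite k (costandardSpace k e l) :=
  Module.Finite.of_injective (costandardSpace k e l).subtype Subtype.val_injective

theorem smul_costandardSpace_eq_zero {m : Λ} (hm : ¬ m ≤ l) (f : costandardSpace k e l) :
    e m • f = 0 := costandardSpace_ext fun x => by
  have := f.2.2 m hm x 1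
  rwa [mul_one] at this

/-- The functional is a matrix coefficient `b ↦ φ (e l • b • v)` of the simple module `L l`, with
`v` on the line cut out by `e l`. -/
theorem IsIdempotentSystem.exists_functional {L : Λ → FDMod k A} (h : IsIdempotentSystem L e)
    (l : Λ) : ∃ f : costandardSpace k e l, f.1 1 ≠ 0 := by
  obtain ⟨v, hv, hv0, -⟩ := h.line l
  obtain ⟨φ, hφ⟩ : ∃ φ : Module.Dual k (L l), φ v ≠ 0 := by
    by_contra! hφ
    exact hv0 ((Module.forall_dual_apply_eq_zero_iff k v).1 hφ)
  let ψ : L l →ₗ[k] k := φ ∘ₗ (LinearMap.lsmul k (L l) 1 ∘ₗ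
    { toFun := fun x => e l • x
      map_add' := smul_add _
      map_smul' := fun c x => smul_comm _ _ _ })
  have hψ : ∀ x, ψ x = φ (e l • x) := fun x => by
    change φ ((1 : k) • e l • x) = _
    rw [one_smul]
  refine ⟨toCostandard (fun m hm x => h.off m l (fun e => hm e.le) x) ψ (fun x => ?_) v, ?_⟩
  · rw [hψ, hψ, ← mul_smul, h.idem]
  · rw [toCostandard_apply, one_smul, hψ, hv]
    exact hφ

end Costandard

/-! ### Graded costandard modules and degree 0 parts -/

section GradedCostandardModules

variable {k B : Type u} [Field k] [Ring B] [Algebra k B] {𝒜 : ℕ → Submodule k B}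
  [GradedAlgebra 𝒜] {Λ : Type v} {L : Λ → FDMod k (𝒜 0)} [PartialOrder Λ]

open FDMod

theorem FDMod.inflate_smul_eq_zero {X : FDMod k (𝒜 0)} [Module.Finite k B] {i : ℤ} (hi : i ≠ 0)
    {b : B} (hb : b ∈ (GrMod.regular 𝒜).deg i) (x : X.inflate) : b • x = 0 := by
  have h0 : GradedRing.projZeroRingHom' 𝒜 b = 0 := by
    by_cases hi' : 0 ≤ i
    · obtain ⟨n, rfl⟩ := Int.eq_ofNat_of_zero_le hi'
      ext
      simp [DirectSum.decompose_of_mem_ne 𝒜 (GrMod.mem_regular_deg_natCast.1 hb)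
        (show n ≠ 0 by omega)]
    · rw [GrMod.eq_zero_of_mem_regular_deg (by omega) hb, map_zero]
  refine (inflate_smul_def b x).trans ?_
  rw [h0]
  exact zero_smul (𝒜 0) (show X from x)

namespace GrMod

variable [Module.Finite k B] (e : Λ → 𝒜 0)

variable (𝒜) in
/-- The projection of the regular module to a homogeneous component. -/
def regularProj (i : ℤ) : B →ₗ[k] B where
  toFun := (regular 𝒜).comp i
  map_add' := ((regular 𝒜).comp i).map_add
  map_smul' c x := (regular 𝒜).comp_smul_base i c x

theorem regularProj_mem (i : ℤ) (b : B) : regularProj 𝒜 i b ∈ (regular 𝒜).deg i :=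
  (regular 𝒜).comp_mem i b

theorem regularProj_of_mem_ne {i j : ℤ} {b : B} (hb : b ∈ (regular 𝒜).deg i) (hij : i ≠ j) :
    regularProj 𝒜 j b = 0 :=
  (regular 𝒜).comp_of_mem_ne hb hij

theorem regularProj_mul {n : ℕ} {a : B} (ha : a ∈ 𝒜 n) (i : ℤ) (b : B) :
    regularProj 𝒜 i (a * b) = a * regularProj 𝒜 (i - n) b :=
  (regular 𝒜).comp_comp_smul ha i b

theorem comp_regularProj_mem (l : Λ) {f : Module.Dual k B}
    (hf : f ∈ costandardSpace k (fun l => (e l : B)) l) (i : ℤ) :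
    f ∘ₗ regularProj 𝒜 i ∈ costandardSpace k (fun l => (e l : B)) l := by
  classical
  refine ⟨fun b => ?_, fun m hm b c => ?_⟩
  · change f (regularProj 𝒜 i (e l * b)) = f (regularProj 𝒜 i b)
    rw [regularProj_mul (e l).2, hf.1, Nat.cast_zero, sub_zero]
  · change f (regularProj 𝒜 i (b * (e m * c))) = 0
    rw [← DirectSum.sum_support_decompose 𝒜 b, Finset.sum_mul, map_sum, map_sum]
    refine Finset.sum_eq_zero fun n _ => ?_
    rw [regularProj_mul (SetLike.coe_mem _), regularProj_mul (e m).2]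
    exact hf.2 m hm _ _

/-- The graded costandard module with socle in degree `0`. -/
abbrev costandard (l : Λ) : GrMod 𝒜 where
  carrier := costandardSpace k (fun l => (e l : B)) l
  addCommGroup := inferInstance
  moduleBase := inferInstance
  module := inferInstance
  isScalarTower := inferInstance
  finite := inferInstance
  -- A functional has degree `i` when it is supported on the component of `B` of degree `-i`. Hence
  -- the module lives in degrees at most 0, and evaluation at `1` only sees degree 0.
  deg i :=
    { carrier := {f | ∀ j, j ≠ -i → ∀ b ∈ (regular 𝒜).deg j, f.1 b = 0}
      add_mem' := fun {f g} hf hg j hj b hb => by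
        change f.1 b + g.1 b = 0
        rw [hf j hj b hb, hg j hj b hb, add_zero]
      zero_mem' := fun _ _ _ _ => rfl
      smul_mem' := fun c f hf j hj b hb => by
        change c • f.1 b = 0
        rw [hf j hj b hb, smul_zero] }
  isInternal := by
    refine isInternal_of_components _ (fun i => AddMonoidHom.mk'
      (fun f => ⟨f.1 ∘ₗ regularProj 𝒜 (-i), comp_regularProj_mem e l f.2 _⟩)
      (fun f g => Subtype.ext (LinearMap.add_comp _ _ _))) ?_ ?_ ?_ ?_
    · intro i f j hj b hb
      change f.1 (regularProj 𝒜 (-i) b) = 0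
      rw [regularProj_of_mem_ne hb hj, map_zero]
    · intro i f hf
      refine costandardSpace_ext fun b => ?_
      change f.1 (regularProj 𝒜 (-i) b) = f.1 b
      obtain ⟨s, hs⟩ := (regular 𝒜).exists_sum_comp_eq
      have hb := hs b
      nth_rw 2 [← hb]
      rw [map_sum]
      by_cases hi : -i ∈ s
      · rw [Finset.sum_eq_single_of_mem _ hi]
        · rfl
        · exact fun j _ hj => hf j hj _ ((regular 𝒜).comp_mem j b)
      · rw [Finset.sum_eq_zero fun j hj => hf j (fun e => hi (e ▸ hj)) _
          ((regular 𝒜).comp_mem j b)]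
        have : regularProj 𝒜 (-i) b = 0 := by
          change (regular 𝒜).comp (-i) b = 0
          rw [← hb, map_sum]
          exact Finset.sum_eq_zero fun j hj => (regular 𝒜).comp_of_mem_ne
            ((regular 𝒜).comp_mem j b) (fun e => hi (e ▸ hj))
        rw [this, map_zero]
    · intro i j f hf hij
      refine costandardSpace_ext fun b => ?_
      exact hf (-j) (fun e => hij (by omega)) _ (regularProj_mem (-j) b)
    · intro f
      obtain ⟨s, hs⟩ := (regular 𝒜).exists_sum_comp_eq
      refine ⟨s.map (Equiv.neg ℤ).toEmbedding, costandardSpace_ext fun b => ?_⟩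
      have h1 : ∀ j, f.1 (regularProj 𝒜 (- -j) b) = f.1 ((regular 𝒜).comp j b) := by
        intro j
        rw [neg_neg]
        rfl
      rw [Finset.sum_map, AddSubmonoidClass.coe_finsetSum, LinearMap.sum_apply]
      refine (Finset.sum_congr rfl fun j _ => h1 j).trans ?_
      rw [← map_sum]
      exact congrArg f.1 (hs b)
  smul_mem := by
    intro n i a f ha hf j hj b hb
    refine hf (j + n) (by omega) _ ?_
    exact smul_mem_of_mem_regular (M := regular 𝒜) hb (mem_regular_deg_natCast.2 ha)

/-- The evaluation of a functional at `1`. -/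
def costandardEval (l : Λ) : costandard e l →ₗ[k] k where
  toFun f := f.1 1
  map_add' _ _ := rfl
  map_smul' _ _ := rfl

variable {e}

theorem costandardEval_smul (l : Λ) (a : B) (f : costandard e l) :
    costandardEval e l (a • f) = f.1 a :=
  congrArg f.1 (one_mul a)

theorem costandardEval_idem (l : Λ) (f : costandard e l) :
    costandardEval e l ((e l : B) • f) = costandardEval e l f := by
  rw [costandardEval_smul]
  have := f.2.1 1
  rwa [mul_one] at this

theorem costandard_apply_one {l : Λ} {i : ℤ} (hi : i ≠ 0) {f : costandard e l}
    (hf : f ∈ (costandard e l).deg i) : costandardEval e l f = 0 :=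
  hf 0 (fun e => hi (by omega)) 1 (mem_regular_deg_zero.2 SetLike.GradedOne.one_mem)

theorem isGradedCostandard_costandard
    (h : IsIdempotentSystem (fun l => ((L l).inflate : FDMod k B)) (fun l => (e l : B))) (l : Λ) :
    IsGradedCostandard L l (costandard e l) where
  costandard := by
    refine h.isCostandard_of (N := (costandard e l).ungraded) (costandardEval e l)
      (costandardEval_idem l) (fun f hf => ?_) (h.factorsLE_iff.2 fun m hm x => ?_) ?_
    · refine costandardSpace_ext fun b => ?_
      exact (costandardEval_smul l b f).symm.trans (hf b)
    · exact smul_costandardSpace_eq_zero hm x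
    · intro X hX ψ hψ
      refine ⟨toCostandard (h.factorsLE_iff.1 hX) ψ hψ, fun x => ?_⟩
      exact (toCostandard_apply (h.factorsLE_iff.1 hX) ψ hψ x 1).trans (by rw [one_smul])
  deg_pos i hi := by
    rw [eq_bot_iff]
    intro f hf
    refine costandardSpace_ext fun b => ?_
    obtain ⟨s, hs⟩ := (regular 𝒜).exists_sum_comp b
    change f.1 b = 0
    rw [← hs, map_sum]
    refine Finset.sum_eq_zero fun j _ => ?_
    have hb := (regular 𝒜).comp_mem j b
    by_cases hj : j = -i
    · have h0 : (regular 𝒜).comp j b = (0 : B) := eq_zero_of_mem_regular_deg (by omega) hb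
      exact (congrArg f.1 h0).trans (map_zero _)
    · exact hf j hj _ hb
  deg_zero h0 := by
    obtain ⟨f, hf⟩ := h.exists_functional l
    obtain ⟨s, hs⟩ := (costandard e l).exists_sum_comp f
    apply hf
    change costandardEval e l f = 0
    rw [← hs, map_sum]
    refine Finset.sum_eq_zero fun i _ => ?_
    have hi := (costandard e l).comp_mem i f
    by_cases hi0 : i = 0
    · subst hi0
      rw [h0, Submodule.mem_bot] at hi
      rw [hi, map_zero]
    · exact costandard_apply_one hi0 hi

/-- A functional of degree 0 is determined by its restriction to `𝒜 0`. For the universal property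
an `𝒜 0`-module is inflated; elements of nonzero degree act on it by zero, so the resulting
functionals have degree 0. -/
theorem isCostandard_zeroPart (h : IsIdempotentSystem L e) (l : Λ) :
    IsCostandard L l (costandard e l).zeroPart := by
  refine h.isCostandard_of (N := (costandard e l).zeroPart)
    (costandardEval e l ∘ₗ ((costandard e l).deg 0).subtype)
    (fun f => costandardEval_idem l f.1) (fun f hf => ?_) (h.factorsLE_iff.2 fun m hm x => ?_) ?_
  · refine Subtype.ext (costandardSpace_ext fun b => ?_)
    obtain ⟨s, hs⟩ := (regular 𝒜).exists_sum_comp b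
    change f.1.1 b = 0
    rw [← hs, map_sum]
    refine Finset.sum_eq_zero fun j _ => ?_
    have hb := (regular 𝒜).comp_mem j b
    by_cases hj : j = 0
    · subst hj
      have := hf ⟨_, mem_regular_deg_zero.1 hb⟩
      exact (costandardEval_smul l _ f.1).symm.trans this
    · exact f.2 j (by omega) _ hb
  · exact Subtype.ext (smul_costandardSpace_eq_zero hm x.1)
  · intro X hX ψ hψ
    have hX' : ∀ m, ¬ m ≤ l → ∀ x : X.inflate, (e m : B) • x = 0 := fun m hm x =>
      (inflate_coe_smul (e m) x).trans (h.factorsLE_iff.1 hX m hm x)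
    let ψ' : X.inflate →ₗ[k] k := ψ
    have hψ' : ∀ x : X.inflate, ψ' ((e l : B) • x) = ψ' x := fun x =>
      (congrArg ψ (inflate_coe_smul (e l) x)).trans (hψ x)
    let F : X.inflate →ₗ[B] costandardSpace k (fun l => (e l : B)) l := toCostandard hX' ψ' hψ'
    refine ⟨{ toFun := fun x => ⟨F x, fun j hj b hb => ?_⟩
              map_add' := fun x y => Subtype.ext (map_add F x y)
              map_smul' := fun a x => Subtype.ext ?_ }, fun x => ?_⟩
    · exact (congrArg ψ' (inflate_smul_eq_zero (by omega) hb (show X.inflate from x))).trans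
        (map_zero ψ')
    · exact (congrArg (fun z : X.inflate => F z) (inflate_coe_smul a x).symm).trans
        (map_smul F (a : B) (show X.inflate from x))
    · change ψ ((1 : B) • (show X.inflate from x)) = ψ x
      rw [one_smul]

/-- Maps from the degree 0 part to an `𝒜 0`-module are obtained by restricting maps from the whole
standard module to the inflation. -/
theorem isStandard_zeroPart (h : IsIdempotentSystem L e) (l : Λ) :
    IsStandard L l (standard e l).zeroPart := by
  have hidem : (e l : B) * e l = e l := congrArg Subtype.val (h.idem l)
  refine h.isStandard_of (D := (standard e l).zeroPart) (x := ⟨standardGen e l, standardGen_mem l⟩)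
    (Subtype.ext ?_) (fun y => ?_) (h.factorsLE_iff.2 fun m hm x => Subtype.ext ?_) ?_
  · change (e l : B) • standardGen e l = standardGen e l
    rw [smul_standardGen]
    rfl
  · obtain ⟨b, hb, hby⟩ := exists_mem_deg_smul_standardGen l y.2
    exact ⟨⟨b, mem_regular_deg_zero.1 hb⟩, Subtype.ext hby⟩
  · obtain ⟨b, hb⟩ := exists_smul_standardGen l x.1
    change (e m : B) • x.1 = 0
    rw [← hb, ← mul_smul, smul_standardGen_eq_zero]
    exact mul_mem_standardIdeal (fun l => (e l : B)) hm b
  · intro X hX y hy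
    let F : standard e l →ₗ[B] X.inflate := (standardIdeal (fun l => (e l : B)) l).liftQ
      (LinearMap.toSpanSingleton B X.inflate (show X.inflate from y)) (fun a ha => by
        refine smul_eq_zero_of_mem_standardIdeal (e := fun l => (e l : B)) (l := l)
          (x := (show X.inflate from y)) ((inflate_coe_smul (e l) y).trans hy) (fun m hm x => ?_) ha
        exact (inflate_coe_smul (e m) x).trans (h.factorsLE_iff.1 hX m hm x))
    refine ⟨{ toFun := fun x => F x.1
              map_add' := fun x y => map_add F x.1 y.1
              map_smul' := fun a x => (map_smul F (a : B) x.1).trans (inflate_coe_smul a _) }, ?_⟩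
    change (e l : B) • (show X.inflate from y) = y
    exact (inflate_coe_smul (e l) y).trans hy

end GrMod

end GradedCostandardModules

/-! ### Grading shifts and graded projective modules -/

section GradedProjectives

variable {k B : Type u} [Field k] [Ring B] [Algebra k B] {𝒜 : ℕ → Submodule k B}

namespace GrMod

variable (𝒜) in
/-- The grading shift as a functor. -/
def shiftBy (r : ℤ) : GrMod 𝒜 ⥤ GrMod 𝒜 where
  obj M := M.shift r
  map f := ⟨f.lin, fun h => f.map_mem h⟩

instance (r : ℤ) : (shiftBy 𝒜 r).Faithful where
  map_injective {M N f g} h := by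
    ext x
    exact congrArg (fun q : M.shift r ⟶ N.shift r => q.lin x) h

instance (r : ℤ) : (shiftBy 𝒜 r).Full where
  map_surjective {M N} f := by
    refine ⟨⟨f.lin, fun {i x} hx => ?_⟩, rfl⟩
    have h1 : x ∈ (M.shift r).deg (i + r) := by
      change x ∈ M.deg (i + r - r)
      rwa [add_sub_cancel_right]
    have h2 : f.lin x ∈ N.deg (i + r - r) := f.map_mem h1
    rwa [add_sub_cancel_right] at h2

theorem shift_shift_iso (M : GrMod 𝒜) {r s t : ℤ} (h : r + s = t) :
    Nonempty ((M.shift r).shift s ≅ M.shift t) := by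
  refine nonempty_iso_of_bijective ⟨(LinearMap.id : M →ₗ[B] M), fun {i x} hx => ?_⟩
    Function.bijective_id
  have h1 : x ∈ M.deg (i - s - r) := hx
  change x ∈ M.deg (i - t)
  rwa [← h, add_comm, ← sub_sub]

theorem shift_zero_iso (M : GrMod 𝒜) : Nonempty (M.shift 0 ≅ M) := by
  refine nonempty_iso_of_bijective ⟨(LinearMap.id : M →ₗ[B] M), fun {i x} hx => ?_⟩
    Function.bijective_id
  have h1 : x ∈ M.deg (i - 0) := hx
  change x ∈ M.deg i
  rwa [sub_zero] at h1

instance (r : ℤ) : (shiftBy 𝒜 r).EssSurj where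
  mem_essImage M := by
    obtain ⟨φ⟩ := M.shift_shift_iso (neg_add_cancel r)
    obtain ⟨ψ⟩ := M.shift_zero_iso
    exact ⟨M.shift (-r), ⟨φ.trans ψ⟩⟩

instance (r : ℤ) : (shiftBy 𝒜 r).IsEquivalence where

instance (r : ℤ) : (shiftBy 𝒜 r).Additive where

variable [GradedAlgebra 𝒜] [Module.Finite k B]

/-- The graded left ideal generated by an element of degree `0`. -/
abbrev principal (a : 𝒜 0) : GrMod 𝒜 :=
  (regular 𝒜).sub (Submodule.span B {(a : B)})
    (isHomogeneous_span_singleton _ (mem_regular_deg_zero.2 a.2))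

/-- The generator of a graded principal left ideal. -/
def principalGen (a : 𝒜 0) : principal a := ⟨(a : B), Submodule.mem_span_singleton_self _⟩

theorem principalGen_mem (a : 𝒜 0) : principalGen a ∈ (principal a).deg 0 :=
  mem_regular_deg_zero.2 a.2

theorem smul_principalGen {a : 𝒜 0} (ha : a * a = a) (x : principal a) :
    x.1 • principalGen a = x := by
  obtain ⟨b, hb⟩ := Submodule.mem_span_singleton.1 x.2
  refine Subtype.ext ?_
  change x.1 * (a : B) = x.1
  have haa : (a : B) * a = a := congrArg Subtype.val ha
  rw [← hb, smul_eq_mul, mul_assoc, haa]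

/-- The morphism from a graded principal left ideal given by a homogeneous element. -/
def principalHom (a : 𝒜 0) {M : GrMod 𝒜} {s : ℤ} {x : M} (hx : x ∈ M.deg s) :
    (principal a).shift s ⟶ M where
  lin := (LinearMap.toSpanSingleton B M x) ∘ₗ (Submodule.span B {(a : B)}).subtype
  map_mem {i y} hy := by
    have hy' : (show principal a from y).1 ∈ (regular 𝒜).deg (i - s) := hy
    have := smul_mem_of_mem_regular hy' hx
    rwa [sub_add_cancel] at this

theorem principal_hom_ext {a : 𝒜 0} (ha : a * a = a) {M : GrMod 𝒜} {s : ℤ}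
    {f g : (principal a).shift s ⟶ M} (h : f.lin (principalGen a) = g.lin (principalGen a)) :
    f = g := by
  have key : ∀ (f : (principal a).shift s ⟶ M) (x : principal a),
      f.lin x = x.1 • f.lin (principalGen a) := fun f x =>
    (congrArg f.lin (smul_principalGen ha x).symm).trans (map_smul f.lin x.1 (principalGen a))
  ext x
  exact (key f x).trans ((congrArg (fun z => (show principal a from x).1 • z) h).trans
    (key g x).symm)

theorem principal_lin_mem {a : 𝒜 0} {M : GrMod 𝒜} {s : ℤ}
    (f : (principal a).shift s ⟶ M) : f.lin (principalGen a) ∈ M.deg s := by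
  refine f.map_mem (i := s) ?_
  change principalGen a ∈ (principal a).deg (s - s)
  rw [sub_self]
  exact principalGen_mem a

theorem smul_principal_lin {a : 𝒜 0} (ha : a * a = a) {M : GrMod 𝒜} {s : ℤ}
    (f : (principal a).shift s ⟶ M) :
    (a : B) • f.lin (principalGen a) = f.lin (principalGen a) :=
  (map_smul f.lin (a : B) (principalGen a)).symm.trans
    (congrArg f.lin (smul_principalGen ha (principalGen a)))

/-- The shifted ideal `B a` represents `M ↦ a • M_s`. To lift along a surjection, take any preimage,
its component of degree `s`, and multiply by `a`. -/
theorem projective_principal {a : 𝒜 0} (ha : a * a = a) (s : ℤ) :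
    Projective ((principal a).shift s) where
  factors {X N} f g _ := by
    have hf := principal_lin_mem f
    obtain ⟨x, hx⟩ := surjective_of_epi g (f.lin (principalGen a))
    refine ⟨principalHom a (X.comp_mem s x), principal_hom_ext ha ?_⟩
    have h1 : g.lin ((a : B) • X.comp s x) = (a : B) • N.comp s (g.lin x) := by
      rw [map_smul, comp_lin_comm]
    rw [hx, comp_of_mem _ hf] at h1
    exact h1.trans (smul_principal_lin ha f)

/-- Finitely many shifted copies of `B`, one for each homogeneous component of each vector of a
basis, cover `M`. Enough projectives are needed to compare Ext groups along the shift. -/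
instance : EnoughProjectives (GrMod 𝒜) where
  presentation M := by
    classical
    have key : ∀ S : Finset M, ∃ (P : GrMod 𝒜) (_ : Projective P) (f : P ⟶ M),
        ∀ x ∈ S, x ∈ LinearMap.range f.lin := by
      have step : ∀ (P : GrMod 𝒜) (_ : Projective P) (f : P ⟶ M) (s : ℤ) (x : M), x ∈ M.deg s →
          ∃ (P' : GrMod 𝒜) (_ : Projective P') (f' : P' ⟶ M),
            LinearMap.range f.lin ≤ LinearMap.range f'.lin ∧ x ∈ LinearMap.range f'.lin := by
        intro P hP f s x hx
        have h1 : (1 : 𝒜 0) * 1 = 1 := mul_one 1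
        have := projective_principal h1 s
        refine ⟨P ⊞ (principal 1).shift s, inferInstance,
          biprod.desc f (principalHom 1 hx), ?_, ?_⟩
        · rintro _ ⟨y, rfl⟩
          exact ⟨(biprod.inl : P ⟶ P ⊞ (principal 1).shift s).lin y,
            congrArg (fun q => Hom.lin q y) (biprod.inl_desc f (principalHom 1 hx))⟩
        · refine ⟨(biprod.inr : _ ⟶ P ⊞ (principal 1).shift s).lin (principalGen 1), ?_⟩
          refine (congrArg (fun q : (principal 1).shift s ⟶ M => q.lin (principalGen 1))
            (biprod.inr_desc f (principalHom 1 hx))).trans ?_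
          exact one_smul B x
      intro S
      induction S using Finset.induction_on with
      | empty => exact ⟨zeroObj, (isZero_of_forall fun _ => rfl).projective, 0, by simp⟩
      | insert x S _ ih =>
        obtain ⟨P, hP, f, hf⟩ := ih
        obtain ⟨t, ht⟩ := M.exists_sum_comp x
        have : ∃ (P' : GrMod 𝒜) (_ : Projective P') (f' : P' ⟶ M),
            LinearMap.range f.lin ≤ LinearMap.range f'.lin ∧
              ∀ i ∈ t, M.comp i x ∈ LinearMap.range f'.lin := by
          clear ht
          induction t using Finset.induction_on with
          | empty => exact ⟨P, hP, f, le_rfl, by simp⟩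
          | insert i t _ ih =>
            obtain ⟨P', hP', f', h1, h2⟩ := ih
            obtain ⟨P'', hP'', f'', h3, h4⟩ := step P' hP' f' i _ (M.comp_mem i x)
            refine ⟨P'', hP'', f'', h1.trans h3, fun j hj => ?_⟩
            obtain rfl | hj := Finset.mem_insert.1 hj
            · exact h4
            · exact h3 (h2 j hj)
        obtain ⟨P', hP', f', h1, h2⟩ := this
        refine ⟨P', hP', f', fun y hy => ?_⟩
        obtain rfl | hy := Finset.mem_insert.1 hy
        · rw [← ht]
          exact Submodule.sum_mem _ h2
        · exact h1 (hf y hy)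
    let b := Module.finBasis k M
    obtain ⟨P, hP, f, hf⟩ := key (Finset.univ.image b)
    have hs : Function.Surjective f.lin := by
      intro x
      change x ∈ LinearMap.range f.lin
      rw [← b.sum_repr x]
      refine Submodule.sum_mem _ fun i _ => ?_
      rw [← algebraMap_smul B]
      exact Submodule.smul_mem _ _ (hf _ (Finset.mem_image_of_mem _ (Finset.mem_univ i)))
    exact ⟨{ p := P, f := f, projective := hP, epi := epi_of_surjective f hs }⟩

end GrMod

end GradedProjectives

/-! ### Invariance of Ext under isomorphisms and grading shifts -/

section ExtShift

open Abelian

theorem CategoryTheory.Abelian.Ext.subsingleton_of_iso {C : Type*} [Category* C] [Abelian C] [HasExt C]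
    {X X' Y Y' : C} (e : X ≅ X') (e' : Y ≅ Y') {n : ℕ} (h : Subsingleton (Ext X' Y' n)) :
    Subsingleton (Ext X Y n) := by
  refine subsingleton_of_forall_eq 0 fun x => ?_
  have h1 : x = (Ext.mk₀ e.hom).comp (((Ext.mk₀ e.inv).comp x (zero_add n)).comp
      (Ext.mk₀ e'.hom) (add_zero n) |>.comp (Ext.mk₀ e'.inv) (add_zero n)) (zero_add n) := by
    simp
  rw [h1, Subsingleton.elim (((Ext.mk₀ e.inv).comp x (zero_add n)).comp
      (Ext.mk₀ e'.hom) (add_zero n)) 0]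
  simp

variable {k B : Type u} [Field k] [Ring B] [Algebra k B] [Module.Finite k B]
  {𝒜 : ℕ → Submodule k B} [GradedAlgebra 𝒜]

theorem GrMod.subsingleton_ext_shift {M N : GrMod 𝒜} {n : ℕ} (r : ℤ)
    (h : Subsingleton (Ext M N n)) : Subsingleton (Ext (M.shift r) (N.shift r) n) :=
  ((shiftBy 𝒜 r).mapExt_bijective_of_preservesProjectiveObjects M N n).2.subsingleton

end ExtShift

/-! ### Graded standard filtrations by counting dimensions -/

section GradedFiltrations

/-- This is `(N + A x) / N ≅ A / (N : x)`, counted in dimensions. -/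
theorem finrank_sup_span_singleton {k A M : Type u} [Field k] [Ring A] [Algebra k A]
    [Module.Finite k A] [AddCommGroup M] [Module k M] [Module A M] [IsScalarTower k A M]
    [Module.Finite k M] (N : Submodule A M) (x : M) :
    Module.finrank k ↥(N ⊔ Submodule.span A {x}) +
      Module.finrank k (N.comap (LinearMap.toSpanSingleton A M x)) =
    Module.finrank k N + Module.finrank k A := by
  let S := N ⊔ Submodule.span A {x}
  have hfin : Module.Finite k S :=
    Module.Finite.of_injective (S.subtype.restrictScalars k) Subtype.val_injective
  have : Module.Finite k (M ⧸ N) :=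
    Module.Finite.of_surjective (N.mkQ.restrictScalars k) (Submodule.mkQ_surjective N)
  let θ : A →ₗ[k] M ⧸ N := (N.mkQ ∘ₗ LinearMap.toSpanSingleton A M x).restrictScalars k
  let ρ : S →ₗ[k] M ⧸ N := (N.mkQ ∘ₗ S.subtype).restrictScalars k
  have h1 := θ.finrank_range_add_finrank_ker
  have h2 := ρ.finrank_range_add_finrank_ker
  have h3 : LinearMap.range θ = LinearMap.range ρ := by
    apply le_antisymm
    · rintro _ ⟨a, rfl⟩
      exact ⟨⟨a • x, Submodule.mem_sup_right
        (Submodule.smul_mem _ _ (Submodule.mem_span_singleton_self x))⟩, rfl⟩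
    · rintro _ ⟨⟨y, hy⟩, rfl⟩
      obtain ⟨n, hn, z, hz, rfl⟩ := Submodule.mem_sup.1 hy
      obtain ⟨a, rfl⟩ := Submodule.mem_span_singleton.1 hz
      refine ⟨a, ?_⟩
      change N.mkQ (a • x) = N.mkQ (n + a • x)
      have h0 : N.mkQ n = 0 := (Submodule.Quotient.mk_eq_zero N).2 hn
      rw [map_add, h0, zero_add]
  have h4 : Module.finrank k (LinearMap.ker ρ) = Module.finrank k N := by
    have e : LinearMap.ker ρ ≃ₗ[k] N :=
      { toFun := fun y => ⟨y.1.1, (Submodule.Quotient.mk_eq_zero N).1 y.2⟩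
        invFun := fun y => ⟨⟨y.1, Submodule.mem_sup_left y.2⟩,
          (Submodule.Quotient.mk_eq_zero N).2 y.2⟩
        left_inv := fun _ => rfl
        right_inv := fun _ => rfl
        map_add' := fun _ _ => rfl
        map_smul' := fun _ _ => rfl }
    exact e.finrank_eq
  have h5 : Module.finrank k (LinearMap.ker θ) =
      Module.finrank k (N.comap (LinearMap.toSpanSingleton A M x)) := by
    have e : LinearMap.ker θ ≃ₗ[k] N.comap (LinearMap.toSpanSingleton A M x) :=
      { toFun := fun y => ⟨y.1, (Submodule.Quotient.mk_eq_zero N).1 y.2⟩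
        invFun := fun y => ⟨y.1, (Submodule.Quotient.mk_eq_zero N).2 y.2⟩
        left_inv := fun _ => rfl
        right_inv := fun _ => rfl
        map_add' := fun _ _ => rfl
        map_smul' := fun _ _ => rfl }
    exact e.finrank_eq
  rw [h3] at h1
  change Module.finrank k S + _ = _
  omega

theorem finrank_add_finrank_quotient {k A : Type u} [Field k] [Ring A] [Algebra k A]
    [Module.Finite k A] (I : Submodule A A) :
    Module.finrank k I + Module.finrank k (A ⧸ I) = Module.finrank k A := by
  have h := (I.mkQ.restrictScalars k).finrank_range_add_finrank_ker
  have h1 : LinearMap.range (I.mkQ.restrictScalars k) = ⊤ :=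
    LinearMap.range_eq_top.2 (Submodule.mkQ_surjective I)
  have h2 : Module.finrank k (LinearMap.ker (I.mkQ.restrictScalars k)) = Module.finrank k I := by
    have e : LinearMap.ker (I.mkQ.restrictScalars k) ≃ₗ[k] I :=
      { toFun := fun y => ⟨y.1, (Submodule.Quotient.mk_eq_zero I).1 y.2⟩
        invFun := fun y => ⟨y.1, (Submodule.Quotient.mk_eq_zero I).2 y.2⟩
        left_inv := fun _ => rfl
        right_inv := fun _ => rfl
        map_add' := fun _ _ => rfl
        map_smul' := fun _ _ => rfl }
    exact e.finrank_eq
  rw [h1, finrank_top, h2] at h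
  omega

variable {k B : Type u} [Field k] [Ring B] [Algebra k B] {𝒜 : ℕ → Submodule k B}
  {Λ : Type v} [PartialOrder Λ]

namespace GrMod

/-- A chain of homogeneous submodules ending in `N` with sections that are quotients of standard
modules with labels in `W`; the number is the sum of the dimensions of these standard modules. -/
inductive Chain (M : GrMod 𝒜) (e : Λ → B) (W : Set Λ) : Submodule B M → ℕ → Prop
  | bot : Chain M e W ⊥ 0
  | step {N : Submodule B M} {c : ℕ} {x : M} {s : ℤ} {m : Λ} : Chain M e W N c → x ∈ M.deg s →
      m ∈ W → e m • x = x → (∀ a ∈ standardIdeal e m, a • x ∈ N) →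
      Chain M e W (N ⊔ Submodule.span B {x}) (Module.finrank k (B ⧸ standardIdeal e m) + c)

/-- A chain of homogeneous submodules ending in `N` with sections standard modules with labels
in `W`. -/
inductive Filtered (M : GrMod 𝒜) (e : Λ → B) (W : Set Λ) : Submodule B M → Prop
  | bot : Filtered M e W ⊥
  | step {N : Submodule B M} {x : M} {s : ℤ} {m : Λ} : Filtered M e W N → x ∈ M.deg s →
      m ∈ W → e m • x = x → (∀ a, a • x ∈ N ↔ a ∈ standardIdeal e m) →
      Filtered M e W (N ⊔ Submodule.span B {x})

variable {M : GrMod 𝒜} {e : Λ → B} {W : Set Λ}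

theorem Filtered.isHomogeneous [GradedAlgebra 𝒜] {N : Submodule B M} (h : M.Filtered e W N) :
    M.IsHomogeneous N := by
  induction h with
  | bot => exact M.isHomogeneous_bot
  | step _ hx _ _ _ ih => exact ih.sup (M.isHomogeneous_span_singleton hx)

/-- Each section is a quotient of the standard module whose dimension is counted in `c`. If nothing
is lost in total, nothing is lost at any step, and every section is the full standard module. -/
theorem Chain.filtered [Module.Finite k B] {N : Submodule B M} {c : ℕ} (h : M.Chain e W N c) :
    Module.finrank k N ≤ c ∧ (c ≤ Module.finrank k N → M.Filtered e W N) := by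
  induction h with
  | bot => exact ⟨(finrank_bot k M).le, fun _ => .bot⟩
  | @step N c x s m _ hx hm hex hz ih =>
    have h1 := finrank_sup_span_singleton (k := k) N x
    have h2 := finrank_add_finrank_quotient (k := k) (standardIdeal e m)
    have hle : standardIdeal e m ≤ N.comap (LinearMap.toSpanSingleton B M x) := hz
    have hfin : Module.Finite k (N.comap (LinearMap.toSpanSingleton B M x)) :=
      Module.Finite.of_injective ((Submodule.subtype _).restrictScalars k) Subtype.val_injective
    have h3 := LinearMap.finrank_le_finrank_of_injective
      (f := (Submodule.inclusion hle).restrictScalars k) (Submodule.inclusion_injective hle)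
    refine ⟨by omega, fun hc => .step (ih.2 (by omega)) hx hm hex fun a => ⟨fun ha => ?_, hz a⟩⟩
    have h4 : Module.finrank k (standardIdeal e m) =
        Module.finrank k (N.comap (LinearMap.toSpanSingleton B M x)) := by omega
    have h5 := (LinearMap.injective_iff_surjective_of_finrank_eq_finrank
      (f := (Submodule.inclusion hle).restrictScalars k) h4).1 (Submodule.inclusion_injective hle)
    obtain ⟨y, hy⟩ := h5 ⟨a, ha⟩
    have : y.1 = a := congrArg Subtype.val hy
    exact this ▸ y.2

theorem Chain.sup_span {N : Submodule B M} {c : ℕ} (h : M.Chain e W N c) {m : Λ} (hm : m ∈ W)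
    (t : Finset M) (ht : ∀ y ∈ t, (∃ s, y ∈ M.deg s) ∧ e m • y = y ∧
      ∀ a ∈ standardIdeal e m, a • y ∈ N) :
    M.Chain e W (N ⊔ Submodule.span B t)
      (t.card * Module.finrank k (B ⧸ standardIdeal e m) + c) := by
  classical
  induction t using Finset.induction_on with
  | empty => simpa using h
  | insert y t hy ih =>
    have h1 := ih fun z hz => ht z (Finset.mem_insert_of_mem hz)
    obtain ⟨⟨s, hs⟩, hey, hz⟩ := ht y (Finset.mem_insert_self y t)
    have h2 := h1.step hs hm hey fun a ha => Submodule.mem_sup_left (hz a ha)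
    have h3 : N ⊔ Submodule.span B (insert y t : Finset M) =
        N ⊔ Submodule.span B t ⊔ Submodule.span B {y} := by
      rw [Finset.coe_insert, Submodule.span_insert, sup_assoc, sup_comm (Submodule.span B {y})]
    rw [h3, Finset.card_insert_of_notMem hy, add_mul, one_mul, add_comm (_ * _), add_assoc]
    exact h2

/-- Modulo `N`, the products of `a` with homogeneous vectors span `a • M`. A basis selected among
them is no larger than the spanning set provided by `s`. -/
theorem exists_homogeneous_finset [GradedAlgebra 𝒜] (N : Submodule B M) (a : B)
    (s : Finset M) (hs : ∀ x : M, a • x ∈ Submodule.span k (s : Set M) ⊔ N.restrictScalars k) :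
    ∃ t : Finset M, t.card ≤ s.card ∧ (∀ y ∈ t, ∃ x i, x ∈ M.deg i ∧ y = a • x) ∧
      ∀ x : M, a • x ∈ Submodule.span k (t : Set M) ⊔ N.restrictScalars k := by
  classical
  let N' := N.restrictScalars k
  let T : Set M := {y | ∃ x i, x ∈ M.deg i ∧ y = a • x}
  obtain ⟨b, hbT, hbs, hbi⟩ := exists_linearIndependent k (N'.mkQ '' T)
  have hbT' : ∀ z : M ⧸ N', ∃ y : M, z ∈ b → y ∈ T ∧ N'.mkQ y = z := fun z => by
    by_cases hz : z ∈ b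
    · obtain ⟨y, hy⟩ := hbT hz
      exact ⟨y, fun _ => hy⟩
    · exact ⟨0, fun h => absurd h hz⟩
  choose g hgT using hbT'
  have hbf : b.Finite := hbi.setFinite
  have hb' : ∀ y : M, y ∈ Submodule.span k (g '' b) ⊔ N' ↔ N'.mkQ y ∈ Submodule.span k b := by
    intro y
    have : Submodule.span k b = (Submodule.span k (g '' b)).map N'.mkQ := by
      rw [Submodule.map_span, Set.image_image]
      congr 1
      exact ((Set.image_congr fun z hz => (hgT z hz).2).trans (Set.image_id' b)).symm
    rw [this, ← Submodule.mem_comap, Submodule.comap_map_mkQ, sup_comm]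
  have hcard : hbf.toFinset.card ≤ s.card := by
    have h1 : b.ncard ≤ Module.finrank k (Submodule.span k (N'.mkQ '' (s : Set M))) := by
      have h2 : Submodule.span k b ≤ Submodule.span k (N'.mkQ '' (s : Set M)) := by
        rw [hbs]
        refine Submodule.span_le.2 ?_
        rintro _ ⟨_, ⟨x, i, -, rfl⟩, rfl⟩
        change _ ∈ Submodule.span k (N'.mkQ '' (s : Set M))
        rw [← Submodule.map_span, ← Submodule.mem_comap, Submodule.comap_map_mkQ, sup_comm]
        exact hs x
      have h3 := Submodule.finrank_mono h2
      have := hbf.fintype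
      rw [finrank_span_set_eq_card hbi] at h3
      rwa [Set.ncard_eq_toFinset_card']
    rw [← Set.ncard_eq_toFinset_card b hbf]
    refine h1.trans ?_
    rw [← Finset.coe_image]
    exact (finrank_span_finset_le_card _).trans Finset.card_image_le
  refine ⟨hbf.toFinset.image g, Finset.card_image_le.trans hcard, fun y hy => ?_, fun x => ?_⟩
  · obtain ⟨z, hz, rfl⟩ := Finset.mem_image.1 hy
    exact (hgT z (hbf.mem_toFinset.1 hz)).1
  · rw [Finset.coe_image, hbf.coe_toFinset, hb', hbs]
    obtain ⟨t, ht⟩ := M.exists_sum_comp x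
    rw [← ht, Finset.smul_sum, map_sum]
    exact Submodule.sum_mem _ fun i _ => Submodule.subset_span
      ⟨_, ⟨_, i, M.comp_mem i x, rfl⟩, rfl⟩

end GrMod

variable [GradedAlgebra 𝒜] [Module.Finite k B] [Fintype Λ] {L : Λ → FDMod k (𝒜 0)} {e : Λ → 𝒜 0}
  (h : IsIdempotentSystem (fun l => ((L l).inflate : FDMod k B)) (fun l => (e l : B)))
  (hq : IsQuasiHereditary (fun l => ((L l).inflate : FDMod k B)))
include h hq

/-- Removing a minimal `i` from the upper set `U` leaves an upper set containing all labels above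
`i`. The trace over `U` arises from the smaller trace by adjoining at most `n i` homogeneous vectors
fixed by `e i`. The ideal `standardIdeal` of `i` sends these into the trace over the labels above
`i`, so each generates a quotient of a shifted standard module modulo what is already there. -/
theorem GrMod.exists_chain (M : GrMod 𝒜) (μ : Λ) (n : Λ → ℕ)
    (hn : ∀ (i : Λ) (U : Set Λ), μ < i → Set.Ioi i ⊆ U → IsUpperSet U →
      ∃ s : Finset M, s.card ≤ n i ∧ ∀ x : M, (e i : B) • x ∈ Submodule.span k (s : Set M) ⊔
        (idempotentTrace (fun l => (e l : B)) U M).restrictScalars k)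
    (U : Finset Λ) (hU : IsUpperSet (U : Set Λ)) (hμ : ∀ i ∈ U, μ < i) :
    ∃ c ≤ ∑ m ∈ U, n m * Module.finrank k (B ⧸ standardIdeal (fun l => (e l : B)) m),
      M.Chain (fun l => (e l : B)) (Set.Ioi μ) (idempotentTrace (fun l => (e l : B)) U M) c := by
  classical
  induction hc : U.card generalizing U with
  | zero =>
    obtain rfl := Finset.card_eq_zero.1 hc
    refine ⟨0, by simp, ?_⟩
    have : idempotentTrace (fun l => (e l : B)) ((∅ : Finset Λ) : Set Λ) M = ⊥ := by
      rw [eq_bot_iff]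
      refine Submodule.span_le.2 ?_
      rintro _ ⟨m, hm, -⟩
      simp at hm
    rw [this]
    exact .bot
  | succ d ih =>
    obtain ⟨i, hi⟩ := U.exists_minimal (Finset.card_pos.1 (by omega))
    have hiU : i ∈ U := hi.1
    have hIoi : Set.Ioi i ⊆ ((U.erase i : Finset Λ) : Set Λ) := fun m hm =>
      Finset.mem_coe.2 (Finset.mem_erase.2 ⟨(ne_of_gt hm), hU (le_of_lt hm) hiU⟩)
    have hU' : IsUpperSet ((U.erase i : Finset Λ) : Set Λ) := by
      intro a b hab ha
      obtain ⟨ha1, ha2⟩ := Finset.mem_erase.1 (Finset.mem_coe.1 ha)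
      refine Finset.mem_coe.2 (Finset.mem_erase.2 ⟨?_, hU hab ha2⟩)
      rintro rfl
      exact ha1 (le_antisymm hab (hi.2 ha2 hab))
    obtain ⟨c, hc1, hc2⟩ := ih (U.erase i) hU' (fun j hj => hμ j (Finset.mem_of_mem_erase hj))
      (by rw [Finset.card_erase_of_mem hiU]; omega)
    obtain ⟨s, hs1, hs2⟩ := hn i _ (hμ i hiU) hIoi hU'
    obtain ⟨t, ht1, ht2, ht3⟩ := GrMod.exists_homogeneous_finset
      (idempotentTrace (fun l => (e l : B)) ((U.erase i : Finset Λ) : Set Λ) M) (e i : B) s hs2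
    have hei : ∀ y ∈ t, (e i : B) • y = y := by
      intro y hy
      obtain ⟨x, j, hx, rfl⟩ := ht2 y hy
      rw [← mul_smul, h.idem i]
    have hch := hc2.sup_span (m := i) (hμ i hiU) t fun y hy => by
      refine ⟨?_, hei y hy, fun a ha =>
        h.smul_mem_trace_of_mem_standardIdeal hq (hei y hy) hIoi ha⟩
      obtain ⟨x, j, hx, rfl⟩ := ht2 y hy
      exact ⟨_, M.smul_mem (e i).2 hx⟩
    have heq : idempotentTrace (fun l => (e l : B)) ((U.erase i : Finset Λ) : Set Λ) M ⊔
        Submodule.span B (t : Set M) = idempotentTrace (fun l => (e l : B)) (U : Set Λ) M := by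
      apply le_antisymm
      · refine sup_le (idempotentTrace_mono (Finset.coe_subset.2 (Finset.erase_subset i U)))
          (Submodule.span_le.2 fun y hy => ?_)
        rw [← hei y hy]
        exact smul_mem_idempotentTrace (e := fun l => (e l : B)) (Finset.mem_coe.2 hiU) y
      · refine Submodule.span_le.2 ?_
        rintro _ ⟨m, hm, x, rfl⟩
        by_cases hmi : m = i
        · subst hmi
          obtain ⟨y, hy, z, hz, hyz⟩ := Submodule.mem_sup.1 (ht3 x)
          change (e m : B) • x ∈ _
          rw [← hyz, sup_comm]
          exact Submodule.add_mem_sup (Submodule.span_le_restrictScalars k B _ hy) hz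
        · exact Submodule.mem_sup_left (smul_mem_idempotentTrace (e := fun l => (e l : B))
            (Finset.mem_coe.2 (Finset.mem_erase.2 ⟨hmi, hm⟩)) x)
    rw [heq] at hch
    refine ⟨_, ?_, hch⟩
    rw [← Finset.add_sum_erase U _ hiU]
    exact add_le_add (Nat.mul_le_mul_right _ (ht1.trans hs1)) hc1

/-- The ungraded multiplicities `n` bound the length of a homogeneous chain, while the dimensions
they predict do not exceed that of the trace. Hence the chain loses no dimension and its sections
are shifted standard modules. -/
theorem GrMod.filtered_trace (μ : Λ) :
    (principal (e μ)).Filtered (fun l => (e l : B)) (Set.Ioi μ)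
      (idempotentTrace (fun l => (e l : B)) (Set.Ioi μ) (principal (e μ))) := by
  classical
  obtain ⟨n, hn1, hn2, hn3⟩ := h.exists_multiplicities hq μ
  obtain ⟨c, hc1, hc2⟩ := GrMod.exists_chain h hq (principal (e μ)) μ n hn2
    (Finset.univ.filter (μ < ·)) (fun a b hab ha => by
      have : μ < a := by simpa using ha
      simpa using this.trans_le hab) (fun i hi => by simpa using hi)
  have hset : ((Finset.univ.filter (μ < ·) : Finset Λ) : Set Λ) = Set.Ioi μ := by
    ext
    simp
  rw [hset] at hc2
  refine hc2.filtered.2 (hc1.trans (le_trans ?_ hn3))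
  exact Finset.sum_le_sum_of_subset (Finset.filter_subset _ _)

end GradedFiltrations

/-! ### The graded sequence `0 → K(l) → B e_l → Δ(l) → 0` -/

section StandardSequences

variable {k B : Type u} [Field k] [Ring B] [Algebra k B] {𝒜 : ℕ → Submodule k B}
  [GradedAlgebra 𝒜] [Module.Finite k B] {Λ : Type v} [PartialOrder Λ] {e : Λ → 𝒜 0}

namespace GrMod

/-- The morphism from a graded standard module given by a homogeneous element. -/
def standardHom (l : Λ) {M : GrMod 𝒜} {s : ℤ} {x : M} (hx : x ∈ M.deg s)
    (hz : ∀ a ∈ standardIdeal (fun l => (e l : B)) l, a • x = 0) :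
    (standard e l).shift s ⟶ M where
  lin := (standardIdeal (fun l => (e l : B)) l).liftQ (LinearMap.toSpanSingleton B M x) hz
  map_mem {i y} hy := by
    obtain ⟨b, hb, rfl⟩ := hy
    have := smul_mem_of_mem_regular hb hx
    rw [sub_add_cancel] at this
    exact this

theorem standardHom_smul_gen {l : Λ} {M : GrMod 𝒜} {s : ℤ} {x : M} (hx : x ∈ M.deg s)
    (hz : ∀ a ∈ standardIdeal (fun l => (e l : B)) l, a • x = 0) (b : B) :
    (standardHom l hx hz).lin (b • standardGen e l) = b • x := by
  have h1 : (e l : B) • x = x := by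
    have := hz _ (one_sub_mem_standardIdeal (fun l => (e l : B)) l)
    rw [sub_smul, one_smul, sub_eq_zero] at this
    exact this.symm
  refine (map_smul (standardHom l hx hz).lin b (standardGen e l)).trans ?_
  change b • (e l : B) • x = b • x
  rw [h1]

theorem standard_hom_eq_zero {l : Λ} {M : GrMod 𝒜} {s : ℤ} {f : (standard e l).shift s ⟶ M}
    (h : f.lin (standardGen e l) = 0) : f = 0 := by
  ext x
  obtain ⟨b, rfl⟩ := exists_smul_standardGen l x
  exact (map_smul f.lin b (standardGen e l)).trans
    ((congrArg (b • ·) h).trans (smul_zero b))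

theorem idem_smul_standardGen (l : Λ) : (e l : B) • standardGen e l = standardGen e l :=
  smul_standardGen l (e l : B)

theorem standard_lin_mem {l : Λ} {M : GrMod 𝒜} {s : ℤ} (f : (standard e l).shift s ⟶ M) :
    f.lin (standardGen e l) ∈ M.deg s := by
  refine f.map_mem (i := s) ?_
  change standardGen e l ∈ (standard e l).deg (s - s)
  rw [sub_self]
  exact standardGen_mem l

theorem smul_standard_lin {l : Λ} {M : GrMod 𝒜} {s : ℤ} (f : (standard e l).shift s ⟶ M) (b : B) :
    b • f.lin (standardGen e l) = f.lin (b • standardGen e l) :=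
  (map_smul f.lin b (standardGen e l)).symm

theorem idem_smul_standard_lin {l : Λ} {M : GrMod 𝒜} {s : ℤ}
    (f : (standard e l).shift s ⟶ M) :
    (e l : B) • f.lin (standardGen e l) = f.lin (standardGen e l) :=
  (smul_standard_lin f _).trans (congrArg f.lin (idem_smul_standardGen l))

theorem ideal_smul_standard_lin {l : Λ} {M : GrMod 𝒜} {s : ℤ}
    (f : (standard e l).shift s ⟶ M) {a : B}
    (ha : a ∈ standardIdeal (fun l => (e l : B)) l) : a • f.lin (standardGen e l) = 0 :=
  (smul_standard_lin f _).trans ((congrArg f.lin ((smul_standardGen_eq_zero l a).2 ha)).trans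
    (map_zero f.lin))

theorem isHomogeneous_trace (M : GrMod 𝒜) (U : Set Λ) :
    M.IsHomogeneous (idempotentTrace (fun l => (e l : B)) U M) := by
  refine M.isHomogeneous_span _ ?_
  rintro _ ⟨m, hm, x, rfl⟩ i
  have := M.comp_comp_smul (e m).2 i x
  exact this ▸ smul_mem_idempotentTrace (e := fun l => (e l : B)) hm _

variable (e) in
/-- The kernel of the projection from the projective module to the standard module. -/
abbrev standardKer (l : Λ) : GrMod 𝒜 :=
  (principal (e l)).sub (idempotentTrace (fun l => (e l : B)) (Set.Ioi l) (principal (e l)))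
    (isHomogeneous_trace _ _)

variable (e) in
/-- The inclusion of the kernel of the projection to the standard module. -/
def standardKerι (l : Λ) : standardKer e l ⟶ principal (e l) :=
  ⟨Submodule.subtype _, fun h => h⟩

variable (e) in
/-- The projection from the projective module to the standard module. -/
def standardπ (l : Λ) : principal (e l) ⟶ standard e l :=
  ⟨(standardIdeal (fun l => (e l : B)) l).mkQ ∘ₗ Submodule.subtype _, fun {_ x} h => ⟨x.1, h, rfl⟩⟩

theorem standardπ_surjective (l : Λ) : Function.Surjective (standardπ e l).lin := by
  intro y
  obtain ⟨b, rfl⟩ := exists_smul_standardGen l y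
  exact ⟨b • principalGen (e l), rfl⟩

/-- An extension-closed property that holds for standard modules with labels in `W` holds for
the modules filtered by them. -/
theorem Filtered.induction {W : Set Λ} {𝒬 : GrMod 𝒜 → Prop} (hzero : ∀ X, IsZero X → 𝒬 X)
    (hext : ∀ S : ShortComplex (GrMod 𝒜), S.ShortExact → 𝒬 S.X₁ → 𝒬 S.X₃ → 𝒬 S.X₂)
    (hst : ∀ l ∈ W, ∀ s : ℤ, 𝒬 ((standard e l).shift s)) {M : GrMod 𝒜} {N : Submodule B M}
    (hN : M.Filtered (fun l => (e l : B)) W N) (hom : M.IsHomogeneous N) : 𝒬 (M.sub N hom) := by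
  -- Invariance under isomorphism is the case of an extension by the zero module.
  have hiso : ∀ {X Y : GrMod 𝒜}, (X ≅ Y) → 𝒬 X → 𝒬 Y := by
    intro X Y φ hX
    have : (ShortComplex.mk φ.hom (0 : Y ⟶ zeroObj) comp_zero).ShortExact :=
      shortExact_of _ _ _ (injective_of_mono φ.hom) (fun _ => ⟨0, rfl⟩)
        (fun x _ => surjective_of_epi φ.hom x)
    exact hext _ this hX (hzero _ (isZero_of_forall fun _ => rfl))
  induction hN with
  | bot => exact hzero _ (isZero_of_forall fun x => Subtype.ext ((Submodule.mem_bot B).1 x.2))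
  | @step N x s m hN hx hm hex hz ih =>
    have hNh := hN.isHomogeneous
    let f := M.subHom hNh hom le_sup_left
    have hS : (ShortComplex.mk f (cokerπ f) (comp_cokerπ f)).ShortExact :=
      shortExact_of _ _ _ (Submodule.inclusion_injective (le_sup_left : N ≤ N ⊔ Submodule.span B {x})) (cokerπ_surjective f)
        (fun x => (cokerπ_eq_zero f x).1)
    let x' : M.sub _ hom :=
      ⟨x, Submodule.mem_sup_right (Submodule.mem_span_singleton_self x)⟩
    -- The annihilator of the generator of the section is exactly the ideal that defines the
    -- standard module, so the section is that module shifted by the degree of `x`.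
    have hzero' : ∀ a : B, a • (cokerπ f).lin x' = 0 ↔
        a ∈ standardIdeal (fun l => (e l : B)) m := by
      intro a
      rw [← map_smul, cokerπ_eq_zero, ← hz]
      constructor
      · rintro ⟨y, hy⟩
        have : y.1 = a • x := congrArg Subtype.val hy
        exact this ▸ y.2
      · exact fun ha => ⟨⟨a • x, ha⟩, rfl⟩
    have hx' : (cokerπ f).lin x' ∈ (coker f).deg s := (cokerπ f).map_mem (x := x') hx
    let g : (standard e m).shift s ⟶ coker f :=
      standardHom m hx' fun a ha => (hzero' a).2 ha
    have hg : ∀ b : B, g.lin (b • standardGen e m) = b • (cokerπ f).lin x' :=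
      standardHom_smul_gen hx' _
    obtain ⟨φ⟩ : Nonempty ((standard e m).shift s ≅ coker f) := by
      refine nonempty_iso_of_bijective g ⟨?_, ?_⟩
      · rw [← LinearMap.ker_eq_bot, eq_bot_iff]
        intro y hy
        obtain ⟨b, rfl⟩ := exists_smul_standardGen m y
        have h1 : g.lin (b • standardGen e m) = 0 := hy
        rw [hg, hzero'] at h1
        exact (smul_standardGen_eq_zero m b).2 h1
      · intro y
        obtain ⟨⟨z, hz⟩, rfl⟩ := cokerπ_surjective f y
        obtain ⟨n, hn, w, hw, rfl⟩ := Submodule.mem_sup.1 hz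
        obtain ⟨b, rfl⟩ := Submodule.mem_span_singleton.1 hw
        refine ⟨b • standardGen e m, (hg b).trans ?_⟩
        rw [← map_smul, ← sub_eq_zero, ← map_sub, cokerπ_eq_zero]
        refine ⟨⟨-n, N.neg_mem hn⟩, Subtype.ext ?_⟩
        change -n = b • x - (n + b • x)
        abel
    exact hext _ hS (ih hNh) (hiso φ (hst m hm s))

variable {L : Λ → FDMod k (𝒜 0)}
  (h : IsIdempotentSystem (fun l => ((L l).inflate : FDMod k B)) (fun l => (e l : B)))
  (hq : IsQuasiHereditary (fun l => ((L l).inflate : FDMod k B)))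
include h hq

theorem standardKer_exact (l : Λ) (x : principal (e l)) :
    (standardπ e l).lin x = 0 ↔ ∃ y, (standardKerι e l).lin y = x := by
  have hx : (standardπ e l).lin x = 0 ↔
      x ∈ idempotentTrace (fun l => (e l : B)) (Set.Ioi l) (principal (e l)) := by
    have h1 := h.idempotentTrace_span hq l
    have h2 : x ∈ (standardIdeal (fun l => (e l : B)) l).comap
      (Submodule.span B {(e l : B)}).subtype ↔ (standardπ e l).lin x = 0 :=
      (Submodule.Quotient.mk_eq_zero (standardIdeal (fun l => (e l : B)) l) (x := x.1)).symm
    rw [← h2]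
    exact (SetLike.ext_iff.1 h1 x).symm
  rw [hx]
  exact ⟨fun hx => ⟨⟨x, hx⟩, rfl⟩, fun ⟨y, hy⟩ => hy ▸ y.2⟩

theorem standardKerι_comp (l : Λ) : standardKerι e l ≫ standardπ e l = 0 := by
  ext x
  exact (standardKer_exact h hq l _).2 ⟨x, rfl⟩

theorem standardKer_shortExact (l : Λ) (s : ℤ) :
    ((ShortComplex.mk (standardKerι e l) (standardπ e l) (standardKerι_comp h hq l)).map
      (shiftBy 𝒜 s)).ShortExact :=
  (shortExact_of _ _ _ Subtype.val_injective (standardπ_surjective l)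
    (fun x => (standardKer_exact h hq l x).1)).map_of_exact _

/-- This is the form in which the graded filtration of the kernel is used: an extension-closed
property passes from larger labels to the kernel, and from there to the standard module of `l`. -/
theorem standardKer_induction [Finite Λ] {𝒬 : GrMod 𝒜 → Prop} (hzero : ∀ X, IsZero X → 𝒬 X)
    (hext : ∀ S : ShortComplex (GrMod 𝒜), S.ShortExact → 𝒬 S.X₁ → 𝒬 S.X₃ → 𝒬 S.X₂) (l : Λ)
    (hst : ∀ m, l < m → ∀ s : ℤ, 𝒬 ((standard e m).shift s)) (s : ℤ) :
    𝒬 ((standardKer e l).shift s) := by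
  have := Fintype.ofFinite Λ
  refine Filtered.induction (𝒬 := fun X => 𝒬 (X.shift s)) (W := Set.Ioi l) (fun X hX => ?_)
    (fun S hS => ?_) (fun m hm t => ?_) (filtered_trace h hq l) (isHomogeneous_trace _ _)
  · exact hzero _ ((shiftBy 𝒜 s).map_isZero hX)
  · exact hext _ (hS.map_of_exact (shiftBy 𝒜 s))
  · obtain ⟨φ⟩ := (standard e m).shift_shift_iso (rfl : t + s = t + s)
    have : (ShortComplex.mk φ.inv (0 : _ ⟶ zeroObj) comp_zero).ShortExact :=
      shortExact_of _ _ _ (injective_of_mono φ.inv) (fun _ => ⟨0, rfl⟩)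
        (fun x _ => surjective_of_epi φ.inv x)
    exact hext _ this (hst m hm (t + s)) (hzero _ (isZero_of_forall fun _ => rfl))

end GrMod

end StandardSequences

/-! ### Vanishing of Ext from standard modules -/

section ExtVanishing

open Abelian

section General

variable {C : Type*} [Category* C] [Abelian C] [HasExt C]

theorem CategoryTheory.Abelian.Ext.subsingleton_zero {X Y : C} (h : ∀ f : X ⟶ Y, f = 0) :
    Subsingleton (Ext X Y 0) :=
  have : Subsingleton (X ⟶ Y) := subsingleton_of_forall_eq 0 h
  Ext.addEquiv₀.injective.subsingleton

theorem CategoryTheory.Abelian.Ext.subsingleton_middle {S : ShortComplex C} (hS : S.ShortExact)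
    {Y : C} {n : ℕ} (h1 : Subsingleton (Ext S.X₁ Y n)) (h3 : Subsingleton (Ext S.X₃ Y n)) :
    Subsingleton (Ext S.X₂ Y n) := by
  refine subsingleton_of_forall_eq 0 fun x => ?_
  obtain ⟨y, rfl⟩ := Ext.contravariant_sequence_exact₂ hS Y x (Subsingleton.elim _ _)
  rw [Subsingleton.elim y 0, Ext.comp_zero]

theorem CategoryTheory.Abelian.Ext.subsingleton_right {S : ShortComplex C} (hS : S.ShortExact)
    (hP : Projective S.X₂) {Y : C} {n : ℕ} (h1 : Subsingleton (Ext S.X₁ Y n)) :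
    Subsingleton (Ext S.X₃ Y (n + 1)) := by
  refine subsingleton_of_forall_eq 0 fun x => ?_
  have := Ext.subsingleton_of_projective S.X₂ Y n
  obtain ⟨y, rfl⟩ := Ext.contravariant_sequence_exact₃ hS Y x (Subsingleton.elim _ _)
    (add_comm 1 n)
  rw [Subsingleton.elim y 0, Ext.comp_zero]

theorem CategoryTheory.Abelian.Ext.subsingleton_of_isZero {X Y : C} (hX : IsZero X) (n : ℕ) :
    Subsingleton (Ext X Y n) := by
  refine subsingleton_of_forall_eq 0 fun x => ?_
  rw [← x.mk₀_id_comp, (IsZero.iff_id_eq_zero X).1 hX, Ext.mk₀_zero, Ext.zero_comp]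

end General

variable {k B : Type u} [Field k] [Ring B] [Algebra k B] {𝒜 : ℕ → Submodule k B}
  [GradedAlgebra 𝒜] [Module.Finite k B] {Λ : Type v} [PartialOrder Λ] [Finite Λ] {e : Λ → 𝒜 0}
  {L : Λ → FDMod k (𝒜 0)}
  (h : IsIdempotentSystem (fun l => ((L l).inflate : FDMod k B)) (fun l => (e l : B)))
  (hq : IsQuasiHereditary (fun l => ((L l).inflate : FDMod k B)))

namespace GrMod

include h

theorem projective_shift_principal (l : Λ) (s : ℤ) :
    Projective ((shiftBy 𝒜 s).obj (principal (e l))) :=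
  projective_principal (Subtype.ext (h.idem l)) s

include hq

/-- Dimension shifting: the kernel of the projective cover is filtered by standard modules with
labels above `μ`. -/
theorem subsingleton_ext_standard_succ (μ : Λ) {M : GrMod 𝒜} {n : ℕ}
    (hM : ∀ m, μ < m → ∀ s : ℤ, Subsingleton (Ext ((standard e m).shift s) M n)) (s : ℤ) :
    Subsingleton (Ext ((standard e μ).shift s) M (n + 1)) := by
  refine Ext.subsingleton_right (standardKer_shortExact h hq μ s)
    (projective_shift_principal h μ s) ?_
  exact standardKer_induction h hq (𝒬 := fun X => Subsingleton (Ext X M n))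
    (fun X hX => Ext.subsingleton_of_isZero hX n) (fun S hS => Ext.subsingleton_middle hS) μ hM s

/-- In degree 0 a map is given by a vector in `e μ • M`, which is zero. Higher degrees follow by
shifting to larger labels, where the hypothesis persists. -/
theorem subsingleton_ext_standard (μ : Λ) {M : GrMod 𝒜}
    (hM : ∀ m, μ ≤ m → ∀ x : M, (e m : B) • x = 0) (n : ℕ) (s : ℤ) :
    Subsingleton (Ext ((standard e μ).shift s) M n) := by
  induction n generalizing μ s with
  | zero =>
    refine Ext.subsingleton_zero fun f => standard_hom_eq_zero ?_
    rw [← idem_smul_standard_lin, hM μ le_rfl]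
  | succ n ih =>
    exact subsingleton_ext_standard_succ h hq μ
      (fun m hm s => ih m (fun i hi => hM i (hm.le.trans hi)) s) s

theorem subsingleton_ext_standard_pos (μ : Λ) {M : GrMod 𝒜}
    (hM : ∀ m, μ < m → ∀ x : M, (e m : B) • x = 0) (n : ℕ) (s : ℤ) :
    Subsingleton (Ext ((standard e μ).shift s) M (n + 1)) :=
  subsingleton_ext_standard_succ h hq μ
    (fun m hm s => subsingleton_ext_standard h hq m (fun i hi => hM i (hm.trans_le hi)) n s) s

omit hq [Finite Λ] in
theorem standardGen_ne_zero (l : Λ) : standardGen e l ≠ 0 :=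
  h.mkQ_standardIdeal_ne_zero l

omit h hq [Finite Λ] in
theorem idem_smul_standard {l m : Λ} (hm : ¬ m ≤ l) (x : standard e l) : (e m : B) • x = 0 := by
  obtain ⟨b, rfl⟩ := exists_smul_standardGen l x
  rw [← mul_smul, smul_standardGen_eq_zero]
  exact mul_mem_standardIdeal (fun l => (e l : B)) hm b

/-- The multiplicity one of `L l` is transported from the standard module supplied by
quasi-heredity, by uniqueness of standard modules. -/
theorem idem_smul_standard_line (l : Λ) (x : standard e l) :
    ∃ c : k, (e l : B) • x = c • standardGen e l := by
  obtain ⟨D, hDs, hD, -⟩ := h.exists_filtration hq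
  obtain ⟨φ⟩ := h.standard_unique (h.isStandard_standardQuotient l) (hDs l)
  obtain ⟨z, hz, -, hline⟩ := hD.generator l
  obtain ⟨c, hc⟩ := hline (φ (standardGen e l))
  obtain ⟨d, hd⟩ := hline (φ x)
  have h1 : φ (standardGen e l) = c • z := by
    rw [← hc, ← map_smul]
    exact congrArg φ (idem_smul_standardGen l).symm
  have hc0 : c ≠ 0 := by
    rintro rfl
    rw [zero_smul, map_eq_zero_iff φ φ.injective] at h1
    exact standardGen_ne_zero h l h1
  refine ⟨d * c⁻¹, φ.injective ?_⟩
  have h2 : φ ((d * c⁻¹) • standardGen e l) = (d * c⁻¹) • φ (standardGen e l) :=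
    map_smul (φ.toLinearMap.restrictScalars k) _ _
  rw [h2, h1, ← mul_smul, mul_assoc, inv_mul_cancel₀ hc0, mul_one, ← hd]
  exact map_smul φ _ _

theorem standard_hom_eq_smul {l : Λ} {s t : ℤ}
    (f : (standard e l).shift s ⟶ (standard e l).shift t) :
    (s ≠ t → f = 0) ∧ ∃ c : k, ∀ x : standard e l, f.lin x = c • x := by
  have h0 := standard_lin_mem f
  obtain ⟨c, hc⟩ := idem_smul_standard_line h hq l (f.lin (standardGen e l))
  have h1 : f.lin (standardGen e l) = c • standardGen e l :=
    (idem_smul_standard_lin f).symm.trans hc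
  refine ⟨fun hst => standard_hom_eq_zero ?_, c, fun x => ?_⟩
  · have h2 : c • standardGen e l ∈ (standard e l).deg 0 :=
      Submodule.smul_mem _ _ (standardGen_mem l)
    have h3 : c • standardGen e l ∈ (standard e l).deg (s - t) := h1 ▸ h0
    rw [h1]
    exact ((standard e l).comp_of_mem h2).symm.trans
      ((standard e l).comp_of_mem_ne h3 (sub_ne_zero.2 hst))
  · obtain ⟨b, rfl⟩ := exists_smul_standardGen l x
    refine (map_smul f.lin b (standardGen e l)).trans ((congrArg (b • ·) h1).trans ?_)
    exact smul_comm b c (standardGen e l)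

/-- The factors of `Δ(ν)` have labels at most `ν`. Unless `μ ≤ ν`, the vanishing theorem applies in
all degrees; for `μ = ν` it applies in positive degrees, and in degree 0 the line `e ν • Δ(ν)` sits
in a single grading degree. -/
theorem ext_standard_standard {μ ν : Λ} {s t : ℤ} {n : ℕ}
    (hne : Nontrivial (Ext ((standard e μ).shift s) ((standard e ν).shift t) n)) :
    μ < ν ∨ (μ = ν ∧ s = t ∧ n = 0) := by
  by_contra! hcon
  obtain ⟨h1, h2⟩ := hcon
  rw [← not_subsingleton_iff_nontrivial] at hne
  apply hne
  by_cases hμν : μ = ν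
  · subst hμν
    cases n with
    | zero =>
      exact Ext.subsingleton_zero fun f => (standard_hom_eq_smul h hq f).1
        fun hst => h2 rfl hst rfl
    | succ n =>
      exact subsingleton_ext_standard_pos h hq μ (M := (standard e μ).shift t)
        (fun m hm x => idem_smul_standard (not_le_of_gt hm) x) n s
  · exact subsingleton_ext_standard h hq μ (M := (standard e ν).shift t) (fun m hm x => idem_smul_standard
      (fun hmν => h1 (lt_of_le_of_ne (hm.trans hmν) hμν)) x) n s

/-- Modulo `standardIdeal`, which kills `f`, the product `e l * b` is a scalar `c`. So `f b = f (e l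
* b) = c * f 1`. -/
theorem costandard_eq_zero {l : Λ} {f : costandard e l} (hf : (e l : B) • f = f)
    (hf1 : costandardEval e l f = 0) : f = 0 := by
  refine costandardSpace_ext fun b => ?_
  obtain ⟨c, hc⟩ := idem_smul_standard_line h hq l (b • standardGen e l)
  have h1 : (e l : B) * b - algebraMap k B c ∈ standardIdeal (fun l => (e l : B)) l := by
    rw [← smul_standardGen_eq_zero, sub_smul, mul_smul, hc, algebraMap_smul, sub_self]
  have h2 := smul_eq_zero_of_mem_standardIdeal (e := fun l => (e l : B)) hf
    (M := costandard e l)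
    (fun m hm y => smul_costandardSpace_eq_zero (e := fun l => (e l : B)) hm y) h1
  have h3 : f.1 (1 * ((e l : B) * b - algebraMap k B c)) = 0 := congrArg (fun g => g.1 1) h2
  rw [one_mul, map_sub, f.2.1, Algebra.algebraMap_eq_smul_one, map_smul] at h3
  have h4 : f.1 1 = 0 := hf1
  rw [h4, smul_zero, sub_zero] at h3
  exact h3

theorem standard_hom_costandard_eq_zero {μ ν : Λ} {s t : ℤ} (hμν : μ ≤ ν)
    (hne : μ = ν → s ≠ t) (f : (standard e μ).shift s ⟶ (costandard e ν).shift t) : f = 0 := by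
  refine standard_hom_eq_zero ?_
  by_cases h0 : μ = ν
  · subst h0
    refine costandard_eq_zero h hq (idem_smul_standard_lin f) ?_
    exact costandard_apply_one (sub_ne_zero.2 (hne rfl)) (standard_lin_mem f)
  · refine costandardSpace_ext fun b => ?_
    have h1 := ideal_smul_standard_lin f (mul_mem_standardIdeal (fun l => (e l : B))
      (show ¬ ν ≤ μ from fun h => h0 (le_antisymm hμν h)) b)
    have h2 : (show costandard e ν from f.lin (standardGen e μ)).1 (1 * ((e ν : B) * b)) = 0 :=
      congrArg (fun g : costandard e ν => g.1 1) h1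
    rw [one_mul, (show costandard e ν from f.lin (standardGen e μ)).2.1] at h2
    exact h2

end GrMod

end ExtVanishing

/-! ### Ext between standard and costandard modules -/

section ExtCostandard

open Abelian

variable {k B : Type u} [Field k] [Ring B] [Algebra k B] {𝒜 : ℕ → Submodule k B}
  [GradedAlgebra 𝒜] [Module.Finite k B] {Λ : Type v} [PartialOrder Λ] {e : Λ → 𝒜 0}
  {L : Λ → FDMod k (𝒜 0)}

namespace GrMod

theorem hom_ext_of_mem {M N : GrMod 𝒜} {f g : M ⟶ N}
    (h : ∀ i, ∀ x ∈ M.deg i, f.lin x = g.lin x) : f = g := by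
  ext x
  obtain ⟨s, hs⟩ := M.exists_sum_comp x
  rw [← hs, map_sum, map_sum]
  exact Finset.sum_congr rfl fun i _ => h i _ (M.comp_mem i x)

theorem comp_smul_of_mem (M : GrMod 𝒜) {i j : ℤ} {b : B} (hb : b ∈ (regular 𝒜).deg j) (x : M) :
    M.comp i (b • x) = b • M.comp (i - j) x := by
  by_cases hj : 0 ≤ j
  · obtain ⟨n, rfl⟩ := Int.eq_ofNat_of_zero_le hj
    exact M.comp_comp_smul (mem_regular_deg_natCast.1 hb) i x
  · rw [eq_zero_of_mem_regular_deg (by omega) hb, zero_smul, zero_smul, map_zero]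

/-- A graded module embedded in a projective one: a morphism that extends to a linear map extends
to a morphism. -/
theorem exists_lift_of_linear {a : 𝒜 0} (ha : a * a = a) {K M : GrMod 𝒜} (ι : K ⟶ principal a)
    {s : ℤ} (f : K.shift s ⟶ M) (φ : principal a →ₗ[B] M)
    (hφ : ∀ z : K, φ (ι.lin z) = f.lin z) :
    ∃ g : (principal a).shift s ⟶ M, (shiftBy 𝒜 s).map ι ≫ g = f := by
  let y := φ (principalGen a)
  -- The image of the generator under `φ` need not be homogeneous; its component of degree `s` gives
  -- the same values on homogeneous elements of `K`, because `f` preserves degrees.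
  refine ⟨principalHom a (M.comp_mem s y), hom_ext_of_mem fun i z hz => ?_⟩
  have hz' : (ι.lin (show K from z)).1 ∈ (regular 𝒜).deg (i - s) := ι.map_mem hz
  have h1 : (ι.lin (show K from z)).1 • y = f.lin z :=
    (map_smul φ _ _).symm.trans ((congrArg φ (smul_principalGen ha _)).trans (hφ z))
  have h2 := M.comp_smul_of_mem (i := i) hz' y
  rw [h1, comp_of_mem _ (f.map_mem hz), sub_sub_cancel] at h2
  exact h2.symm

variable (h : IsIdempotentSystem (fun l => ((L l).inflate : FDMod k B)) (fun l => (e l : B)))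
  (hq : IsQuasiHereditary (fun l => ((L l).inflate : FDMod k B)))
include h hq

/-- The costandard module is injective only relative to modules with factors at most `ν`. Dividing
the kernel by its trace `Z` over the other labels, and the projective module by the image of `Z`,
produces an injection between such modules. The extension found there is linear, and is then made
homogeneous. -/
theorem exists_lift_standardKer {μ ν : Λ} (hμν : μ ≤ ν) {s t : ℤ}
    (f : (standardKer e μ).shift s ⟶ (costandard e ν).shift t) :
    ∃ g : (principal (e μ)).shift s ⟶ (costandard e ν).shift t,
      (shiftBy 𝒜 s).map (standardKerι e μ) ≫ g = f := by
  let E : Λ → B := fun l => (e l : B)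
  let Z : Submodule B (standardKer e μ) := idempotentTrace E {m | ¬ m ≤ ν} (standardKer e μ)
  let Z' : Submodule B (principal (e μ)) := Z.map (standardKerι e μ).lin
  let f' : standardKer e μ →ₗ[B] costandard e ν := f.lin
  have := (standardKer e μ).finite
  have := (principal (e μ)).finite
  have hfX : Module.Finite k (standardKer e μ ⧸ Z) :=
    Module.Finite.of_surjective (Z.mkQ.restrictScalars k) (Submodule.mkQ_surjective Z)
  have hfY : Module.Finite k (principal (e μ) ⧸ Z') :=
    Module.Finite.of_surjective (Z'.mkQ.restrictScalars k) (Submodule.mkQ_surjective Z')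
  have hZf : Z ≤ LinearMap.ker f' := by
    refine Submodule.span_le.2 ?_
    rintro _ ⟨m, hm, x, rfl⟩
    change f' (E m • x) = 0
    rw [map_smul]
    exact smul_costandardSpace_eq_zero (e := E) hm (f' x)
  let X : FDMod k B := FDMod.of k B (standardKer e μ ⧸ Z)
  let Y : FDMod k B := FDMod.of k B (principal (e μ) ⧸ Z')
  have hX : FactorsLE (fun l => ((L l).inflate : FDMod k B)) ν X := by
    rw [h.factorsLE_iff]
    intro m hm x
    obtain ⟨x, rfl⟩ := Submodule.mkQ_surjective Z x
    change E m • Z.mkQ x = 0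
    rw [← map_smul]
    exact (Submodule.Quotient.mk_eq_zero Z).2 (smul_mem_idempotentTrace hm x)
  have hY : FactorsLE (fun l => ((L l).inflate : FDMod k B)) ν Y := by
    rw [h.factorsLE_iff]
    intro m hm x
    obtain ⟨x, rfl⟩ := Submodule.mkQ_surjective Z' x
    change E m • Z'.mkQ x = 0
    rw [← map_smul]
    refine (Submodule.Quotient.mk_eq_zero Z').2 ?_
    -- Since `Δ(μ)` has factors at most `μ ≤ ν`, the vector `e m • x` lies in the kernel. As `e m`
    -- is idempotent, it even lies in the image of `Z`.
    have h1 : (standardπ e μ).lin (E m • x) = 0 := by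
      rw [map_smul]
      exact idem_smul_standard (fun hmμ => hm (hmμ.trans hμν)) _
    obtain ⟨y, hy⟩ := (standardKer_exact h hq μ _).1 h1
    refine ⟨E m • y, smul_mem_idempotentTrace hm y, ?_⟩
    rw [map_smul, hy, ← mul_smul, h.idem m]
  let g : X →ₗ[B] Y := Z.mapQ Z' (standardKerι e μ).lin (Submodule.le_comap_map _ _)
  have hg : Function.Injective g := by
    rw [← LinearMap.ker_eq_bot, eq_bot_iff]
    intro x hx
    obtain ⟨x, rfl⟩ := Submodule.mkQ_surjective Z x
    obtain ⟨z, hz, hzx⟩ := (Submodule.Quotient.mk_eq_zero Z').1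
      (show Z'.mkQ ((standardKerι e μ).lin x) = 0 from hx)
    have : z = x := Subtype.ext hzx
    exact (Submodule.Quotient.mk_eq_zero Z).2 (this ▸ hz)
  obtain ⟨φ, hφ⟩ := (isGradedCostandard_costandard h ν).costandard.injective X Y hX hY g
    (Z.liftQ f' hZf) hg
  exact exists_lift_of_linear (Subtype.ext (h.idem μ)) (standardKerι e μ) f (φ ∘ₗ Z'.mkQ)
    fun z => LinearMap.congr_fun hφ (Z.mkQ z)

variable [Finite Λ]

/-- If `μ` is not at most `ν`, no label above `μ` occurs in `∇(ν)`. Otherwise degree 0 is a direct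
computation, degree 1 vanishes because every map from the kernel extends to the projective module,
and degrees from 2 on reduce to larger `μ` by dimension shifting. -/
theorem ext_standard_costandard {μ ν : Λ} {s t : ℤ} {n : ℕ}
    (hne : Nontrivial (Ext ((standard e μ).shift s) ((costandard e ν).shift t) n)) :
    μ = ν ∧ s = t ∧ n = 0 := by
  by_contra hcon
  rw [← not_subsingleton_iff_nontrivial] at hne
  apply hne
  clear hne
  induction μ using WellFoundedGT.induction generalizing s n with
  | ind μ ih =>
  by_cases hμν : μ ≤ ν
  · have hzero : n = 0 → Subsingleton (Ext ((standard e μ).shift s) ((costandard e ν).shift t) n) := by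
      rintro rfl
      exact Ext.subsingleton_zero fun f => standard_hom_costandard_eq_zero h hq hμν
        (fun h1 h2 => hcon ⟨h1, h2, rfl⟩) f
    rcases n with - | - | n
    · exact hzero rfl
    · have hS := standardKer_shortExact h hq μ s
      have hP := projective_shift_principal h μ s
      refine subsingleton_of_forall_eq 0 fun x => ?_
      have := Ext.subsingleton_of_projective ((shiftBy 𝒜 s).obj (principal (e μ)))
        ((costandard e ν).shift t) 0
      obtain ⟨y, rfl⟩ := Ext.contravariant_sequence_exact₃ hS _ x
        (this.elim _ _) (add_zero 1)
      obtain ⟨f, rfl⟩ := Ext.addEquiv₀.symm.surjective y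
      obtain ⟨g, rfl⟩ := exists_lift_standardKer h hq hμν f
      have h3 := (Ext.mk₀_comp_mk₀ ((shiftBy 𝒜 s).map (standardKerι e μ)) g).symm
      exact (congrArg (fun z => hS.extClass.comp z (add_zero 1)) h3).trans
        (hS.extClass_comp_assoc (Ext.mk₀ g))
    · exact subsingleton_ext_standard_succ h hq μ
        (fun m hm s => ih m hm (fun h => by simp at h)) s
  · exact subsingleton_ext_standard h hq μ (M := (costandard e ν).shift t)
      (fun m hm x => smul_costandardSpace_eq_zero (e := fun l => (e l : B))
        (fun h => hμν (hm.trans h)) x) n s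

omit [Finite Λ] in
-- A functional with nonzero value at `1` keeps this value when replaced by its degree 0 component
-- and multiplied by `e ν`. The result is a legitimate image of the generator of the standard
-- module.
theorem exists_standard_hom_costandard (ν : Λ) (t : ℤ) :
    ∃ f : (standard e ν).shift t ⟶ (costandard e ν).shift t, f ≠ 0 := by
  obtain ⟨f, hf⟩ := h.exists_functional ν
  have hidem := h.idem ν
  let g : costandard e ν := (e ν : B) • (costandard e ν).comp 0 f
  have hg1 : costandardEval e ν g = costandardEval e ν f := by
    rw [costandardEval_idem]
    have h1 : ∀ i, costandardEval e ν ((costandard e ν).comp i ((costandard e ν).comp 0 f)) =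
        costandardEval e ν ((costandard e ν).comp i f) := by
      intro i
      by_cases hi : i = 0
      · subst hi
        rw [comp_of_mem _ ((costandard e ν).comp_mem 0 f)]
      · rw [costandard_apply_one hi ((costandard e ν).comp_mem i _),
          costandard_apply_one hi ((costandard e ν).comp_mem i _)]
    obtain ⟨s, hs⟩ := (costandard e ν).exists_sum_comp_eq
    have h2 : ∀ y, costandardEval e ν y =
        ∑ i ∈ s, costandardEval e ν ((costandard e ν).comp i y) := fun y => by
      rw [← map_sum, hs]
    rw [h2 ((costandard e ν).comp 0 f), h2 f]
    exact Finset.sum_congr rfl fun i _ => h1 i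
  have hg0 : g ∈ (costandard e ν).deg 0 := by
    have := (costandard e ν).smul_mem (e ν).2 ((costandard e ν).comp_mem 0 f)
    exact this
  have hge : (e ν : B) • g = g := by
    rw [← mul_smul, hidem]
  have hg0' : g ∈ ((costandard e ν).shift t).deg t := by
    change g ∈ (costandard e ν).deg (t - t)
    rwa [sub_self]
  let F := standardHom ν (M := (costandard e ν).shift t) hg0' fun a ha =>
    smul_eq_zero_of_mem_standardIdeal (e := fun l => (e l : B)) (M := costandard e ν) hge
      (fun m hm y => smul_costandardSpace_eq_zero (e := fun l => (e l : B)) hm y) ha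
  refine ⟨F, fun h0 => hf ?_⟩
  have h1 : F.lin ((1 : B) • standardGen e ν) = (1 : B) • g := standardHom_smul_gen hg0' _ 1
  have h2 : F.lin ((1 : B) • standardGen e ν) = (0 : costandard e ν) := by
    rw [h0]
    rfl
  have h3 : g = 0 := (one_smul B g).symm.trans (h1.symm.trans h2)
  change costandardEval e ν f = 0
  rw [← hg1, h3, map_zero]

end GrMod

end ExtCostandard

/-! ### Finiteness of Ext from the shifts of a standard module -/

section ExtFinite

open Abelian

theorem Module.Finite.of_exact_middle {k U V W : Type*} [Field k] [AddCommGroup U] [Module k U]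
    [AddCommGroup V] [Module k V] [AddCommGroup W] [Module k W] [Module.Finite k U]
    [Module.Finite k W] (f : U →ₗ[k] V) (g : V →ₗ[k] W)
    (hfg : ∀ v, g v = 0 → ∃ u, f u = v) : Module.Finite k V := by
  refine ⟨Submodule.fg_of_fg_map_of_fg_inf_ker g (IsNoetherian.noetherian _) ?_⟩
  have h1 : ⊤ ⊓ LinearMap.ker g = (LinearMap.range f) ⊓ LinearMap.ker g := by
    ext v
    exact ⟨fun hv => ⟨hfg v hv.2, hv.2⟩, fun hv => ⟨trivial, hv.2⟩⟩
  rw [h1]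
  have : Module.Finite k (LinearMap.range f) := inferInstance
  have h2 := IsNoetherian.noetherian
    ((LinearMap.ker g).comap (LinearMap.range f).subtype)
  have h3 := h2.map (LinearMap.range f).subtype
  rwa [Submodule.map_comap_subtype] at h3

variable {k B : Type u} [Field k] [Ring B] [Algebra k B] {𝒜 : ℕ → Submodule k B}
  [GradedAlgebra 𝒜]

namespace GrMod

/-- The extension spaces from the shifts of `X` to `M` are finite dimensional, and only finitely
many are nonzero. -/
def ExtFinite (M X : GrMod 𝒜) : Prop :=
  (∀ (s : ℤ) (n : ℕ), Module.Finite k (Ext (X.shift s) M n)) ∧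
    {p : ℤ × ℕ | Nontrivial (Ext (X.shift p.1) M p.2)}.Finite

theorem extFinite_of_isZero (M : GrMod 𝒜) {X : GrMod 𝒜} (hX : IsZero X) : ExtFinite M X := by
  have h : ∀ s n, Subsingleton (Ext (X.shift s) M n) := fun s n =>
    Ext.subsingleton_of_isZero ((shiftBy 𝒜 s).map_isZero hX) n
  refine ⟨fun s n => have := h s n; inferInstance, ?_⟩
  refine Set.Finite.subset Set.finite_empty fun p hp => ?_
  exact (not_nontrivial_iff_subsingleton.2 (h p.1 p.2)) hp

/-- Precomposition with an extension as a linear map. -/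
def extPrecomp {X Y : GrMod 𝒜} (M : GrMod 𝒜) {a b c : ℕ} (α : Ext X Y a) (h : a + b = c) :
    Ext Y M b →ₗ[k] Ext X M c where
  toFun β := α.comp β h
  map_add' _ _ := Ext.comp_add _ _ _ _
  map_smul' _ _ := Ext.comp_smul _ _ _ _

variable (M : GrMod 𝒜)

theorem ExtFinite.middle {S : ShortComplex (GrMod 𝒜)} (hS : S.ShortExact)
    (h1 : ExtFinite M S.X₁) (h3 : ExtFinite M S.X₃) : ExtFinite M S.X₂ := by
  have hS' : ∀ s, (S.map (shiftBy 𝒜 s)).ShortExact := fun s => hS.map_of_exact _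
  refine ⟨fun s n => ?_, (h1.2.union h3.2).subset fun p hp => ?_⟩
  · have : Module.Finite k (Ext (S.map (shiftBy 𝒜 s)).X₁ M n) := h1.1 s n
    have : Module.Finite k (Ext (S.map (shiftBy 𝒜 s)).X₃ M n) := h3.1 s n
    refine Module.Finite.of_exact_middle (k := k)
      (extPrecomp M (Ext.mk₀ (S.map (shiftBy 𝒜 s)).g) (zero_add n))
      (extPrecomp M (Ext.mk₀ (S.map (shiftBy 𝒜 s)).f) (zero_add n)) fun v hv => ?_
    exact Ext.contravariant_sequence_exact₂ (hS' s) M v hv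
  · by_contra hcon
    rw [Set.mem_union, not_or] at hcon
    exact not_nontrivial_iff_subsingleton.2 (Ext.subsingleton_middle (hS' p.1)
      (not_nontrivial_iff_subsingleton.1 hcon.1) (not_nontrivial_iff_subsingleton.1 hcon.2)) hp

/-- In degree 0 the Ext group of the third term embeds in that of the middle term. In degree `n + 1`
it is controlled by degree `n` of the first term, whence the shift in the support. -/
theorem ExtFinite.right {S : ShortComplex (GrMod 𝒜)} (hS : S.ShortExact)
    (hP : ∀ s, Projective (S.X₂.shift s)) (h1 : ExtFinite M S.X₁) (h2 : ExtFinite M S.X₂) :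
    ExtFinite M S.X₃ := by
  have hS' : ∀ s, (S.map (shiftBy 𝒜 s)).ShortExact := fun s => hS.map_of_exact _
  have h0 : ∀ s (f : Ext (S.X₃.shift s) M 0),
      (Ext.mk₀ ((shiftBy 𝒜 s).map S.g)).comp f (zero_add 0) = 0 → f = 0 := by
    intro s f hf
    have := (hS' s).epi_g
    exact Ext.precomp_mk₀_injective_of_epi M (S.map (shiftBy 𝒜 s)).g (hf.trans (map_zero _).symm)
  refine ⟨fun s n => ?_, ((h2.2.union (h1.2.image fun p => (p.1, p.2 + 1)))).subset fun p hp => ?_⟩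
  · have : ∀ n, Module.Finite k (Ext (S.map (shiftBy 𝒜 s)).X₁ M n) := h1.1 s
    have : ∀ n, Module.Finite k (Ext (S.map (shiftBy 𝒜 s)).X₂ M n) := h2.1 s
    cases n with
    | zero =>
      exact Module.Finite.of_injective
        (extPrecomp M (Ext.mk₀ ((shiftBy 𝒜 s).map S.g)) (zero_add 0) :
          Ext (S.X₃.shift s) M 0 →ₗ[k] Ext (S.map (shiftBy 𝒜 s)).X₂ M 0)
        ((injective_iff_map_eq_zero _).2 (h0 s))
    | succ n =>
      refine Module.Finite.of_exact_middle (k := k)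
        (extPrecomp M (hS' s).extClass (add_comm 1 n))
        (extPrecomp M (Ext.mk₀ (S.map (shiftBy 𝒜 s)).g) (zero_add (n + 1))) fun v hv => ?_
      exact Ext.contravariant_sequence_exact₃ (hS' s) M v hv (add_comm 1 n)
  · obtain ⟨s, n⟩ := p
    by_contra hcon
    rw [Set.mem_union, not_or] at hcon
    refine not_nontrivial_iff_subsingleton.2 ?_ hp
    cases n with
    | zero =>
      have := not_nontrivial_iff_subsingleton.1 hcon.1
      exact subsingleton_of_forall_eq 0 fun f => h0 s f (this.elim _ _)
    | succ n =>
      refine Ext.subsingleton_right (hS' s) (hP s)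
        (not_nontrivial_iff_subsingleton.1 fun hn => hcon.2 ?_)
      exact ⟨(s, n), hn, rfl⟩

variable [Module.Finite k B]

/-- Only degree 0 counts, and there a morphism is determined by the image of the generator in `M_s`,
which vanishes for all but finitely many `s`. -/
theorem extFinite_principal {a : 𝒜 0} (ha : a * a = a) : ExtFinite M (principal a) := by
  obtain ⟨t, ht⟩ := M.exists_degrees
  have hz : ∀ s n, Subsingleton (Ext ((principal a).shift s) M (n + 1)) := fun s n =>
    have := projective_principal ha s
    Ext.subsingleton_of_projective ((principal a).shift s) M n
  refine ⟨fun s n => ?_, (t.finite_toSet.image fun s => (s, 0)).subset fun p hp => ?_⟩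
  · cases n with
    | zero =>
      let ev : ((principal a).shift s ⟶ M) →ₗ[k] M :=
        { toFun := fun f => f.lin (principalGen a)
          map_add' := fun _ _ => rfl
          map_smul' := fun _ _ => rfl }
      have : Module.Finite k ((principal a).shift s ⟶ M) :=
        Module.Finite.of_injective ev fun f g hfg => principal_hom_ext ha hfg
      exact Module.Finite.equiv (Ext.linearEquiv₀ (R := k)).symm
    | succ n =>
      have := hz s n
      infer_instance
  · obtain ⟨s, n⟩ := p
    cases n with
    | zero =>
      refine ⟨s, ?_, rfl⟩
      by_contra hs
      refine not_nontrivial_iff_subsingleton.2 (Ext.subsingleton_zero fun f => ?_) hp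
      refine principal_hom_ext ha ?_
      rw [← comp_of_mem _ (principal_lin_mem f), ht s hs]
      rfl
    | succ n => exact absurd hp (not_nontrivial_iff_subsingleton.2 (hz s n))

theorem ExtFinite.shift {X : GrMod 𝒜} (hX : ExtFinite M X) (t : ℤ) :
    ExtFinite M (X.shift t) := by
  refine ⟨fun s n => ?_, ?_⟩
  · obtain ⟨φ⟩ := X.shift_shift_iso (rfl : t + s = t + s)
    have := hX.1 (t + s) n
    refine Module.Finite.of_injective (extPrecomp M (Ext.mk₀ φ.inv) (zero_add n) :
      Ext ((X.shift t).shift s) M n →ₗ[k] Ext (X.shift (t + s)) M n) ?_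
    refine (injective_iff_map_eq_zero _).2 fun x hx => ?_
    have h1 : (Ext.mk₀ φ.hom).comp ((Ext.mk₀ φ.inv).comp x (zero_add n)) (zero_add n) = x := by
      simp
    have h2 : (Ext.mk₀ φ.inv).comp x (zero_add n) = 0 := hx
    rw [← h1, h2, Ext.comp_zero]
  · refine (hX.2.image fun p => (p.1 - t, p.2)).subset fun p hp => ?_
    refine ⟨(t + p.1, p.2), ?_, Prod.ext (by simp) rfl⟩
    obtain ⟨φ⟩ := X.shift_shift_iso (rfl : t + p.1 = t + p.1)
    by_contra hcon
    exact not_nontrivial_iff_subsingleton.2 (Ext.subsingleton_of_iso φ (Iso.refl M)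
      (not_nontrivial_iff_subsingleton.1 hcon)) hp

variable {Λ : Type v} [PartialOrder Λ] [Finite Λ] {e : Λ → 𝒜 0} {L : Λ → FDMod k (𝒜 0)}
  (h : IsIdempotentSystem (fun l => ((L l).inflate : FDMod k B)) (fun l => (e l : B)))
  (hq : IsQuasiHereditary (fun l => ((L l).inflate : FDMod k B)))
include h hq

/-- Descending induction on the label along `0 → K(μ) → B e_μ → Δ(μ) → 0`. -/
theorem extFinite_standard (μ : Λ) : ExtFinite M (standard e μ) := by
  induction μ using WellFoundedGT.induction with
  | ind μ ih =>
  have hK := standardKer_induction h hq (𝒬 := ExtFinite M) (fun X => extFinite_of_isZero M)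
    (fun S hS => ExtFinite.middle M hS) μ (fun m hm s => (ih m hm).shift M s) 0
  have hK0 : ExtFinite M (standardKer e μ) := by
    obtain ⟨φ⟩ := (standardKer e μ).shift_zero_iso
    have : (ShortComplex.mk φ.hom (0 : _ ⟶ zeroObj) comp_zero).ShortExact :=
      shortExact_of _ _ _ (injective_of_mono φ.hom) (fun _ => ⟨0, rfl⟩)
        (fun x _ => surjective_of_epi φ.hom x)
    exact ExtFinite.middle M this hK (extFinite_of_isZero M (isZero_of_forall fun _ => rfl))
  exact ExtFinite.right M (shortExact_of _ _ (standardKerι_comp h hq μ) Subtype.val_injective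
    (standardπ_surjective μ) fun x => (standardKer_exact h hq μ x).1)
    (fun s => projective_shift_principal h μ s) hK0
    (extFinite_principal M (Subtype.ext (h.idem μ)))

end GrMod

end ExtFinite

/-! ### Ext groups as morphisms in the derived category -/

section ShiftedSingle

open Abelian DerivedCategory Pretriangulated

variable {C : Type*} [Category* C] [Abelian C] [HasExt C] [HasDerivedCategory C]

/-- An object of an abelian category, placed in a single degree of the derived category. -/
abbrev shiftedSingle (X : C) (a : ℤ) : DerivedCategory C :=
  ((singleFunctor C 0).obj X)⟦a⟧

theorem shiftedSingle_shift (X : C) (a : ℤ) :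
    Nonempty ((shiftedSingle X a)⟦(1 : ℤ)⟧ ≅ shiftedSingle X (a + 1)) :=
  ⟨(shiftAdd _ a 1).symm⟩

section Linear

variable (k : Type*) [Field k] [Linear k C]

/-- Extensions as morphisms between shifted objects in the derived category. -/
def extToHom (X Y : C) {a b : ℤ} {n : ℕ} (h : n + a = b) :
    Ext X Y n →ₗ[k] (shiftedSingle X a ⟶ shiftedSingle Y b) :=
  Linear.rightComp k _ ((shiftFunctorAdd' (DerivedCategory C) (n : ℤ) a b h).inv.app _) ∘ₗ
    (shiftFunctor (DerivedCategory C) a).mapLinearMap k ∘ₗ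
      (Ext.homLinearEquiv (R := k)).toLinearMap

theorem extToHom_injective (X Y : C) {a b : ℤ} {n : ℕ} (h : n + a = b) :
    Function.Injective (extToHom k X Y h) := by
  intro x y hxy
  apply Ext.homEquiv.injective
  apply (shiftFunctor (DerivedCategory C) a).map_injective
  rw [← cancel_mono ((shiftFunctorAdd' (DerivedCategory C) (n : ℤ) a b h).inv.app _)]
  exact hxy

theorem extToHom_surjective (X Y : C) {a b : ℤ} {n : ℕ} (h : n + a = b) :
    Function.Surjective (extToHom k X Y h) := by
  intro f
  obtain ⟨g, hg⟩ := (shiftFunctor (DerivedCategory C) a).map_surjective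
    (f ≫ (shiftFunctorAdd' (DerivedCategory C) (n : ℤ) a b h).hom.app _)
  obtain ⟨x, rfl⟩ := (Ext.homEquiv (n := n)).surjective g
  refine ⟨x, ?_⟩
  change (shiftFunctor (DerivedCategory C) a).map (Ext.homEquiv x) ≫
    (shiftFunctorAdd' (DerivedCategory C) (n : ℤ) a b h).inv.app _ = f
  rw [hg, Category.assoc, Iso.hom_inv_id_app, Category.comp_id]

end Linear

theorem shiftedSingle_hom_eq_zero {X Y : C} {a b : ℤ} (h : b < a)
    (f : shiftedSingle X a ⟶ shiftedSingle Y b) : f = 0 := by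
  have h1 := TStructure.t.isLE_shift ((singleFunctor C 0).obj X) 0 a (-a)
  have h2 := TStructure.t.isGE_shift ((singleFunctor C 0).obj Y) 0 b (-b)
  exact TStructure.t.zero_of_isLE_of_isGE f (-a) (-b) (by omega) h1 h2

/-- For `b < a` there are no nonzero morphisms, by the canonical t-structure. Otherwise the morphism
is a shifted Ext class of degree `b - a`. -/
theorem exists_nontrivial_ext {X Y : C} {a b : ℤ}
    {f : shiftedSingle X a ⟶ shiftedSingle Y b} (hf : f ≠ 0) :
    ∃ n : ℕ, n + a = b ∧ Nontrivial (Ext X Y n) := by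
  by_cases h : a ≤ b
  · obtain ⟨n, hn⟩ := Int.eq_ofNat_of_zero_le (sub_nonneg.2 h)
    have hn' : n + a = b := by omega
    refine ⟨n, hn', ?_⟩
    obtain ⟨g, hg⟩ := (shiftFunctor (DerivedCategory C) a).map_surjective
      (f ≫ (shiftFunctorAdd' (DerivedCategory C) (n : ℤ) a b hn').hom.app _)
    have hg0 : g ≠ 0 := by
      rintro rfl
      apply hf
      rw [← cancel_mono ((shiftFunctorAdd' (DerivedCategory C) (n : ℤ) a b hn').hom.app _), ← hg,
        Functor.map_zero, zero_comp]
    obtain ⟨x, rfl⟩ := (Ext.homEquiv (n := n)).surjective g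
    refine ⟨x, 0, fun h0 => hg0 ?_⟩
    rw [h0]
    exact Ext.zero_hom _ _ _
  · exact absurd (shiftedSingle_hom_eq_zero (by omega) f) hf

section Generation

variable {Z : DerivedCategory C}

theorem shiftedSingle_orthogonal_of_isZero {X : C} (hX : IsZero X) (a : ℤ)
    (f : shiftedSingle X a ⟶ Z) : f = 0 :=
  ((shiftFunctor (DerivedCategory C) a).map_isZero
    ((singleFunctor C 0).map_isZero hX)).eq_of_src _ _

variable {S : ShortComplex C} (hS : S.ShortExact)
include hS

theorem shiftedSingle_orthogonal_middle
    (h1 : ∀ (a : ℤ) (f : shiftedSingle S.X₁ a ⟶ Z), f = 0)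
    (h3 : ∀ (a : ℤ) (f : shiftedSingle S.X₃ a ⟶ Z), f = 0) (a : ℤ)
    (f : shiftedSingle S.X₂ a ⟶ Z) : f = 0 := by
  obtain ⟨g, hg⟩ := Triangle.yoneda_exact₂ _
    (Triangle.shift_distinguished _ hS.singleTriangle_distinguished a) f (h1 a _)
  exact hg.trans ((congrArg (fun q => _ ≫ q) (h3 a g)).trans comp_zero)

/-- The connecting term of the triangle is `X₁[a + 1]`, which is why the hypotheses range over all
shifts. -/
theorem shiftedSingle_orthogonal_right
    (h1 : ∀ (a : ℤ) (f : shiftedSingle S.X₁ a ⟶ Z), f = 0)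
    (h2 : ∀ (a : ℤ) (f : shiftedSingle S.X₂ a ⟶ Z), f = 0) (a : ℤ)
    (f : shiftedSingle S.X₃ a ⟶ Z) : f = 0 := by
  obtain ⟨g, hg⟩ := Triangle.yoneda_exact₃ _
    (Triangle.shift_distinguished _ hS.singleTriangle_distinguished a) f (h2 a _)
  obtain ⟨φ⟩ := shiftedSingle_shift S.X₁ a
  exact hg.trans ((congrArg (fun q => _ ≫ q) (eq_zero_of_iso_left φ (h1 (a + 1)) g)).trans
    comp_zero)

end Generation

end ShiftedSingle

/-! ### Standard modules as an exceptional family; linearity of Ext -/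

section ExceptionalStandard

open Abelian

variable {k B : Type u} [Field k] [Ring B] [Algebra k B] {𝒜 : ℕ → Submodule k B}
  [GradedAlgebra 𝒜] [Module.Finite k B] {Λ : Type v} [PartialOrder Λ] [Finite Λ] {e : Λ → 𝒜 0}
  {L : Λ → FDMod k (𝒜 0)}
  (h : IsIdempotentSystem (fun l => ((L l).inflate : FDMod k B)) (fun l => (e l : B)))
  (hq : IsQuasiHereditary (fun l => ((L l).inflate : FDMod k B)))

namespace GrMod

theorem finrank_quot_lt (M : GrMod 𝒜) {N : Submodule B M} (hN : M.IsHomogeneous N) {y : M}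
    (hy : y ∈ N) (hy0 : y ≠ 0) : Module.finrank k (M.quot N hN) < Module.finrank k M := by
  let q : M →ₗ[k] M.quot N hN := N.mkQ.restrictScalars k
  have h1 := q.finrank_range_add_finrank_ker
  have h2 : LinearMap.range q = ⊤ := LinearMap.range_eq_top.2 (Submodule.mkQ_surjective N)
  rw [h2, finrank_top] at h1
  have h3 : Nontrivial (LinearMap.ker q) :=
    ⟨⟨y, (Submodule.Quotient.mk_eq_zero N).2 hy⟩, 0, fun h0 => hy0 (congrArg Subtype.val h0)⟩
  have h4 : 0 < Module.finrank k (LinearMap.ker q) := Module.finrank_pos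
  omega

include h hq

/-- Induction on a lower set `S` containing the labels that occur in `M`, then on the dimension of
`M`. For `ν` maximal in `S`, a nonzero homogeneous `y = e ν • y` generates a quotient of a shifted
`Δ(ν)`. The kernel of this quotient map has no factor `L ν`, so it falls under a smaller `S`, and `M
/ B y` has smaller dimension. Two short exact sequences assemble `M`. -/
theorem standard_generates {𝒬 : GrMod 𝒜 → Prop} (hzero : ∀ X, IsZero X → 𝒬 X)
    (hext : ∀ S : ShortComplex (GrMod 𝒜), S.ShortExact → 𝒬 S.X₁ → 𝒬 S.X₃ → 𝒬 S.X₂)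
    (hright : ∀ S : ShortComplex (GrMod 𝒜), S.ShortExact → 𝒬 S.X₁ → 𝒬 S.X₂ → 𝒬 S.X₃)
    (hst : ∀ m, ∀ s : ℤ, 𝒬 ((standard e m).shift s)) (M : GrMod 𝒜) : 𝒬 M := by
  classical
  suffices H : ∀ (n : ℕ) (S : Finset Λ), S.card = n → IsLowerSet (S : Set Λ) →
      ∀ (d : ℕ) (M : GrMod 𝒜), Module.finrank k M ≤ d →
      (∀ m ∉ S, ∀ x : M, (e m : B) • x = 0) → 𝒬 M by
    have := Fintype.ofFinite Λ
    exact H _ Finset.univ rfl (by simp [IsLowerSet]) _ M le_rfl (by simp)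
  intro n
  induction n with
  | zero =>
    intro S hS _ _ M _ hM
    obtain rfl := Finset.card_eq_zero.1 hS
    exact hzero _ (isZero_of_forall (h.eq_zero_of_forall fun l x => hM l (by simp) x))
  | succ n ih =>
    intro S hS hlow d
    obtain ⟨ν, hν⟩ := S.exists_maximal (Finset.card_pos.1 (by omega))
    have hlow' : IsLowerSet ((S.erase ν : Finset Λ) : Set Λ) := by
      intro a b hba ha
      simp only [Finset.coe_erase, Set.mem_sdiff, Finset.mem_coe, Set.mem_singleton_iff] at ha ⊢
      refine ⟨hlow hba ha.1, ?_⟩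
      rintro rfl
      exact ha.2 (le_antisymm (hν.2 ha.1 hba) hba)
    have hcard : (S.erase ν).card = n := by rw [Finset.card_erase_of_mem hν.1, hS]; rfl
    induction d with
    | zero =>
      intro M hM _
      have := Module.finrank_zero_iff.1 (Nat.le_zero.1 hM)
      exact hzero _ (isZero_of_forall fun x => Subsingleton.elim _ _)
    | succ d ihd =>
      intro M hd hM
      by_cases hall : ∀ x : M, (e ν : B) • x = 0
      · refine ih _ hcard hlow' _ M le_rfl fun m hm => ?_
        by_cases hmν : m = ν
        · exact hmν ▸ hall
        · exact hM m fun hmS => hm (Finset.mem_erase.2 ⟨hmν, hmS⟩)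
      · push Not at hall
        obtain ⟨x, hx⟩ := hall
        obtain ⟨i, hi⟩ : ∃ i, (e ν : B) • M.comp i x ≠ 0 := by
          by_contra! hcon
          obtain ⟨t, ht⟩ := M.exists_sum_comp x
          apply hx
          rw [← ht, Finset.smul_sum]
          exact Finset.sum_eq_zero fun i _ => hcon i
        let y := (e ν : B) • M.comp i x
        have hydeg : y ∈ M.deg i := by
          have := M.smul_mem (e ν).2 (M.comp_mem i x)
          rwa [Nat.cast_zero, zero_add] at this
        have hey : (e ν : B) • y = y := by rw [← mul_smul, h.idem ν]
        have htr : idempotentTrace (fun l => (e l : B)) (Set.Ioi ν) M = ⊥ := by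
          rw [eq_bot_iff]
          refine Submodule.span_le.2 ?_
          rintro _ ⟨m, hm, z, rfl⟩
          exact hM m (fun hmS => not_le_of_gt hm (hν.2 hmS (le_of_lt hm))) z
        have hIy : ∀ a ∈ standardIdeal (fun l => (e l : B)) ν, a • y = 0 := by
          intro a ha
          have := h.smul_mem_trace_of_mem_standardIdeal hq hey (subset_refl (Set.Ioi ν)) ha
          rwa [htr, Submodule.mem_bot] at this
        let N := Submodule.span B {y}
        have hN : M.IsHomogeneous N := M.isHomogeneous_span_singleton hydeg
        let y' : M.sub N hN := ⟨y, Submodule.mem_span_singleton_self y⟩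
        let f : (standard e ν).shift i ⟶ M.sub N hN :=
          standardHom ν (x := y') hydeg fun a ha => Subtype.ext (hIy a ha)
        have hf : ∀ b : B, f.lin (b • standardGen e ν) = b • y' := standardHom_smul_gen _ _
        have hfs : Function.Surjective f.lin := by
          rintro ⟨z, hz⟩
          obtain ⟨b, rfl⟩ := Submodule.mem_span_singleton.1 hz
          exact ⟨b • standardGen e ν, hf b⟩
        have hS1 := shortExact_of (kerι f) f (kerι_comp f) Subtype.val_injective hfs
          fun x hx => ⟨⟨x, hx⟩, rfl⟩
        let ι : M.sub N hN ⟶ M := ⟨N.subtype, fun hx => hx⟩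
        let π : M ⟶ M.quot N hN := ⟨N.mkQ, fun {_ x} hx => ⟨x, hx, rfl⟩⟩
        have hιπ : ι ≫ π = 0 := by
          ext x
          exact (Submodule.Quotient.mk_eq_zero N).2 x.2
        have hS2 := shortExact_of ι π hιπ Subtype.val_injective (Submodule.mkQ_surjective N)
          fun x hx => ⟨⟨x, (Submodule.Quotient.mk_eq_zero N).1 hx⟩, rfl⟩
        refine hext _ hS2 (hright _ hS1 ?_ (hst ν i)) (ihd _ ?_ ?_)
        · refine ih _ hcard hlow' _ (ker f) le_rfl fun m hm x => Subtype.ext ?_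
          change (e m : B) • (show standard e ν from x.1) = 0
          by_cases hmν : m = ν
          · subst hmν
            -- The space `e m • Δ(m)` is the line of the generator, and the generator maps to `y ≠
            -- 0`. So this line meets the kernel of `f` trivially.
            obtain ⟨c, hc⟩ := idem_smul_standard_line h hq m (show standard e m from x.1)
            have h1 : f.lin (show standard e m from x.1) = 0 := x.2
            have h2 : f.lin ((e m : B) • (show standard e m from x.1)) = 0 :=
              (map_smul f.lin (e m : B) (show standard e m from x.1)).trans
                ((congrArg ((e m : B) • ·) h1).trans (smul_zero _))
            have h3 : f.lin (c • standardGen e m) = c • y' := by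
              rw [← algebraMap_smul B c (standardGen e m), hf, algebraMap_smul]
            rw [hc] at h2
            have h4 : c • y = 0 := congrArg Subtype.val (h3.symm.trans h2)
            rcases smul_eq_zero.1 h4 with h5 | h5
            · rw [hc, h5, zero_smul]
            · exact absurd h5 hi
          · exact idem_smul_standard (fun hle => hm (Finset.mem_erase.2 ⟨hmν, hlow hle hν.1⟩)) _
        · have := M.finrank_quot_lt hN (Submodule.mem_span_singleton_self y) hi
          exact Nat.le_of_lt_succ (this.trans_le hd)
        · intro m hm z
          obtain ⟨z, rfl⟩ := Submodule.mkQ_surjective N z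
          change (e m : B) • N.mkQ z = 0
          rw [← map_smul, hM m hm, map_zero]

variable [HasDerivedCategory (GrMod 𝒜)]

theorem homFinite_standard (M : GrMod 𝒜) (b : ℤ) :
    HomFinite k (fun (ν : Λ) (t : ℤ × ℤ) => shiftedSingle ((standard e ν).shift t.1) t.2)
      (shiftedSingle M b) where
  finite ν t := by
    by_cases ht : t.2 ≤ b
    · obtain ⟨n, hn⟩ := Int.eq_ofNat_of_zero_le (sub_nonneg.2 ht)
      have := (extFinite_standard M h hq ν).1 t.1 n
      exact Module.Finite.of_surjective
        (extToHom k ((standard e ν).shift t.1) M (show n + t.2 = b by omega))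
        (extToHom_surjective k _ _ _)
    · have : Subsingleton (shiftedSingle ((standard e ν).shift t.1) t.2 ⟶ shiftedSingle M b) :=
        subsingleton_of_forall_eq 0 fun f => shiftedSingle_hom_eq_zero (by omega) f
      infer_instance
  support ν := by
    refine ((extFinite_standard M h hq ν).2.image fun p => (p.1, b - p.2)).subset ?_
    rintro ⟨s, a⟩ ⟨f, hf⟩
    obtain ⟨n, hn, hne⟩ := exists_nontrivial_ext hf
    exact ⟨(s, n), hne, Prod.ext rfl (by dsimp only at hn ⊢; omega)⟩

theorem isGeneratedBy_standard (M : GrMod 𝒜) (b : ℤ) :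
    IsGeneratedBy (fun (ν : Λ) (t : ℤ × ℤ) => shiftedSingle ((standard e ν).shift t.1) t.2)
      (shiftedSingle M b) := by
  intro Z hZ
  exact standard_generates h hq (𝒬 := fun X => ∀ (a : ℤ) (f : shiftedSingle X a ⟶ Z), f = 0)
    (fun X hX => shiftedSingle_orthogonal_of_isZero hX)
    (fun S hS => shiftedSingle_orthogonal_middle hS)
    (fun S hS => shiftedSingle_orthogonal_right hS) (fun m s a => hZ m (s, a)) M b

/-- An index `t = (s, a)` records the grading shift and the cohomological shift. Suspension changes
only the second entry. -/
theorem isExceptionalPair :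
    IsExceptionalPair k ((Equiv.refl ℤ).prodCongr (Equiv.addRight 1))
      (fun (ν : Λ) (t : ℤ × ℤ) => shiftedSingle ((standard e ν).shift t.1) t.2)
      (fun (ν : Λ) (t : ℤ × ℤ) => shiftedSingle ((costandard e ν).shift t.1) t.2) where
  shift_d ν t := shiftedSingle_shift _ t.2
  shift_c ν t := shiftedSingle_shift _ t.2
  hom_dd μ ν t u f hf := by
    obtain ⟨n, hn, hne⟩ := exists_nontrivial_ext hf
    refine (ext_standard_standard h hq hne).imp id ?_
    rintro ⟨h1, h2, rfl⟩
    exact ⟨h1, Prod.ext h2 (by simpa using hn)⟩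
  end_d ν t f := by
    obtain ⟨g, rfl⟩ := (shiftFunctor (DerivedCategory (GrMod 𝒜)) t.2).map_surjective f
    obtain ⟨g, rfl⟩ := (DerivedCategory.singleFunctor (GrMod 𝒜) 0).map_surjective g
    obtain ⟨c, hc⟩ := (standard_hom_eq_smul h hq g).2
    have hg : g = c • 𝟙 _ := by
      ext x
      exact hc x
    refine ⟨c, ?_⟩
    rw [hg, Functor.map_smul, Functor.map_smul, CategoryTheory.Functor.map_id,
      CategoryTheory.Functor.map_id]
  hom_dc μ ν t u f hf := by
    obtain ⟨n, hn, hne⟩ := exists_nontrivial_ext hf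
    obtain ⟨h1, h2, rfl⟩ := ext_standard_costandard h hq hne
    exact ⟨h1, Prod.ext h2 (by simpa using hn)⟩
  exists_dc ν t := by
    obtain ⟨f, hf⟩ := exists_standard_hom_costandard h hq ν t.1
    refine ⟨(shiftFunctor (DerivedCategory (GrMod 𝒜)) t.2).map
      ((DerivedCategory.singleFunctor (GrMod 𝒜) 0).map f), fun h0 => hf ?_⟩
    apply (DerivedCategory.singleFunctor (GrMod 𝒜) 0).map_injective
    apply (shiftFunctor (DerivedCategory (GrMod 𝒜)) t.2).map_injective
    rw [h0, Functor.map_zero, Functor.map_zero]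
  finite ν t := homFinite_standard h hq _ _

omit [HasDerivedCategory (GrMod 𝒜)] in
-- Linearity of `X` against the costandard modules means that `X` is built from the objects
-- `Δ(ν)⟨s⟩[s]` on the diagonal. Linearity of `Y` means that these have no maps to `Y⟨r⟩[n]` unless
-- `n = r`.
theorem ext_eq_of_linear {X Y : GrMod 𝒜}
    (hX : ∀ (ν : Λ) (n : ℕ) (r : ℤ), Nontrivial (Ext X ((costandard e ν).shift r) n) → (n : ℤ) = r)
    (hY : ∀ (ν : Λ) (n : ℕ) (r : ℤ), Nontrivial (Ext (standard e ν) (Y.shift r) n) → (n : ℤ) = r)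
    (n : ℕ) (r : ℤ) (hne : Nontrivial (Ext X (Y.shift r) n)) : (n : ℤ) = r := by
  let : HasDerivedCategory (GrMod 𝒜) := HasDerivedCategory.standard _
  by_contra hnr
  obtain ⟨x, hx⟩ := exists_ne (0 : Ext X (Y.shift r) n)
  have hx' : extToHom k X (Y.shift r) (show n + (0 : ℤ) = n by omega) x ≠ 0 := fun h0 =>
    hx (extToHom_injective k _ _ _ (h0.trans (map_zero _).symm))
  refine hx' ((isExceptionalPair h hq).hom_eq_zero (homFinite_standard h hq X 0)
    (isGeneratedBy_standard h hq X 0) {t | t.1 = t.2} ?_ ?_ _)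
  · intro ν t f hf
    obtain ⟨m, hm, hne⟩ := exists_nontrivial_ext hf
    have := hX ν m t.1 hne
    change t.1 = t.2
    omega
  · intro ν t ht f
    by_contra hf
    obtain ⟨m, hm, hne⟩ := exists_nontrivial_ext hf
    have ht' : t.1 = t.2 := ht
    -- Undoing the grading shift `s = t.1` on both sides turns `hY` into `m = r - s`, while the
    -- cohomological degrees give `m = n - s`.
    have h1 : Nontrivial (Ext (standard e ν) (Y.shift (r - t.1)) m) := by
      by_contra hcon
      obtain ⟨φ⟩ := Y.shift_shift_iso (sub_add_cancel r t.1)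
      exact not_nontrivial_iff_subsingleton.2 (Ext.subsingleton_of_iso (Iso.refl _) φ.symm
        (subsingleton_ext_shift t.1 (not_nontrivial_iff_subsingleton.1 hcon))) hne
    have := hY ν m _ h1
    omega

end GrMod

end ExceptionalStandard

/-! ### The degree 0 part is quasi-hereditary -/

section ZeroPart

theorem LinearEquiv.nonempty_of_surjective {A P X Y : Type*} [Ring A] [AddCommGroup P] [Module A P]
    [AddCommGroup X] [Module A X] [AddCommGroup Y] [Module A Y] (f : P →ₗ[A] X) (g : P →ₗ[A] Y)
    (hf : Function.Surjective f) (hg : Function.Surjective g) (hfg : ∀ p, f p = 0 ↔ g p = 0) :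
    Nonempty (X ≃ₗ[A] Y) := by
  have h : LinearMap.ker f = LinearMap.ker g := by
    ext p
    exact hfg p
  exact ⟨(f.quotKerEquivOfSurjective hf).symm.trans
    ((Submodule.quotEquivOfEq _ _ h).trans (g.quotKerEquivOfSurjective hg))⟩

variable {k B : Type u} [Field k] [Ring B] [Algebra k B] {𝒜 : ℕ → Submodule k B}
  [GradedAlgebra 𝒜] {Λ : Type v} [PartialOrder Λ] {e : Λ → 𝒜 0} {L : Λ → FDMod k (𝒜 0)}

namespace GrMod

/-- The part of degree `0` of a submodule. -/
def zeroSub (M : GrMod 𝒜) (N : Submodule B M) : Submodule (𝒜 0) M.zeroPart where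
  carrier := {x | (show M.deg 0 from x).1 ∈ N}
  add_mem' := fun hx hy => N.add_mem hx hy
  zero_mem' := N.zero_mem
  smul_mem' := fun a _ hx => N.smul_mem (a : B) hx

theorem mem_zeroSub {M : GrMod 𝒜} {N : Submodule B M} {x : M.zeroPart} :
    x ∈ M.zeroSub N ↔ (show M.deg 0 from x).1 ∈ N := Iff.rfl

variable [Module.Finite k B]

variable (e) in
/-- The degree `0` part of the projection from `B` to a standard module. -/
def standardZeroProj (l : Λ) : 𝒜 0 →ₗ[𝒜 0] (standard e l).zeroPart :=
  LinearMap.toSpanSingleton (𝒜 0) (standard e l).zeroPart ⟨standardGen e l, standardGen_mem l⟩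

theorem standardZeroProj_surjective (l : Λ) : Function.Surjective (standardZeroProj e l) := by
  intro y
  obtain ⟨b, hb, hby⟩ := exists_mem_deg_smul_standardGen l y.2
  exact ⟨⟨b, mem_regular_deg_zero.1 hb⟩, Subtype.ext hby⟩

theorem standardZeroProj_eq_zero (l : Λ) (a : 𝒜 0) :
    standardZeroProj e l a = 0 ↔ (a : B) ∈ standardIdeal (fun l => (e l : B)) l := by
  rw [← smul_standardGen_eq_zero]
  exact Subtype.ext_iff

/-- Taking degree 0 parts is exact. A section generated in degree 0 contributes the degree 0 part of
a standard module, and a section generated in another degree contributes nothing and is dropped from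
the list. -/
theorem Filtered.exists_zeroPart_filtration {M : GrMod 𝒜} (hM : ∀ i < 0, M.deg i = ⊥) {W : Set Λ}
    {N : Submodule B M} (hN : M.Filtered (fun l => (e l : B)) W N) :
    ∃ (n : ℕ) (F : ℕ → Submodule (𝒜 0) M.zeroPart), Antitone F ∧ F 0 = M.zeroSub N ∧ F n = ⊥ ∧
      ∀ i < n, ∃ m ∈ W, Nonempty ((F i ⧸ (F (i + 1)).submoduleOf (F i)) ≃ₗ[𝒜 0]
        (standard e m).zeroPart) := by
  induction hN with
  | bot =>
    refine ⟨0, fun _ => ⊥, antitone_const, ?_, rfl, fun i hi => absurd hi (Nat.not_lt_zero i)⟩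
    rw [eq_comm, eq_bot_iff]
    intro x hx
    exact Subtype.ext ((Submodule.mem_bot B).1 hx)
  | @step N x s m hN hx hm hex hz ih =>
    obtain ⟨n, F, hF, hF0, hFn, hsec⟩ := ih
    by_cases hs : s = 0
    · subst hs
      have hle : M.zeroSub N ≤ M.zeroSub (N ⊔ Submodule.span B {x}) := fun y hy =>
        mem_zeroSub.2 (Submodule.mem_sup_left hy)
      refine ⟨n + 1, fun i => Nat.casesOn i (M.zeroSub (N ⊔ Submodule.span B {x})) F, ?_, rfl,
        hFn, fun i hi => ?_⟩
      · refine antitone_nat_of_succ_le fun i => ?_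
        cases i with
        | zero => exact hF0.le.trans hle
        | succ i => exact hF (Nat.le_succ i)
      · cases i with
        | zero =>
          refine ⟨m, hm, ?_⟩
          let x' : M.zeroSub (N ⊔ Submodule.span B {x}) :=
            ⟨⟨x, hx⟩, Submodule.mem_sup_right (Submodule.mem_span_singleton_self x)⟩
          let f : 𝒜 0 →ₗ[𝒜 0] (M.zeroSub (N ⊔ Submodule.span B {x}) ⧸
              (F 0).submoduleOf (M.zeroSub (N ⊔ Submodule.span B {x}))) :=
            Submodule.mkQ _ ∘ₗ LinearMap.toSpanSingleton (𝒜 0) _ x'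
          refine LinearEquiv.nonempty_of_surjective f (standardZeroProj e m) ?_
            (standardZeroProj_surjective m) fun a => ?_
          · intro y
            obtain ⟨⟨⟨y, hy0⟩, hy⟩, rfl⟩ := Submodule.mkQ_surjective _ y
            obtain ⟨z, hz, w, hw, hzw⟩ := Submodule.mem_sup.1 (mem_zeroSub.1 hy)
            obtain ⟨b, rfl⟩ := Submodule.mem_span_singleton.1 hw
            let b0 : 𝒜 0 := GradedRing.projZeroRingHom' 𝒜 b
            -- The vector `x` has degree 0, so only the degree 0 component of `b` contributes to the
            -- degree 0 component of `b • x`.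
            have hb0 : M.comp 0 (b • x) = (b0 : B) • x := by
              classical
              have h1 : ∀ n : ℕ, M.comp 0 ((DirectSum.decompose 𝒜 b n : B) • x) =
                  if n = 0 then (b0 : B) • x else 0 := by
                intro n
                have h2 := M.smul_mem (SetLike.coe_mem (DirectSum.decompose 𝒜 b n)) hx
                split_ifs with hn
                · subst hn
                  rw [Nat.cast_zero, zero_add] at h2
                  rw [comp_of_mem _ h2]
                  rfl
                · exact comp_of_mem_ne _ h2 (by omega)
              nth_rw 1 [← DirectSum.sum_support_decompose 𝒜 b]
              rw [Finset.sum_smul, map_sum, Finset.sum_congr rfl fun n _ => h1 n,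
                Finset.sum_ite_eq']
              split_ifs with h3
              · rfl
              · have : (b0 : B) = 0 := by
                  simpa [b0] using h3
                rw [this, zero_smul]
            refine ⟨b0, ?_⟩
            rw [← sub_eq_zero]
            change Submodule.mkQ _ (b0 • x') - Submodule.mkQ _ _ = 0
            rw [← map_sub]
            refine (Submodule.Quotient.mk_eq_zero _).2 ?_
            change (b0 • x' - ⟨⟨y, hy0⟩, hy⟩ : M.zeroSub (N ⊔ Submodule.span B {x})).1 ∈ F 0
            rw [hF0, mem_zeroSub]
            change (b0 : B) • x - y ∈ N
            have h4 : M.comp 0 z + (b0 : B) • x = y := by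
              rw [← hb0, ← map_add]
              exact (congrArg (M.comp 0) hzw).trans (M.comp_of_mem hy0)
            rw [← h4, sub_add_cancel_right]
            exact N.neg_mem (hN.isHomogeneous z hz 0)
          · rw [standardZeroProj_eq_zero, ← hz]
            refine (Submodule.Quotient.mk_eq_zero _).trans ?_
            change (a • x' : M.zeroSub (N ⊔ Submodule.span B {x})).1 ∈ F 0 ↔ _
            rw [hF0]
            exact Iff.rfl
        | succ i => exact hsec i (by omega)
    · have heq : M.zeroSub (N ⊔ Submodule.span B {x}) = M.zeroSub N := by
        apply le_antisymm
        · intro y hy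
          obtain ⟨z, hz, w, hw, hzw⟩ := Submodule.mem_sup.1 (mem_zeroSub.1 hy)
          obtain ⟨b, rfl⟩ := Submodule.mem_span_singleton.1 hw
          -- If `s < 0` then `x = 0`, as `M` has no negative degrees. If `s > 0` then `B x` lies in
          -- positive degrees.
          have hb0 : M.comp 0 (b • x) = 0 := by
            classical
            by_cases hs0 : s < 0
            · rw [hM s hs0, Submodule.mem_bot] at hx
              rw [hx, smul_zero, map_zero]
            · rw [← DirectSum.sum_support_decompose 𝒜 b, Finset.sum_smul, map_sum]
              refine Finset.sum_eq_zero fun n _ => ?_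
              exact comp_of_mem_ne _ (M.smul_mem (SetLike.coe_mem _) hx) (by omega)
          have h4 : M.comp 0 z = (show M.deg 0 from y).1 := by
            rw [← add_zero (M.comp 0 z), ← hb0, ← map_add]
            exact (congrArg (M.comp 0) hzw).trans (M.comp_of_mem y.2)
          rw [mem_zeroSub, ← h4]
          exact hN.isHomogeneous z hz 0
        · exact fun y hy => mem_zeroSub.2 (Submodule.mem_sup_left hy)
      exact ⟨n, F, hF, hF0.trans heq.symm, hFn, hsec⟩

variable [Finite Λ] (h : IsIdempotentSystem (fun l => ((L l).inflate : FDMod k B)) (fun l => (e l : B)))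
  (h0 : IsIdempotentSystem L e)
  (hq : IsQuasiHereditary (fun l => ((L l).inflate : FDMod k B)))

/-- The degree `0` part of the projection to a standard module. -/
def standardπZero (l : Λ) : (principal (e l)).zeroPart →ₗ[𝒜 0] (standard e l).zeroPart where
  toFun x := ⟨(standardπ e l).lin x.1, (standardπ e l).map_mem x.2⟩
  map_add' x y := Subtype.ext (map_add (standardπ e l).lin x.1 y.1)
  map_smul' a x := Subtype.ext (map_smul (standardπ e l).lin (a : B) x.1)

/-- The generator of `B a` as an element of degree `0`. -/
def principalZeroGen (a : 𝒜 0) : (principal a).zeroPart := ⟨principalGen a, principalGen_mem a⟩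

theorem exists_smul_principalGen_zero {a : 𝒜 0} (ha : a * a = a) (x : (principal a).zeroPart) :
    ∃ b : 𝒜 0, b • principalZeroGen a = x := by
  refine ⟨⟨x.1.1, mem_regular_deg_zero.1 x.2⟩, Subtype.ext ?_⟩
  exact smul_principalGen ha x.1

/-- The degree 0 part of `B a` is the left ideal of `𝒜 0` generated by the idempotent `a`, a direct
summand. -/
theorem projective_principal_zeroPart {a : 𝒜 0} (ha : a * a = a) :
    Module.Projective (𝒜 0) (principal a).zeroPart := by
  let i : (principal a).zeroPart →ₗ[𝒜 0] 𝒜 0 :=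
    { toFun := fun x => ⟨x.1.1, mem_regular_deg_zero.1 x.2⟩
      map_add' := fun _ _ => rfl
      map_smul' := fun _ _ => rfl }
  let s : 𝒜 0 →ₗ[𝒜 0] (principal a).zeroPart :=
    LinearMap.toSpanSingleton (𝒜 0) _ (principalZeroGen a)
  refine Module.Projective.of_split i s (LinearMap.ext fun x => Subtype.ext ?_)
  exact smul_principalGen ha x.1

theorem standardπZero_surjective (l : Λ) :
    Function.Surjective (standardπZero (e := e) l) := by
  intro y
  obtain ⟨b, hb⟩ := standardZeroProj_surjective l y
  exact ⟨b • principalZeroGen (e l), hb⟩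

include h h0 hq

/-- The projective cover of `L l` over `𝒜 0` is the degree 0 part of `B e_l`, with the degree 0 part
of the graded standard filtration. That `L l` occurs once in `Δ(l)_0` is inherited from `Δ(l)`. -/
theorem isQuasiHereditary_zeroPart : IsQuasiHereditary L := by
  have hidem := h0.idem
  have hst := fun l => isStandard_zeroPart h0 l
  refine ⟨h0.indexing, fun l => (standard e l).zeroPart, hst, fun l => ?_, fun l => ?_⟩
  · obtain ⟨p, hp, -⟩ := (hst l).cover
    refine ⟨p, hp, fun m hm => ?_⟩
    have : Module.Finite k (LinearMap.ker p) :=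
      Module.Finite.of_injective ((LinearMap.ker p).subtype.restrictScalars k)
        Subtype.val_injective
    obtain ⟨x, hx⟩ := (h0.isCompositionFactor_iff m).1 hm
    have hx' : e m • x.1 ≠ 0 := fun h => hx (Subtype.ext h)
    refine lt_of_le_of_ne (by_contra fun hml => hx' (Subtype.ext (idem_smul_standard hml _))) ?_
    rintro rfl
    let g : (standard e m).zeroPart := ⟨standardGen e m, standardGen_mem m⟩
    obtain ⟨c, hc⟩ := idem_smul_standard_line h hq m x.1.1
    have h1 : e m • x.1 = c • g := Subtype.ext hc
    have h2 : c • p g = 0 := by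
      have h3 : p (c • g) = 0 := by rw [← h1, map_smul, x.2, smul_zero]
      rwa [← algebraMap_smul (𝒜 0) c g, map_smul, algebraMap_smul] at h3
    rcases smul_eq_zero.1 h2 with h3 | h3
    · exact hx' (by rw [h1, h3, zero_smul])
    · obtain ⟨v, hv, hv0, -⟩ := h0.line m
      obtain ⟨y, rfl⟩ := hp v
      obtain ⟨a, rfl⟩ := standardZeroProj_surjective m y
      apply hv0
      change p (a • g) = 0
      rw [map_smul, h3, smul_zero]
  · obtain ⟨p, hp, -⟩ := (hst l).cover
    have hpπ : Function.Surjective (p ∘ₗ standardπZero l) := hp.comp (standardπZero_surjective l)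
    refine ⟨(principal (e l)).zeroPart, projective_principal_zeroPart (hidem l),
      ⟨p ∘ₗ standardπZero l, hpπ, ?_⟩, ?_⟩
    · refine h0.cover_of_generator (M := (principal (e l)).zeroPart) (l := l)
        (x := principalZeroGen (e l))
        (Subtype.ext (smul_principalGen (hidem l) (principalGen (e l))))
        (exists_smul_principalGen_zero (hidem l)) _ hpπ
    · have := Fintype.ofFinite Λ
      have hneg : ∀ i < 0, (principal (e l)).deg i = ⊥ := by
        intro i hi
        rw [eq_bot_iff]
        intro x hx
        exact Subtype.ext (eq_zero_of_mem_regular_deg hi hx)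
      obtain ⟨n, F, hF, hF0, hFn, hsec⟩ :=
        (filtered_trace h hq l).exists_zeroPart_filtration hneg
      -- The chain `F` starts at the kernel of the projection to `Δ(l)_0`. Prepending the whole
      -- module adds the top section `Δ(l)_0` and raises indices by one.
      refine ⟨n, fun i => Nat.casesOn i ⊤ F, ?_, rfl, hFn, ?_, fun i hi1 hi2 => ?_⟩
      · refine antitone_nat_of_succ_le fun i => ?_
        cases i with
        | zero => exact le_top
        | succ i => exact hF (Nat.le_succ i)
      · refine LinearEquiv.nonempty_of_surjective
          (((F 0).submoduleOf ⊤).mkQ ∘ₗ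
            (Submodule.topEquiv (R := 𝒜 0) (M := (principal (e l)).zeroPart)).symm.toLinearMap)
          (standardπZero l)
          ((Submodule.mkQ_surjective _).comp (LinearEquiv.surjective _))
          (standardπZero_surjective l) fun x => ?_
        refine (Submodule.Quotient.mk_eq_zero _).trans ?_
        change x ∈ F 0 ↔ _
        rw [hF0, mem_zeroSub]
        refine Iff.trans ?_ (Subtype.ext_iff (a1 := standardπZero l x) (a2 := 0)).symm
        refine Iff.trans ?_ (standardKer_exact h hq l x.1).symm
        exact ⟨fun hx => ⟨⟨x.1, hx⟩, rfl⟩, fun ⟨y, hy⟩ => hy ▸ y.2⟩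
      · obtain ⟨j, rfl⟩ := Nat.exists_eq_add_of_le' hi1
        obtain ⟨m, hm, hφ⟩ := hsec j (by omega)
        exact ⟨m, hm, hφ⟩

end GrMod

omit [PartialOrder Λ] in
theorem FDMod.nonempty_toGrMod_iso {X Y : FDMod k (𝒜 0)} (φ : X ≃ₗ[𝒜 0] Y) :
    Nonempty (X.toGrMod ≅ Y.toGrMod) := by
  refine GrMod.nonempty_iso_of_bijective ⟨FDMod.inflateMap φ.toLinearMap, fun {i x} hx => ?_⟩
    φ.bijective
  change _ ∈ (if i = 0 then (⊤ : Submodule k Y) else ⊥)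
  change x ∈ (if i = 0 then (⊤ : Submodule k X) else ⊥) at hx
  split_ifs at hx ⊢ with hi
  · trivial
  · exact (Submodule.mem_bot k).2 ((congrArg φ ((Submodule.mem_bot k).1 hx)).trans (map_zero φ))

end ZeroPart
end

/-! ### The main theorem -/

theorem mainTheorem4 {k B : Type u} [Field k] [IsAlgClosed k] [Ring B] [Algebra k B]
    [Module.Finite k B] (𝒜 : ℕ → Submodule k B) [GradedAlgebra 𝒜]
    {Λ : Type v} [PartialOrder Λ] [Finite Λ] (L : Λ → FDMod k (𝒜 0))
    (hB : IsStandardQKoszul 𝒜 L) :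
    (∀ (l m : Λ) (D N : GrMod 𝒜), IsGradedStandard L l D → IsGradedCostandard L m N →
      ∀ (n : ℕ) (r : ℤ),
        Nontrivial (CategoryTheory.Abelian.Ext D.zeroPart.toGrMod
          (N.zeroPart.toGrMod.shift r) n) → (n : ℤ) = r) ∧
    IsQKoszul 𝒜 L := by
  obtain ⟨e, h, h0⟩ := exists_idempotentSystem hB.quasiHereditary
  have hS := fun l => GrMod.isGradedStandard_standard h l
  have hN := fun l => GrMod.isGradedCostandard_costandard h l
  have part1 : ∀ (l m : Λ) (D N : GrMod 𝒜), IsGradedStandard L l D → IsGradedCostandard L m N →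
      ∀ (n : ℕ) (r : ℤ),
        Nontrivial (CategoryTheory.Abelian.Ext D.zeroPart.toGrMod
          (N.zeroPart.toGrMod.shift r) n) → (n : ℤ) = r := fun l m D N hD hN' =>
    GrMod.ext_eq_of_linear h hB.quasiHereditary
      (fun ν => hB.ext_costandard ν l D _ hD (hN ν))
      (fun ν => hB.ext_standard ν m _ N (hS ν) hN')
  refine ⟨part1, GrMod.isQuasiHereditary_zeroPart h h0 hB.quasiHereditary,
    fun l m X Y hX hY n r hne => ?_⟩
  -- Arbitrary standard and costandard modules of `𝒜 0` are isomorphic to the degree 0 parts of the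
  -- explicit graded modules over `B`, to which the first statement applies.
  obtain ⟨φ⟩ := h0.standard_unique hX (GrMod.isStandard_zeroPart h0 l)
  obtain ⟨ψ⟩ := h0.costandard_unique hY (GrMod.isCostandard_zeroPart h0 m)
  obtain ⟨a⟩ := FDMod.nonempty_toGrMod_iso φ
  obtain ⟨b⟩ := FDMod.nonempty_toGrMod_iso ψ
  refine part1 l m _ _ (hS l) (hN m) n r ?_
  by_contra hcon
  rw [not_nontrivial_iff_subsingleton] at hcon
  exact not_subsingleton_iff_nontrivial.2 hne
    (Abelian.Ext.subsingleton_of_iso a ((GrMod.shiftBy 𝒜 r).mapIso b) hcon)
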